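/- Let $M=\partial\mathcal O\subset\mathbb R^3$ be a smooth compact surface bounding a bounded open set $\mathcal O$, diffeomorphic to $S^2$, invariant under all rotations about the $x_3$-axis, and with positive Gauss curvature everywhere. Let $\nu$ be the outward unit normal, $\chi(x)=e_3\cdot\nu(x)$, let $J:T_xM\to T_xM$, $Jv=\nu(x)\times v$, be counterclockwise rotation by $90^\circ$, let $X_3$ be the vector field generating the rotations about the $x_3$-axis, and let $\xi\in C^\infty(M)$ satisfy $J\nabla\xi=-X_3$ (this determines $\xi$ up to an additive constant). For $\Omega\in\mathbb R$ consider the Euler equation for vector fields $u(t)$ tangent to $M$, $$\frac{\partial u}{\partial t}+\nabla_u u=\Omega\,\chi\,Ju-\nabla p,\qquad \operatorname{div}u=0. \tag{1.1}$$ Let $f\in C^\infty(M)$ be zonal, i.e. invariant under rotations about the $x_3$-axis (so that $f$, $w=\Delta f$ and $\chi$ are functions of $\xi$). If $w(\xi)-\Omega\chi(\xi)$ is strictly monotone in $\xi$, in the sense that its derivative with respect to $\xi$ is bounded away from $0$ on $\xi(M)$, then $U=J\nabla f$ is a stationary solution of (1.1), and it is stable in $H^1(M)$: for every $\varepsilon>0$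 there is $\delta>0$ such that, for every $T>0$ and every solution $u\in C^1([0,T)\times M)$ of (1.1) with $\|u(0)-U\|_{H^1(M)}<\delta$, one has $\|u(t)-U\|_{H^1(M)}<\varepsilon$ for all $t\in[0,T)$. Here $\|X\|_{H^1(M)}^2=\int_M(|X|^2+|\nabla X|^2)\,dS$. -/

import Mathlib

open Set MeasureTheory
open scoped ContDiff

noncomputable section

namespace RotatingSurface

/-- Euclidean three-space. -/
abbrev E3 : Type := EuclideanSpace ℝ (Fin 3)

/-! ### The surface `M = ∂O`, its normal, tangent planes, curvature and area -/

/-- `g` is a smooth defining function of the open set `O` near `x`: on an open neighbourhood `U` of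
`x` it is smooth, has no critical points, and `O ∩ U = {g < 0} ∩ U`, `∂O ∩ U = {g = 0} ∩ U`. -/
def IsDefiningFunctionAt (O : Set E3) (g : E3 → ℝ) (x : E3) : Prop :=
  ∃ U : Set E3, IsOpen U ∧ x ∈ U ∧ ContDiffOn ℝ ∞ g U ∧
    ∀ y ∈ U, gradient g y ≠ 0 ∧ (y ∈ O ↔ g y < 0) ∧ (y ∈ frontier O ↔ g y = 0)

open Classical in
/-- The outward unit normal `ν(x) = ∇g(x) / |∇g(x)|` at a point `x` of `∂O`
(independent of the defining function `g`). -/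
def outwardNormal (O : Set E3) (x : E3) : E3 :=
  if h : ∃ g, IsDefiningFunctionAt O g x then
    ‖gradient h.choose x‖⁻¹ • gradient h.choose x
  else 0

/-- The tangent plane `T_x M = ν(x)^⊥`, for `M = ∂O`. -/
def tangentPlane (O : Set E3) (x : E3) : Submodule ℝ E3 :=
  (Submodule.span ℝ {outwardNormal O x})ᗮ

/-- The covariant derivative `v ↦ ∇_v X` at `x ∈ M`, an endomorphism of `T_x M`: the tangential part
of the derivative of `X` along `M`. (Derivatives within `M` are determined on `T_x M`, and only
tangential directions enter.) -/
def covDeriv (O : Set E3) (X : E3 → E3) (x : E3) : tangentPlane O x →L[ℝ] tangentPlane O x :=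
  (tangentPlane O x).orthogonalProjectionOnto ∘L
    (fderivWithin ℝ X (frontier O) x ∘L (tangentPlane O x).subtypeL)

/-- The Gauss curvature of `M = ∂O`: the determinant of the Weingarten map `dν` on `T_x M`. -/
def gaussCurvature (O : Set E3) (x : E3) : ℝ :=
  LinearMap.det (covDeriv O (outwardNormal O) x : tangentPlane O x →ₗ[ℝ] tangentPlane O x)

/-- The surface area measure of `M = ∂O`: two-dimensional Hausdorff measure, normalized to be
Lebesgue measure on planes. -/
def areaMeasure (O : Set E3) : Measure E3 :=
  (μHE[2] : Measure E3).restrict (frontier O)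

/-- Rotation by the angle `s` about the `x₃`-axis. -/
def rotation (s : ℝ) (x : E3) : E3 :=
  !₂[Real.cos s * x 0 - Real.sin s * x 1, Real.sin s * x 0 + Real.cos s * x 1, x 2]

/-- The vector field `X₃` generating the rotations about the `x₃`-axis. -/
def X3 (x : E3) : E3 := !₂[-x 1, x 0, 0]

/-- `M = ∂O` is a smooth compact surface in `ℝ³`, bounding the bounded open set `O`, diffeomorphic
to the unit sphere, invariant under rotations about the `x₃`-axis, with positive Gauss curvature. -/
structure IsRotationalBody (O : Set E3) : Prop where
  isOpen : IsOpen O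
  isBounded : Bornology.IsBounded O
  smooth_boundary : ∀ x ∈ frontier O, ∃ g, IsDefiningFunctionAt O g x
  diffeo_sphere : ∃ Φ Ψ : E3 → E3,
    ContDiffOn ℝ ∞ Φ (Metric.sphere 0 1) ∧ MapsTo Φ (Metric.sphere 0 1) (frontier O) ∧
    ContDiffOn ℝ ∞ Ψ (frontier O) ∧ MapsTo Ψ (frontier O) (Metric.sphere 0 1) ∧
    InvOn Ψ Φ (Metric.sphere 0 1) (frontier O)
  rotation_invariant : ∀ s : ℝ, ∀ x ∈ frontier O, rotation s x ∈ frontier O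
  curvature_pos : ∀ x ∈ frontier O, 0 < gaussCurvature O x

/-! ### Vector calculus on `M` -/

/-- The gradient `∇f(x) ∈ T_x M` of a function on `M`. -/
def surfaceGradient (O : Set E3) (f : E3 → ℝ) (x : E3) : E3 :=
  ((InnerProductSpace.toDual ℝ (tangentPlane O x)).symm
    (fderivWithin ℝ f (frontier O) x ∘L (tangentPlane O x).subtypeL) : tangentPlane O x)

/-- The divergence on `M`: the trace of the covariant derivative. -/
def surfaceDiv (O : Set E3) (X : E3 → E3) (x : E3) : ℝ :=
  LinearMap.trace ℝ (tangentPlane O x)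
    (covDeriv O X x : tangentPlane O x →ₗ[ℝ] tangentPlane O x)

/-- The Laplace–Beltrami operator `Δ = div ∇` on functions on `M`. -/
def laplaceBeltrami (O : Set E3) (f : E3 → ℝ) (x : E3) : ℝ :=
  surfaceDiv O (surfaceGradient O f) x

/-- The counterclockwise rotation by 90° in `T_x M` (seen from outside), `J v = ν(x) × v`. -/
def rotJ (O : Set E3) (x v : E3) : E3 :=
  WithLp.toLp 2 (crossProduct (WithLp.ofLp (outwardNormal O x)) (WithLp.ofLp v))

/-- `∇_v X` at `x`, as a vector in `ℝ³`, for `v` tangent to `M` at `x`. -/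
def covDerivAlong (O : Set E3) (v : E3) (X : E3 → E3) (x : E3) : E3 :=
  (covDeriv O X x ((tangentPlane O x).orthogonalProjectionOnto v) : tangentPlane O x)

/-- `χ(x) = e₃ · ν(x)`. -/
def chi (O : Set E3) (x : E3) : ℝ := outwardNormal O x 2

/-- `ξ ∈ C^∞(M)` with `J ∇ξ = -X₃` (this determines `ξ` up to an additive constant). -/
def IsRotationPotential (O : Set E3) (ξ : E3 → ℝ) : Prop :=
  ContDiffOn ℝ ∞ ξ (frontier O) ∧
    ∀ x ∈ frontier O, rotJ O x (surfaceGradient O ξ x) = -X3 x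

/-- `f ∈ C^∞(M)` is zonal, i.e. invariant under rotations about the `x₃`-axis. -/
def IsSmoothZonal (O : Set E3) (f : E3 → ℝ) : Prop :=
  ContDiffOn ℝ ∞ f (frontier O) ∧ ∀ s : ℝ, ∀ x ∈ frontier O, f (rotation s x) = f x

/-- The velocity field `u = J ∇f` with stream function `f`. -/
def streamField (O : Set E3) (f : E3 → ℝ) (x : E3) : E3 :=
  rotJ O x (surfaceGradient O f x)

/-- The `H¹(M)` norm of a vector field on `M`: the square root of
`∫_M (|X|² + |∇X|²) dS`, with the Hilbert–Schmidt norm `|∇X|² = tr ((∇X)* ∇X)`. -/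
def h1Norm (O : Set E3) (X : E3 → E3) : ℝ :=
  √(∫ x, (‖X x‖ ^ 2 + LinearMap.trace ℝ (tangentPlane O x)
    (ContinuousLinearMap.adjoint (covDeriv O X x) ∘L covDeriv O X x :
      tangentPlane O x →L[ℝ] tangentPlane O x)) ∂(areaMeasure O))

/-! ### The Euler equation with Coriolis term -/

/-- `u` is a (classical, `C¹` in space-time) solution on the time interval `I` of
`∂u/∂t + ∇_u u = Ω χ J u - ∇p`, `div u = 0`, for vector fields tangent to `M`. At an endpoint of `I`
the time derivative is one-sided. -/
structure IsEulerSolution (O : Set E3) (Ω : ℝ) (I : Set ℝ) (u : ℝ → E3 → E3) : Prop where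
  regular : ContDiffOn ℝ 1 (fun z : ℝ × E3 => u z.1 z.2) (I ×ˢ frontier O)
  tangent : ∀ t ∈ I, ∀ x ∈ frontier O, u t x ∈ tangentPlane O x
  div_free : ∀ t ∈ I, ∀ x ∈ frontier O, surfaceDiv O (u t) x = 0
  equation : ∃ p : ℝ → E3 → ℝ, (∀ t ∈ I, ContDiffOn ℝ 1 (p t) (frontier O)) ∧
    ∀ t ∈ I, ∀ x ∈ frontier O,
      derivWithin (fun s => u s x) I t + covDerivAlong O (u t x) (u t) x =
        (Ω * chi O x) • rotJ O x (u t x) - surfaceGradient O (p t) x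

/-- A stationary solution: the time-independent field `U` solves the equation for all times. -/
def IsStationarySolution (O : Set E3) (Ω : ℝ) (U : E3 → E3) : Prop :=
  IsEulerSolution O Ω univ (fun _ => U)

/-- (Lyapunov) stability of the field `U` in `H¹(M)`: solutions that start close to `U` in `H¹(M)`
stay close to `U` in `H¹(M)`, for as long as they exist, with `δ` depending only on `ε`
(and not on the solution or on its time of existence `T`). -/
def IsStableInH1 (O : Set E3) (Ω : ℝ) (U : E3 → E3) : Prop :=
  ∀ ε > 0, ∃ δ > 0, ∀ T > 0, ∀ u : ℝ → E3 → E3,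
    IsEulerSolution O Ω (Ico 0 T) u → h1Norm O (u 0 - U) < δ →
      ∀ t ∈ Ico 0 T, h1Norm O (u t - U) < ε

/-- The function `q` on the set `S ⊆ ℝ` has derivative bounded away from `0`. (Where `q` is not
differentiable within `S`, `derivWithin` is `0`, so differentiability is part of the condition.) -/
def DerivBoundedAwayFromZeroOn (q : ℝ → ℝ) (S : Set ℝ) : Prop :=
  ∃ b > 0, ∀ s ∈ S, b ≤ |derivWithin q S s|

end RotatingSurface

end

/-!
# Stability of zonal flows on rotating surfaces

Functions and fields on `M = ∂O` are extended to `ℝ³` (`exists_extension`), and the calculus of `M`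
is expressed by derivatives of the extensions in tangential directions, with an ambient extension
`N` of the outward normal (`IsNormalField`). A function of class `C^k` on `M` has tangential
derivatives that do not depend on the extension (`fderiv_eq_of_tangent`).

**The flow is stationary.** For a tangent field, `∇_u u = ∇(|u|²/2) + (rot u) Ju`
(`IsNormalField.inner_advection`), so for `u = J∇f` the equation says that the form `ζ df` is exact,
where `ζ = Δf - Ωχ` is the absolute vorticity. As `ζ` and `f` are both invariant under rotations, `ζ df`
is closed, and a closed form on a surface diffeomorphic to the sphere is exact: it has primitives on
the two charts of stereographic projection, whose common domain is connected
(`IsNormalField.exists_primitive`).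

**The flow is stable**, by the energy–Casimir method of Arnold. Let `ζ_t = rot u_t - Ωχ` be the
absolute vorticity of a solution and `ζ_U = q(ξ)` that of the stationary flow.

* `ζ_t` is transported by the flow, so `∫ Φ(ζ_t)` is conserved for each `C¹` function `Φ`. As the
  solution is only `C¹`, its vorticity is only continuous and the transport equation holds in the weak
  sense (`IsTransported`). The conservation law follows by averaging `ζ_t` with the kernel
  `(ε² + |x - y|²)⁻²`; as the velocity is Lipschitz, the averages are transported up to a
  commutator that tends to `0` uniformly (`IsNormalField.abs_commutator_le`,
  `IsTransported.integral_comp_eq`).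
* `∫ ξ ζ_t` is conserved: `∇ξ = JX₃`, and `X₃` is a Killing field that is tangent to `M`
  (`IsFlowExtension.integral_angular_momentum_eq`).
* The hypothesis on `q`, together with an upper bound for `|q'|`, makes `q` bi-Lipschitz; so there is
  `Φ` with `Φ' = q⁻¹`, and `±(Φ(z) - Φ(ζ_U) - ξ (z - ζ_U))` lies between two positive multiples of
  `(z - ζ_U)²` (`IsNormalField.exists_potential`). The upper bound comes from `|∇ξ| = |X₃|`, since a
  smooth field that vanishes on the axis is bounded by a multiple of `|X₃|`.

Hence `∫ (ζ_t - ζ_U)²` is bounded by a multiple of its value at time `0`. For a divergence-free tangent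
field `X`, the Bochner identity `∫ |∇X|² + ∫ K |X|² = ∫ (rot X)²` (`IsNormalField.integral_bochner`)
and `K > 0` bound the `H¹` norm by the vorticity (`IsNormalField.exists_h1Norm_sq_le`).

Integration by parts on `M` rests on the divergence theorem (`IsNormalField.integral_sdiv_eq_zero`),
proved in graph charts; the area formula for these (`map_areaMeasure_chart`) identifies the
two-dimensional Hausdorff measure with the surface element.
-/

open scoped RealInnerProductSpace

noncomputable section

namespace RotatingSurface

/-! ### Cross products and oriented frames -/

/-- The cross product of `ℝ³` as a continuous bilinear map on `E3`. -/
def crossL : E3 →L[ℝ] E3 →L[ℝ] E3 :=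
  LinearMap.toContinuousBilinearMap
    (LinearMap.mk₂ ℝ (fun a b : E3 => (WithLp.toLp 2
      (crossProduct (WithLp.ofLp a) (WithLp.ofLp b)) : E3))
      (by intro a b c; ext i; fin_cases i <;> simp [cross_apply])
      (by intro a b c; ext i; fin_cases i <;> simp [cross_apply])
      (by intro a b c; ext i; fin_cases i <;> simp [cross_apply] <;> ring)
      (by intro a b c; ext i; fin_cases i <;> simp [cross_apply]))

theorem crossL_apply (a b : E3) :
    crossL a b = WithLp.toLp 2 (crossProduct (WithLp.ofLp a) (WithLp.ofLp b)) := rfl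

theorem rotJ_eq (O : Set E3) (x v : E3) : rotJ O x v = crossL (outwardNormal O x) v := rfl

theorem inner_crossL_left (a b : E3) : ⟪a, crossL a b⟫ = 0 := by
  simp [crossL_apply, PiLp.inner_apply, Fin.sum_univ_three, cross_apply]; ring

theorem inner_crossL_right (a b : E3) : ⟪b, crossL a b⟫ = 0 := by
  simp [crossL_apply, PiLp.inner_apply, Fin.sum_univ_three, cross_apply]; ring

theorem crossL_swap (a b : E3) : crossL a b = - crossL b a := by
  ext i; fin_cases i <;> simp [crossL_apply, cross_apply, mul_comm]

theorem crossL_self (a : E3) : crossL a a = 0 := by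
  ext i; fin_cases i <;> simp [crossL_apply]

theorem inner_crossL_triple (a b c : E3) : ⟪crossL a b, c⟫ = - ⟪b, crossL a c⟫ := by
  simp [crossL_apply, PiLp.inner_apply, Fin.sum_univ_three, cross_apply]; ring

theorem inner_crossL_crossL (a b c d : E3) :
    ⟪crossL a b, crossL c d⟫ = ⟪a, c⟫ * ⟪b, d⟫ - ⟪a, d⟫ * ⟪b, c⟫ := by
  simp [crossL_apply, PiLp.inner_apply, Fin.sum_univ_three, cross_apply]; ring

theorem crossL_crossL (a b c : E3) :
    crossL a (crossL b c) = ⟪a, c⟫ • b - ⟪a, b⟫ • c := by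
  ext i
  fin_cases i <;>
    simp [crossL_apply, PiLp.inner_apply, Fin.sum_univ_three, cross_apply] <;> ring

/-- `(e₁, e₂)` is a positively oriented orthonormal frame of the plane orthogonal to the unit
vector `n`. -/
structure IsFrame (n e₁ e₂ : E3) : Prop where
  nn : ⟪n, n⟫ = 1
  e11 : ⟪e₁, e₁⟫ = 1
  e22 : ⟪e₂, e₂⟫ = 1
  e12 : ⟪e₁, e₂⟫ = 0
  e1n : ⟪e₁, n⟫ = 0
  e2n : ⟪e₂, n⟫ = 0
  cross1 : crossL n e₁ = e₂
  cross2 : crossL n e₂ = -e₁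
  cross12 : crossL e₁ e₂ = n

theorem exists_isFrame {n : E3} (hn : ⟪n, n⟫ = 1) : ∃ e₁ e₂, IsFrame n e₁ e₂ := by
  have hn0 : n ≠ 0 := by rintro rfl; simp at hn
  have : Fact (Module.finrank ℝ E3 = 2 + 1) := ⟨by simp⟩
  have hfr : Module.finrank ℝ (ℝ ∙ n)ᗮ = 2 := Submodule.finrank_orthogonal_span_singleton hn0
  have hb : 0 < Module.finrank ℝ (ℝ ∙ n)ᗮ := by rw [hfr]; norm_num
  let b := stdOrthonormalBasis ℝ (ℝ ∙ n)ᗮ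
  let e₁ : E3 := (b ⟨0, hb⟩ : (ℝ ∙ n)ᗮ)
  have h11 : ⟪e₁, e₁⟫ = 1 := by
    have := b.orthonormal.1 ⟨0, hb⟩
    rw [real_inner_self_eq_norm_sq]
    have h2 : ‖e₁‖ = 1 := this
    rw [h2]; norm_num
  have h1n : ⟪e₁, n⟫ = 0 := by
    rw [real_inner_comm]
    exact (Submodule.mem_orthogonal_singleton_iff_inner_right).1 (b ⟨0, hb⟩).2
  have hn1 : ⟪n, e₁⟫ = 0 := by rw [real_inner_comm]; exact h1n
  refine ⟨e₁, crossL n e₁, hn, h11, ?_, ?_, h1n, ?_, rfl, ?_, ?_⟩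
  · rw [inner_crossL_crossL, hn, h11, h1n, hn1]; norm_num
  · exact inner_crossL_right _ _
  · rw [real_inner_comm]; exact inner_crossL_left _ _
  · rw [crossL_crossL, hn, hn1]; simp
  · rw [crossL_crossL, h11, h1n]; simp

namespace IsFrame

variable {n e₁ e₂ : E3} (h : IsFrame n e₁ e₂)
include h

theorem n1 : ⟪n, e₁⟫ = 0 := by rw [real_inner_comm]; exact h.e1n
theorem n2 : ⟪n, e₂⟫ = 0 := by rw [real_inner_comm]; exact h.e2n
theorem e21 : ⟪e₂, e₁⟫ = 0 := by rw [real_inner_comm]; exact h.e12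

theorem orthonormal : Orthonormal ℝ ![e₁, e₂, n] := by
  rw [orthonormal_iff_ite]
  intro i j
  fin_cases i <;> fin_cases j <;>
    simp [h.e11, h.e22, h.nn, h.e12, h.e21, h.e1n, h.e2n, h.n1, h.n2,
      -inner_self_eq_norm_sq_to_K]

theorem exists_basis : ∃ b : OrthonormalBasis (Fin 3) ℝ E3, b 0 = e₁ ∧ b 1 = e₂ ∧ b 2 = n := by
  have hs : ⊤ ≤ Submodule.span ℝ (Set.range ![e₁, e₂, n]) := by
    rw [h.orthonormal.linearIndependent.span_eq_top_of_card_eq_finrank (by simp)]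
  refine ⟨OrthonormalBasis.mk h.orthonormal hs, ?_, ?_, ?_⟩ <;> simp

theorem expand (v : E3) : v = ⟪e₁, v⟫ • e₁ + ⟪e₂, v⟫ • e₂ + ⟪n, v⟫ • n := by
  obtain ⟨b, h0, h1, h2⟩ := h.exists_basis
  have := b.sum_repr v
  simp only [Fin.sum_univ_three, h0, h1, h2, OrthonormalBasis.repr_apply_apply] at this
  exact this.symm

theorem expand_tangent {v : E3} (hv : ⟪n, v⟫ = 0) : v = ⟪e₁, v⟫ • e₁ + ⟪e₂, v⟫ • e₂ := by
  have := h.expand v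
  rw [hv] at this
  simpa using this

theorem inner_expand (v w : E3) :
    ⟪v, w⟫ = ⟪e₁, v⟫ * ⟪e₁, w⟫ + ⟪e₂, v⟫ * ⟪e₂, w⟫ + ⟪n, v⟫ * ⟪n, w⟫ := by
  conv_lhs => rw [h.expand v]
  simp only [inner_add_left, real_inner_smul_left]

theorem ext_inner {v w : E3} (h1 : ⟪e₁, v⟫ = ⟪e₁, w⟫) (h2 : ⟪e₂, v⟫ = ⟪e₂, w⟫)
    (hn : ⟪n, v⟫ = ⟪n, w⟫) : v = w := by
  rw [h.expand v, h.expand w, h1, h2, hn]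

theorem trace_eq (A : E3 →L[ℝ] E3) :
    LinearMap.trace ℝ E3 A = ⟪e₁, A e₁⟫ + ⟪e₂, A e₂⟫ + ⟪n, A n⟫ := by
  obtain ⟨b, h0, h1, h2⟩ := h.exists_basis
  rw [LinearMap.trace_eq_sum_inner _ b]
  simp [Fin.sum_univ_three, h0, h1, h2]

/-- A frame is an orthonormal basis of the plane `n^⊥`. -/
theorem exists_tangent_basis :
    ∃ b : OrthonormalBasis (Fin 2) ℝ (ℝ ∙ n)ᗮ, (b 0 : E3) = e₁ ∧ (b 1 : E3) = e₂ := by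
  have hn0 : n ≠ 0 := by rintro rfl; simpa using h.nn
  have : Fact (Module.finrank ℝ E3 = 2 + 1) := ⟨by simp⟩
  have hfr : Module.finrank ℝ (ℝ ∙ n)ᗮ = 2 := Submodule.finrank_orthogonal_span_singleton hn0
  have m1 : e₁ ∈ (ℝ ∙ n)ᗮ := Submodule.mem_orthogonal_singleton_iff_inner_right.2 h.n1
  have m2 : e₂ ∈ (ℝ ∙ n)ᗮ := Submodule.mem_orthogonal_singleton_iff_inner_right.2 h.n2
  have ho : Orthonormal ℝ ![(⟨e₁, m1⟩ : (ℝ ∙ n)ᗮ), ⟨e₂, m2⟩] := by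
    rw [orthonormal_iff_ite]
    intro i j
    fin_cases i <;> fin_cases j <;>
      simp [Submodule.coe_inner, h.e11, h.e22, h.e12, h.e21,
        -inner_self_eq_norm_sq_to_K]
  have hs : ⊤ ≤ Submodule.span ℝ (Set.range ![(⟨e₁, m1⟩ : (ℝ ∙ n)ᗮ), ⟨e₂, m2⟩]) := by
    rw [ho.linearIndependent.span_eq_top_of_card_eq_finrank (by simp [hfr])]
  refine ⟨OrthonormalBasis.mk ho hs, ?_, ?_⟩ <;> simp

end IsFrame

/-- The trace over the plane `n^⊥` of an endomorphism of `ℝ³`, for a unit vector `n`. -/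
def trT (n : E3) (A : E3 →L[ℝ] E3) : ℝ :=
  LinearMap.trace ℝ E3 (A : E3 →ₗ[ℝ] E3) - ⟪n, A n⟫

theorem IsFrame.trT_eq {n e₁ e₂ : E3} (h : IsFrame n e₁ e₂) (A : E3 →L[ℝ] E3) :
    trT n A = ⟪e₁, A e₁⟫ + ⟪e₂, A e₂⟫ := by
  rw [trT, h.trace_eq]; ring

/-- The trace of an endomorphism of `ℝ³` as a continuous linear functional. -/
def traceL : (E3 →L[ℝ] E3) →L[ℝ] ℝ :=
  LinearMap.toContinuousLinearMap
    ((LinearMap.trace ℝ E3).comp (ContinuousLinearMap.coeLM ℝ : (E3 →L[ℝ] E3) →ₗ[ℝ] E3 →ₗ[ℝ] E3))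

theorem trT_eq_traceL (n : E3) (A : E3 →L[ℝ] E3) : trT n A = traceL A - ⟪n, A n⟫ := rfl

/-- The projection onto the plane `n^⊥`, for a unit vector `n`. -/
def projT (n : E3) : E3 →L[ℝ] E3 :=
  ContinuousLinearMap.id ℝ E3 - (innerSL ℝ n).smulRight n

theorem projT_apply (n v : E3) : projT n v = v - ⟪n, v⟫ • n := by
  simp [projT]

theorem projT_of_inner {n v : E3} (h : ⟪n, v⟫ = 0) : projT n v = v := by
  simp [projT_apply, h]

theorem inner_projT {n : E3} (hn : ⟪n, n⟫ = 1) (v : E3) : ⟪n, projT n v⟫ = 0 := by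
  simp [projT_apply, inner_sub_right, real_inner_smul_right, hn, -inner_self_eq_norm_sq_to_K]

theorem coe_orthogonalProjectionOnto_eq {n : E3} (hn : ⟪n, n⟫ = 1) (v : E3) :
    (((ℝ ∙ n)ᗮ.orthogonalProjectionOnto v : (ℝ ∙ n)ᗮ) : E3) = projT n v := by
  rw [Submodule.coe_orthogonalProjectionOnto_apply]
  apply Submodule.eq_starProjection_of_mem_orthogonal
  · exact Submodule.mem_orthogonal_singleton_iff_inner_right.2 (inner_projT hn v)
  · rw [projT_apply, sub_sub_cancel, Submodule.orthogonal_orthogonal]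
    exact Submodule.smul_mem _ _ (Submodule.mem_span_singleton_self n)

theorem inner_projT_of_inner {n e : E3} (he : ⟪e, n⟫ = 0) (v : E3) :
    ⟪e, projT n v⟫ = ⟪e, v⟫ := by
  simp [projT_apply, inner_sub_right, real_inner_smul_right, he]

section Plane

variable {n e₁ e₂ : E3} (h : IsFrame n e₁ e₂) (B : (ℝ ∙ n)ᗮ →L[ℝ] (ℝ ∙ n)ᗮ) (A : E3 →L[ℝ] E3)
  (hBA : ∀ v : (ℝ ∙ n)ᗮ, (B v : E3) = projT n (A v))
include h hBA

theorem IsFrame.trace_plane :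
    LinearMap.trace ℝ _ (B : (ℝ ∙ n)ᗮ →ₗ[ℝ] (ℝ ∙ n)ᗮ) = ⟪e₁, A e₁⟫ + ⟪e₂, A e₂⟫ := by
  obtain ⟨b, h0, h1⟩ := h.exists_tangent_basis
  rw [LinearMap.trace_eq_sum_inner _ b]
  simp only [Fin.sum_univ_two, Submodule.coe_inner, ContinuousLinearMap.coe_coe, hBA, h0, h1]
  rw [projT_apply, projT_apply]
  simp [inner_sub_right, real_inner_smul_right, h.e1n, h.e2n]

theorem IsFrame.det_plane :
    LinearMap.det (B : (ℝ ∙ n)ᗮ →ₗ[ℝ] (ℝ ∙ n)ᗮ) =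
      ⟪e₁, A e₁⟫ * ⟪e₂, A e₂⟫ - ⟪e₁, A e₂⟫ * ⟪e₂, A e₁⟫ := by
  obtain ⟨b, h0, h1⟩ := h.exists_tangent_basis
  rw [← LinearMap.det_toMatrix b.toBasis, Matrix.det_fin_two]
  simp only [LinearMap.toMatrix_apply, OrthonormalBasis.coe_toBasis, OrthonormalBasis.coe_toBasis_repr_apply,
    OrthonormalBasis.repr_apply_apply, Submodule.coe_inner, ContinuousLinearMap.coe_coe, hBA, h0, h1,
    projT_apply]
  simp [inner_sub_right, real_inner_smul_right, h.e1n, h.e2n]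

theorem IsFrame.trace_adjoint_plane :
    LinearMap.trace ℝ _ ((ContinuousLinearMap.adjoint B ∘L B : (ℝ ∙ n)ᗮ →L[ℝ] (ℝ ∙ n)ᗮ) :
      (ℝ ∙ n)ᗮ →ₗ[ℝ] (ℝ ∙ n)ᗮ) =
      ⟪e₁, A e₁⟫ ^ 2 + ⟪e₂, A e₁⟫ ^ 2 + ⟪e₁, A e₂⟫ ^ 2 + ⟪e₂, A e₂⟫ ^ 2 := by
  obtain ⟨b, h0, h1⟩ := h.exists_tangent_basis
  rw [LinearMap.trace_eq_sum_inner _ b]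
  simp only [Fin.sum_univ_two, ContinuousLinearMap.coe_coe, ContinuousLinearMap.comp_apply,
    ContinuousLinearMap.adjoint_inner_right]
  simp only [Submodule.coe_inner, hBA, h0, h1]
  rw [h.inner_expand (projT n (A e₁)), h.inner_expand (projT n (A e₂))]
  simp only [projT_apply, inner_sub_right, real_inner_smul_right, h.e1n, h.e2n, h.nn]
  ring

end Plane

/-! ### Local structure of the surface -/

open Filter Topology in
/-- Straightening of a surface near a point: `x ↦ x + (g x / |∇g(x₀)| - ⟨n, x - x₀⟩) n` has identity
derivative at `x₀`; its local inverse `Ψ` moves points along `n` and carries the affine tangent plane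
at `x₀` onto the surface. -/
theorem exists_local_straightening {O : Set E3} {x₀ : E3} (hx₀ : x₀ ∈ frontier O) {g : E3 → ℝ}
    (hg : IsDefiningFunctionAt O g x₀) :
    ∃ (Ψ : E3 → E3) (r : ℝ), 0 < r ∧ ContDiffOn ℝ ∞ Ψ (Metric.ball x₀ r) ∧ Ψ x₀ = x₀ ∧
      HasFDerivAt Ψ (ContinuousLinearMap.id ℝ E3) x₀ ∧
      (∀ y ∈ Metric.ball x₀ r, ∃ s : ℝ, Ψ y = y + s • (‖gradient g x₀‖⁻¹ • gradient g x₀)) ∧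
      (∀ y ∈ Metric.ball x₀ r, ⟪‖gradient g x₀‖⁻¹ • gradient g x₀, y - x₀⟫ = 0 →
        Ψ y ∈ frontier O) ∧
      (∀ y ∈ Metric.ball x₀ r, y ∈ frontier O →
        Ψ (x₀ + projT (‖gradient g x₀‖⁻¹ • gradient g x₀) (y - x₀)) = y) := by
  obtain ⟨U, hUo, hxU, hgU, hU⟩ := hg
  set G := gradient g x₀ with hG
  have hG0 : G ≠ 0 := (hU x₀ hxU).1
  have hGn : ‖G‖ ≠ 0 := norm_ne_zero_iff.2 hG0
  set n := ‖G‖⁻¹ • G with hn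
  have hnorm : ‖n‖ = 1 := by rw [hn, norm_smul, norm_inv, norm_norm, inv_mul_cancel₀ hGn]
  have hnn : ⟪n, n⟫ = 1 := by rw [real_inner_self_eq_norm_sq, hnorm]; norm_num
  have hgx₀ : g x₀ = 0 := (hU x₀ hxU).2.2.1 hx₀
  have hUn : U ∈ 𝓝 x₀ := hUo.mem_nhds hxU
  let F : E3 → E3 := fun x => x + (‖G‖⁻¹ * g x - ⟪n, x - x₀⟫) • n
  have hFU : ContDiffOn ℝ ∞ F U := by
    apply ContDiffOn.add contDiffOn_id
    have h1 : ContDiffOn ℝ ∞ (fun x => ‖G‖⁻¹ * g x - ⟪n, x - x₀⟫) U :=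
      (contDiffOn_const.mul hgU).sub
        (contDiff_const.inner ℝ (contDiff_id.sub contDiff_const)).contDiffOn
    exact h1.smul contDiffOn_const
  have hF0 : ContDiffAt ℝ ∞ F x₀ := hFU.contDiffAt hUn
  have hgd : HasFDerivAt g (innerSL ℝ G) x₀ := by
    have h1 : DifferentiableAt ℝ g x₀ := (hgU.contDiffAt hUn).differentiableAt (by simp)
    have := h1.hasGradientAt.hasFDerivAt
    exact this
  have hFd : HasFDerivAt F (ContinuousLinearMap.id ℝ E3) x₀ := by
    have h1 : HasFDerivAt (fun x => ‖G‖⁻¹ * g x - ⟪n, x - x₀⟫)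
        (‖G‖⁻¹ • innerSL ℝ G - innerSL ℝ n) x₀ := by
      apply HasFDerivAt.sub (hgd.const_mul _)
      have h2 := (innerSL ℝ n).hasFDerivAt.comp x₀ ((hasFDerivAt_id x₀).sub_const x₀)
      exact h2
    have h3 : ‖G‖⁻¹ • innerSL ℝ G - innerSL ℝ n = 0 := by
      rw [hn]; ext v; simp
    rw [h3] at h1
    have h4 := (hasFDerivAt_id x₀).add (h1.smul_const n)
    convert! h4 using 1
    ext v; simp
  let e := hF0.toOpenPartialHomeomorph F (f' := ContinuousLinearEquiv.refl ℝ E3) hFd (by simp)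
  have hecoe : (e : E3 → E3) = F := rfl
  have hes : x₀ ∈ e.source := hF0.mem_toOpenPartialHomeomorph_source _ _
  have hFx₀ : F x₀ = x₀ := by simp [F, hgx₀]
  have het : x₀ ∈ e.target := by
    have := hF0.image_mem_toOpenPartialHomeomorph_target (f' := ContinuousLinearEquiv.refl ℝ E3)
      hFd (by simp)
    rwa [hFx₀] at this
  have hsymm₀ : e.symm x₀ = x₀ := by
    have := e.left_inv hes
    rwa [hecoe, hFx₀] at this
  have hcont : ContinuousAt e.symm x₀ := e.continuousAt_symm het
  -- the derivative of `F` stays invertible near `x₀`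
  have hinv : ∀ᶠ x in 𝓝 x₀, fderiv ℝ F x ∈ Set.range ((↑) : (E3 ≃L[ℝ] E3) → (E3 →L[ℝ] E3)) := by
    have h1 : ContinuousAt (fderiv ℝ F) x₀ :=
      (hF0.fderiv_right (m := 0) (by simp)).continuousAt
    apply h1
    apply ContinuousLinearEquiv.isOpen.mem_nhds
    exact ⟨ContinuousLinearEquiv.refl ℝ E3, by rw [hFd.fderiv]; rfl⟩
  have hev : ∀ᶠ y in 𝓝 x₀, y ∈ e.source ∧ y ∈ e.target ∧ y ∈ U ∧ e.symm y ∈ U ∧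
      fderiv ℝ F (e.symm y) ∈ Set.range ((↑) : (E3 ≃L[ℝ] E3) → (E3 →L[ℝ] E3)) := by
    have t1 : Tendsto e.symm (𝓝 x₀) (𝓝 x₀) := by
      have := hcont.tendsto; rwa [hsymm₀] at this
    filter_upwards [e.open_source.mem_nhds hes, e.open_target.mem_nhds het, hUn,
      t1.eventually hUn, t1.eventually hinv] with y h1 h2 h3 h4 h5
    exact ⟨h1, h2, h3, h4, h5⟩
  obtain ⟨r, hr, hball⟩ := Metric.eventually_nhds_iff_ball.1 hev
  refine ⟨e.symm, r, hr, ?_, hsymm₀, ?_, ?_, ?_, ?_⟩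
  · intro y hy
    obtain ⟨-, h2, -, h4, f', h5⟩ := hball y hy
    apply ContDiffAt.contDiffWithinAt
    have hd : HasFDerivAt F (f' : E3 →L[ℝ] E3) (e.symm y) := by
      rw [h5]
      exact ((hFU.contDiffAt (hUo.mem_nhds h4)).differentiableAt (by simp)).hasFDerivAt
    exact e.contDiffAt_symm h2 hd (hFU.contDiffAt (hUo.mem_nhds h4))
  · have := e.hasFDerivAt_symm (f' := ContinuousLinearEquiv.refl ℝ E3) het
      (by rw [hsymm₀]; exact hFd)
    exact this
  · intro y hy
    obtain ⟨-, h2, -, h4, -⟩ := hball y hy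
    have h6 : F (e.symm y) = y := e.right_inv h2
    refine ⟨-(‖G‖⁻¹ * g (e.symm y) - ⟪n, e.symm y - x₀⟫), ?_⟩
    nth_rewrite 2 [← h6]
    simp only [F]
    module
  · intro y hy h0
    obtain ⟨-, h2, -, h4, -⟩ := hball y hy
    have h6 : F (e.symm y) = y := e.right_inv h2
    rw [← h6] at h0
    have h7 : ‖G‖⁻¹ * g (e.symm y) = 0 := by
      have : e.symm y + (‖G‖⁻¹ * g (e.symm y) - ⟪n, e.symm y - x₀⟫) • n - x₀ =
        (e.symm y - x₀) + (‖G‖⁻¹ * g (e.symm y) - ⟪n, e.symm y - x₀⟫) • n := by abel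
      simp only [F] at h0
      rw [this, inner_add_right, real_inner_smul_right, hnn] at h0
      linarith
    have h8 : g (e.symm y) = 0 := by
      rcases mul_eq_zero.1 h7 with h | h
      · exact absurd h (inv_ne_zero hGn)
      · exact h
    exact (hU _ h4).2.2.2 h8
  · intro y hy hyM
    obtain ⟨h1, -, h3, -, -⟩ := hball y hy
    have h6 : e.symm (F y) = y := e.left_inv h1
    have h7 : g y = 0 := (hU y h3).2.2.1 hyM
    have h8 : F y = x₀ + projT n (y - x₀) := by
      simp only [F, h7, projT_apply]; module
    rw [← h8]; exact h6

theorem norm_projT_le {n : E3} (hn : ⟪n, n⟫ = 1) (v : E3) : ‖projT n v‖ ≤ ‖v‖ := by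
  have h : ‖projT n v‖ ^ 2 ≤ ‖v‖ ^ 2 := by
    rw [← real_inner_self_eq_norm_sq, ← real_inner_self_eq_norm_sq, projT_apply]
    simp only [inner_sub_left, inner_sub_right, real_inner_smul_left, real_inner_smul_right, hn,
      real_inner_comm n v]
    nlinarith [sq_nonneg ⟪n, v⟫]
  exact (sq_le_sq₀ (norm_nonneg _) (norm_nonneg _)).1 h

open Filter Topology in
/-- Near each of its points, the surface is a smooth retract of a ball, and the derivative of the
retraction is the tangential projection. -/
theorem exists_local_retraction {O : Set E3} {x₀ : E3} (hx₀ : x₀ ∈ frontier O) {g : E3 → ℝ}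
    (hg : IsDefiningFunctionAt O g x₀) :
    ∃ (ρ : E3 → E3) (r : ℝ), 0 < r ∧ ContDiffOn ℝ ∞ ρ (Metric.ball x₀ r) ∧
      HasFDerivAt ρ (projT (‖gradient g x₀‖⁻¹ • gradient g x₀)) x₀ ∧
      MapsTo ρ (Metric.ball x₀ r) (frontier O) ∧
      (∀ y ∈ Metric.ball x₀ r, y ∈ frontier O → ρ y = y) := by
  obtain ⟨Ψ, r, hr, hs, h0, hd, -, hM, hid⟩ := exists_local_straightening hx₀ hg
  have hG0 : gradient g x₀ ≠ 0 := by
    obtain ⟨U, -, hxU, -, hU⟩ := hg; exact (hU x₀ hxU).1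
  set n := ‖gradient g x₀‖⁻¹ • gradient g x₀ with hn
  have hnn : ⟪n, n⟫ = 1 := by
    rw [real_inner_self_eq_norm_sq, hn, norm_smul, norm_inv, norm_norm,
      inv_mul_cancel₀ (norm_ne_zero_iff.2 hG0)]; norm_num
  have hQ : MapsTo (fun y => x₀ + projT n (y - x₀)) (Metric.ball x₀ r) (Metric.ball x₀ r) := by
    intro y hy
    rw [Metric.mem_ball, dist_eq_norm] at hy ⊢
    simpa using (norm_projT_le hnn (y - x₀)).trans_lt hy
  refine ⟨fun y => Ψ (x₀ + projT n (y - x₀)), r, hr, ?_, ?_, ?_, ?_⟩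
  · apply hs.comp _ hQ
    exact (contDiff_const.add ((projT n).contDiff.comp (contDiff_id.sub contDiff_const))).contDiffOn
  · have h1 : HasFDerivAt (fun y => x₀ + projT n (y - x₀)) (projT n) x₀ :=
      ((projT n).hasFDerivAt.comp x₀ ((hasFDerivAt_id x₀).sub_const x₀)).const_add x₀
    have h2 : HasFDerivAt Ψ (ContinuousLinearMap.id ℝ E3) (x₀ + projT n (x₀ - x₀)) := by
      simpa using hd
    exact h2.comp x₀ h1
  · intro y hy
    apply hM _ (hQ hy)
    rw [add_sub_cancel_left]
    exact inner_projT hnn _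
  · intro y hy hyM
    exact hid y hy hyM

open Filter Topology in
theorem mem_tangentCone_of_defining {O : Set E3} {x₀ : E3} (hx₀ : x₀ ∈ frontier O) {g : E3 → ℝ}
    (hg : IsDefiningFunctionAt O g x₀) {v : E3} (hv : ⟪gradient g x₀, v⟫ = 0) :
    v ∈ tangentConeAt ℝ (frontier O) x₀ := by
  obtain ⟨ρ, r, hr, -, hd, hM, hid⟩ := exists_local_retraction hx₀ hg
  have h1 := (hd.hasFDerivWithinAt (s := Metric.ball x₀ r)).mapsTo_tangent_cone
  have h2 : v ∈ tangentConeAt ℝ (Metric.ball x₀ r) x₀ := by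
    rw [tangentConeAt_of_mem_nhds (Metric.ball_mem_nhds x₀ hr)]; trivial
  have h3 := h1 h2
  rw [projT_of_inner (by rw [real_inner_smul_left, hv, mul_zero]),
    hid x₀ (Metric.mem_ball_self hr) hx₀] at h3
  exact tangentConeAt_mono hM.image_subset h3

open Filter Topology in
theorem eventually_pos_of_hasDerivAt_pos {f : ℝ → ℝ} {f' : ℝ} (hf : HasDerivAt f f' 0)
    (h0 : f 0 = 0) (hf' : 0 < f') : ∀ᶠ s in 𝓝[>] (0 : ℝ), 0 < f s := by
  have h1 := hasDerivAt_iff_tendsto_slope.1 hf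
  have h2 : ∀ᶠ s in 𝓝[≠] (0 : ℝ), 0 < slope f 0 s := h1.eventually (lt_mem_nhds hf')
  have h3 : ∀ᶠ s in 𝓝[>] (0 : ℝ), 0 < slope f 0 s :=
    h2.filter_mono (nhdsWithin_mono _ (fun s hs => ne_of_gt hs))
  filter_upwards [h3, self_mem_nhdsWithin] with s hs hs0
  have hs0' : (0 : ℝ) < s := hs0
  rw [slope_def_field, h0, sub_zero, sub_zero] at hs
  exact (div_pos_iff_of_pos_right hs0').1 hs

open Filter Topology in
/-- The outward unit normal may be computed from any defining function. -/
theorem outwardNormal_eq {O : Set E3} {x₀ : E3} (hx₀ : x₀ ∈ frontier O) {g : E3 → ℝ}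
    (hg : IsDefiningFunctionAt O g x₀) :
    outwardNormal O x₀ = ‖gradient g x₀‖⁻¹ • gradient g x₀ := by
  have hex : ∃ g, IsDefiningFunctionAt O g x₀ := ⟨g, hg⟩
  have hg' := hex.choose_spec
  rw [outwardNormal, dif_pos hex]
  set g' := hex.choose
  obtain ⟨U, hUo, hxU, hgU, hU⟩ := id hg
  obtain ⟨U', hUo', hxU', hgU', hU'⟩ := id hg'
  set G := gradient g x₀ with hG
  set G' := gradient g' x₀ with hG'
  have hG0 : G ≠ 0 := (hU x₀ hxU).1
  have hG0' : G' ≠ 0 := (hU' x₀ hxU').1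
  have hgd : HasFDerivAt g (innerSL ℝ G) x₀ :=
    ((hgU.contDiffAt (hUo.mem_nhds hxU)).differentiableAt (by simp)).hasGradientAt.hasFDerivAt
  have hgd' : HasFDerivAt g' (innerSL ℝ G') x₀ :=
    ((hgU'.contDiffAt (hUo'.mem_nhds hxU')).differentiableAt (by simp)).hasGradientAt.hasFDerivAt
  have hperp : ∀ v, ⟪G', v⟫ = 0 → ⟪G, v⟫ = 0 := by
    intro v hv
    have hc := mem_tangentCone_of_defining hx₀ hg' hv
    have h1 : HasFDerivWithinAt g (0 : E3 →L[ℝ] ℝ) (frontier O) x₀ := by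
      have : HasFDerivWithinAt (fun _ : E3 => (0 : ℝ)) (0 : E3 →L[ℝ] ℝ) (frontier O) x₀ :=
        hasFDerivWithinAt_const _ _ _
      refine this.congr_of_eventuallyEq ?_ ((hU x₀ hxU).2.2.1 hx₀)
      filter_upwards [self_mem_nhdsWithin, mem_nhdsWithin_of_mem_nhds (hUo.mem_nhds hxU)]
        with y hy hyU
      exact (hU y hyU).2.2.1 hy
    exact hgd.hasFDerivWithinAt.unique_on h1 hc
  have hGc : G ∈ (ℝ ∙ G') := by
    rw [← Submodule.orthogonal_orthogonal (ℝ ∙ G')]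
    rw [Submodule.mem_orthogonal]
    intro u hu
    rw [real_inner_comm]
    exact hperp u (Submodule.mem_orthogonal_singleton_iff_inner_right.1 hu)
  obtain ⟨c, hc⟩ := Submodule.mem_span_singleton.1 hGc
  have hc0 : 0 < c := by
    by_contra hneg
    have hc1 : c ≠ 0 := by rintro rfl; rw [zero_smul] at hc; exact hG0 hc.symm
    have hc2 : c < 0 := lt_of_le_of_ne (not_lt.1 hneg) hc1
    have hGG : 0 < ⟪G', G'⟫ := by rw [real_inner_self_eq_norm_sq]; positivity
    have hpath : HasDerivAt (fun s : ℝ => x₀ - s • G') (-G') 0 := by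
      have := ((hasDerivAt_id (0 : ℝ)).smul_const G').const_sub x₀
      simpa using this
    have hx0 : x₀ = (fun s : ℝ => x₀ - s • G') 0 := by simp
    have hd1 : HasDerivAt (fun s : ℝ => g (x₀ - s • G')) (innerSL ℝ G (-G')) 0 := by
      rw [hx0] at hgd
      exact hgd.comp_hasDerivAt 0 hpath
    have hd2 : HasDerivAt (fun s : ℝ => - g' (x₀ - s • G')) (-innerSL ℝ G' (-G')) 0 := by
      rw [hx0] at hgd'
      exact (hgd'.comp_hasDerivAt 0 hpath).neg
    have hz : g x₀ = 0 := (hU x₀ hxU).2.2.1 hx₀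
    have hz' : g' x₀ = 0 := (hU' x₀ hxU').2.2.1 hx₀
    have hp1 := eventually_pos_of_hasDerivAt_pos hd1 (by simpa using hz) (by
      rw [innerSL_apply_apply, inner_neg_right, ← hc, real_inner_smul_left]
      nlinarith)
    have hp2 := eventually_pos_of_hasDerivAt_pos hd2 (by simpa using hz') (by
      simpa [-inner_self_eq_norm_sq_to_K] using hGG)
    have hcont : Tendsto (fun s : ℝ => x₀ - s • G') (𝓝[>] 0) (𝓝 x₀) := by
      have := hpath.continuousAt.tendsto
      simp only [zero_smul, sub_zero] at this
      exact this.mono_left nhdsWithin_le_nhds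
    have hall := ((hp1.and hp2).and ((hcont.eventually (hUo.mem_nhds hxU)).and
      (hcont.eventually (hUo'.mem_nhds hxU'))))
    obtain ⟨s, ⟨h1, h2⟩, h3, h4⟩ := hall.exists
    have h5 : x₀ - s • G' ∈ O := (hU' _ h4).2.1.2 (by linarith)
    have h6 := (hU _ h3).2.1.1 h5
    linarith
  rw [← hc, norm_smul, Real.norm_eq_abs, abs_of_pos hc0, smul_smul, mul_inv]
  congr 1
  field_simp

theorem IsDefiningFunctionAt.eventually {O : Set E3} {x₀ : E3} {g : E3 → ℝ}
    (hg : IsDefiningFunctionAt O g x₀) :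
    ∃ U : Set E3, IsOpen U ∧ x₀ ∈ U ∧ ContDiffOn ℝ ∞ g U ∧
      ∀ y ∈ U, gradient g y ≠ 0 ∧ IsDefiningFunctionAt O g y := by
  obtain ⟨U, hUo, hxU, hgU, hU⟩ := hg
  exact ⟨U, hUo, hxU, hgU, fun y hy => ⟨(hU y hy).1, U, hUo, hy, hgU, hU⟩⟩

theorem contDiffOn_gradient {g : E3 → ℝ} {U : Set E3} (hU : IsOpen U) (hg : ContDiffOn ℝ ∞ g U) :
    ContDiffOn ℝ ∞ (gradient g) U := by
  have h1 : ContDiffOn ℝ ∞ (fderiv ℝ g) U := hg.fderiv_of_isOpen hU (by simp)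
  exact (InnerProductSpace.toDual ℝ E3).symm.toContinuousLinearEquiv.contDiff.comp_contDiffOn h1

theorem contDiffOn_normalized_gradient {g : E3 → ℝ} {U : Set E3} (hU : IsOpen U)
    (hg : ContDiffOn ℝ ∞ g U) (h0 : ∀ y ∈ U, gradient g y ≠ 0) :
    ContDiffOn ℝ ∞ (fun y => ‖gradient g y‖⁻¹ • gradient g y) U := by
  have h1 := contDiffOn_gradient hU hg
  exact ((h1.norm ℝ h0).inv (fun y hy => norm_ne_zero_iff.2 (h0 y hy))).smul h1

section Body

variable {O : Set E3} (hO : ∀ x ∈ frontier O, ∃ g, IsDefiningFunctionAt O g x)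
include hO

theorem inner_outwardNormal_self {x : E3} (hx : x ∈ frontier O) :
    ⟪outwardNormal O x, outwardNormal O x⟫ = 1 := by
  obtain ⟨g, hg⟩ := hO x hx
  have hG0 : gradient g x ≠ 0 := by
    obtain ⟨U, -, hxU, -, hU⟩ := hg; exact (hU x hxU).1
  rw [outwardNormal_eq hx hg, real_inner_self_eq_norm_sq, norm_smul, norm_inv, norm_norm,
      inv_mul_cancel₀ (norm_ne_zero_iff.2 hG0)]
  norm_num

theorem mem_tangentCone {x v : E3} (hx : x ∈ frontier O) (hv : ⟪outwardNormal O x, v⟫ = 0) :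
    v ∈ tangentConeAt ℝ (frontier O) x := by
  obtain ⟨g, hg⟩ := hO x hx
  have hG0 : gradient g x ≠ 0 := by
    obtain ⟨U, -, hxU, -, hU⟩ := hg; exact (hU x hxU).1
  rw [outwardNormal_eq hx hg, real_inner_smul_left] at hv
  refine mem_tangentCone_of_defining hx hg ((mul_eq_zero.1 hv).resolve_left ?_)
  exact inv_ne_zero (norm_ne_zero_iff.2 hG0)

theorem contDiffOn_outwardNormal : ContDiffOn ℝ ∞ (outwardNormal O) (frontier O) := by
  intro x hx
  obtain ⟨g, hg⟩ := hO x hx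
  obtain ⟨U, hUo, hxU, hgU, hU⟩ := hg.eventually
  have h1 := (contDiffOn_normalized_gradient hUo hgU (fun y hy => (hU y hy).1)).contDiffAt
    (hUo.mem_nhds hxU)
  refine h1.contDiffWithinAt.congr_of_eventuallyEq ?_ (outwardNormal_eq hx hg)
  filter_upwards [self_mem_nhdsWithin, mem_nhdsWithin_of_mem_nhds (hUo.mem_nhds hxU)] with y hy hyU
  exact outwardNormal_eq hy (hU y hyU).2

open Filter Topology in
/-- Derivatives in tangential directions only depend on the values on the surface. -/
theorem fderiv_eq_of_tangent {F : Type*} [NormedAddCommGroup F] [NormedSpace ℝ F]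
    {f₁ f₂ : E3 → F} {L₁ L₂ : E3 →L[ℝ] F} {x v : E3} (hx : x ∈ frontier O)
    (h₁ : HasFDerivWithinAt f₁ L₁ (frontier O) x) (h₂ : HasFDerivWithinAt f₂ L₂ (frontier O) x)
    (heq : f₁ =ᶠ[𝓝[frontier O] x] f₂) (hv : ⟪outwardNormal O x, v⟫ = 0) : L₁ v = L₂ v := by
  have h3 : HasFDerivWithinAt f₁ L₂ (frontier O) x :=
    h₂.congr_of_eventuallyEq heq (heq.self_of_nhdsWithin hx)
  exact h₁.unique_on h3 (mem_tangentCone hO hx hv)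

/-! ### Extension of functions on the surface to `ℝ³` -/

open scoped Manifold in
theorem exists_extension_family (hK : IsCompact (frontier O)) :
    ∃ (ι : Type) (_ : Fintype ι) (φ : ι → E3 → ℝ) (ρ : ι → E3 → E3) (W : ι → Set E3),
      (∀ i, ContDiff ℝ ∞ (φ i)) ∧ (∀ i, HasCompactSupport (φ i)) ∧ (∀ i, IsOpen (W i)) ∧
      (∀ i, tsupport (φ i) ⊆ W i) ∧ (∀ i, ContDiffOn ℝ ∞ (ρ i) (W i)) ∧
      (∀ i, MapsTo (ρ i) (W i) (frontier O)) ∧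
      (∀ i, ∀ x ∈ W i, x ∈ frontier O → ρ i x = x) ∧ ∀ x ∈ frontier O, ∑ i, φ i x = 1 := by
  have hloc : ∀ x : E3, ∃ (ρ : E3 → E3) (r : ℝ), 0 < r ∧ (x ∈ frontier O →
      ContDiffOn ℝ ∞ ρ (Metric.ball x r) ∧ MapsTo ρ (Metric.ball x r) (frontier O) ∧
      ∀ y ∈ Metric.ball x r, y ∈ frontier O → ρ y = y) := by
    intro x
    by_cases hx : x ∈ frontier O
    · obtain ⟨g, hg⟩ := hO x hx
      obtain ⟨ρ, r, hr, h1, -, h2, h3⟩ := exists_local_retraction hx hg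
      exact ⟨ρ, r, hr, fun _ => ⟨h1, h2, h3⟩⟩
    · exact ⟨id, 1, one_pos, fun h => absurd h hx⟩
  choose ρ r hr h using hloc
  obtain ⟨t, htM, ht⟩ := hK.elim_nhds_subcover (fun x => Metric.ball x (r x))
    (fun x _ => Metric.ball_mem_nhds x (hr x))
  obtain ⟨n, ⟨en⟩⟩ : ∃ n, Nonempty (Fin n ≃ t) := ⟨_, ⟨t.equivFin.symm⟩⟩
  obtain ⟨f, hf⟩ := SmoothPartitionOfUnity.exists_isSubordinate 𝓘(ℝ, E3) hK.isClosed
    (fun i : Fin n => Metric.ball (en i : E3) (r (en i))) (fun i => Metric.isOpen_ball) (by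
      intro x hx
      obtain ⟨y, hy, hxy⟩ := mem_iUnion₂.1 (ht hx)
      refine mem_iUnion.2 ⟨en.symm ⟨y, hy⟩, ?_⟩
      simpa using hxy)
  refine ⟨Fin n, inferInstance, fun i => f i, fun i => ρ (en i),
    fun i => Metric.ball (en i : E3) (r (en i)), ?_, ?_, ?_, ?_, ?_, ?_, ?_, ?_⟩
  · intro i; exact (f i).contMDiff.contDiff
  · intro i
    apply HasCompactSupport.intro' (K := tsupport (f i))
    · exact (Metric.isCompact_of_isClosed_isBounded (isClosed_tsupport _)
        (Metric.isBounded_ball.subset (hf i)))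
    · exact isClosed_tsupport _
    · intro x hx; exact image_eq_zero_of_notMem_tsupport hx
  · intro i; exact Metric.isOpen_ball
  · exact hf
  · intro i; exact (h _ (htM _ (en i).2)).1
  · intro i; exact (h _ (htM _ (en i).2)).2.1
  · intro i; exact (h _ (htM _ (en i).2)).2.2
  · intro x hx
    have := f.sum_eq_one hx
    rwa [finsum_eq_sum_of_fintype] at this

/-- Extension of time-dependent `C^k` functions on the surface to `ℝ³`. -/
theorem exists_extension_time (hK : IsCompact (frontier O)) {F : Type*} [NormedAddCommGroup F]
    [NormedSpace ℝ F] {k : WithTop ℕ∞} (hk : k ≤ ∞) {I : Set ℝ} {f : ℝ → E3 → F}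
    (hf : ContDiffOn ℝ k (fun z : ℝ × E3 => f z.1 z.2) (I ×ˢ frontier O)) :
    ∃ F' : ℝ → E3 → F, ContDiffOn ℝ k (fun z : ℝ × E3 => F' z.1 z.2) (I ×ˢ univ) ∧
      (∀ t, ∀ x ∈ frontier O, F' t x = f t x) ∧
      ∃ C : Set E3, IsCompact C ∧ ∀ t, ∀ x ∉ C, F' t x = 0 := by
  obtain ⟨ι, _, φ, ρ, W, h1, h2, h3, h4, h5, h6, h7, h8⟩ := exists_extension_family hO hK
  refine ⟨fun t x => ∑ i, φ i x • f t (ρ i x), ?_, ?_, ?_⟩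
  · apply ContDiffOn.sum
    intro i _ z hz
    by_cases hzW : z.2 ∈ W i
    · have hW : (univ : Set ℝ) ×ˢ W i ∈ nhds z :=
        (isOpen_univ.prod (h3 i)).mem_nhds ⟨trivial, hzW⟩
      have ha : ContDiffWithinAt ℝ k (fun z : ℝ × E3 => φ i z.2) (I ×ˢ W i) z :=
        (((h1 i).of_le hk).comp contDiff_snd).contDiffWithinAt
      have hb : ContDiffOn ℝ k (fun z : ℝ × E3 => (z.1, ρ i z.2)) (I ×ˢ W i) :=
        contDiff_fst.contDiffOn.prodMk
          (((h5 i).of_le hk).comp contDiff_snd.contDiffOn (fun z hz => hz.2))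
      have hc : ContDiffOn ℝ k (fun z : ℝ × E3 => f z.1 (ρ i z.2)) (I ×ˢ W i) :=
        hf.comp hb (fun z hz => ⟨hz.1, h6 i hz.2⟩)
      have hd := ha.smul (hc z ⟨hz.1, hzW⟩)
      have : I ×ˢ W i = (I ×ˢ univ) ∩ (univ ×ˢ W i) := by
        ext ⟨a, b⟩; simp
      rw [this] at hd
      exact (contDiffWithinAt_inter hW).1 hd
    · have hz0 : z.2 ∉ tsupport (φ i) := fun h => hzW (h4 i h)
      have : (fun z : ℝ × E3 => φ i z.2 • f z.1 (ρ i z.2)) =ᶠ[nhds z] fun _ => 0 := by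
        have hop : IsOpen ((fun z : ℝ × E3 => z.2) ⁻¹' (tsupport (φ i))ᶜ) :=
          (isClosed_tsupport _).isOpen_compl.preimage continuous_snd
        filter_upwards [hop.mem_nhds hz0] with y hy
        rw [image_eq_zero_of_notMem_tsupport hy, zero_smul]
      exact (contDiffAt_const.congr_of_eventuallyEq this).contDiffWithinAt
  · intro t x hx
    have : ∀ i, φ i x • f t (ρ i x) = φ i x • f t x := by
      intro i
      by_cases hxW : x ∈ W i
      · rw [h7 i x hxW hx]
      · rw [image_eq_zero_of_notMem_tsupport (fun h => hxW (h4 i h)), zero_smul, zero_smul]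
    simp only [this, ← Finset.sum_smul, h8 x hx, one_smul]
  · refine ⟨⋃ i, tsupport (φ i), isCompact_iUnion (fun i => h2 i), ?_⟩
    intro t x hx
    simp only [mem_iUnion, not_exists] at hx
    exact Finset.sum_eq_zero (fun i _ => by
      rw [image_eq_zero_of_notMem_tsupport (hx i), zero_smul])

theorem exists_extension (hK : IsCompact (frontier O)) {F : Type*} [NormedAddCommGroup F]
    [NormedSpace ℝ F] {k : WithTop ℕ∞} (hk : k ≤ ∞) {f : E3 → F}
    (hf : ContDiffOn ℝ k f (frontier O)) :
    ∃ F' : E3 → F, ContDiff ℝ k F' ∧ HasCompactSupport F' ∧ ∀ x ∈ frontier O, F' x = f x := by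
  obtain ⟨F', h1, h2, C, hC, h3⟩ := exists_extension_time hO hK hk (I := univ)
    (f := fun _ x => f x) (hf.comp contDiff_snd.contDiffOn (fun z hz => hz.2))
  refine ⟨F' 0, ?_, HasCompactSupport.intro hC (h3 0), h2 0⟩
  rw [univ_prod_univ, contDiffOn_univ] at h1
  exact h1.comp (contDiff_const.prodMk contDiff_id)

end Body

/-! ### Vector calculus through ambient extensions -/

theorem two_le_infty : (2 : WithTop ℕ∞) ≤ ∞ :=
  WithTop.coe_le_coe.2 (le_top : (2 : ℕ∞) ≤ ⊤)

theorem inner_crossL_cyclic (a b c : E3) : ⟪a, crossL b c⟫ = ⟪crossL a b, c⟫ := by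
  simp [crossL_apply, PiLp.inner_apply, Fin.sum_univ_three, cross_apply]; ring

/-- `N` is a smooth vector field on `ℝ³` that restricts to the outward normal of the compact smooth
surface `M = ∂O`. -/
structure IsNormalField (O : Set E3) (N : E3 → E3) : Prop where
  smooth_boundary : ∀ x ∈ frontier O, ∃ g, IsDefiningFunctionAt O g x
  isCompact : IsCompact (frontier O)
  smooth : ContDiff ℝ ∞ N
  eq : ∀ x ∈ frontier O, N x = outwardNormal O x

theorem IsRotationalBody.isCompact {O : Set E3} (hO : IsRotationalBody O) :
    IsCompact (frontier O) :=
  Metric.isCompact_of_isClosed_isBounded isClosed_frontier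
    (hO.isBounded.closure.subset frontier_subset_closure)

theorem IsRotationalBody.exists_isNormalField {O : Set E3} (hO : IsRotationalBody O) :
    ∃ N, IsNormalField O N := by
  obtain ⟨N, h1, -, h2⟩ := exists_extension hO.smooth_boundary hO.isCompact le_rfl
    (contDiffOn_outwardNormal hO.smooth_boundary)
  exact ⟨N, hO.smooth_boundary, hO.isCompact, h1, h2⟩

/-- The divergence over `M` of the ambient vector field `X`, computed from its derivative in `ℝ³`. -/
def sdiv (N X : E3 → E3) (x : E3) : ℝ := trT (N x) (fderiv ℝ X x)

/-- The scalar curl over `M` of a tangent field, `rot X = - div (J X)`. -/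
def srot (N X : E3 → E3) (x : E3) : ℝ := - sdiv N (fun y => crossL (N y) (X y)) x

/-- The tangential gradient of an ambient function. -/
def sgrad (N : E3 → E3) (f : E3 → ℝ) (x : E3) : E3 := projT (N x) (gradient f x)

theorem inner_gradient (f : E3 → ℝ) (x v : E3) :
    ⟪gradient f x, v⟫ = fderiv ℝ f x v := by
  rw [gradient, InnerProductSpace.toDual_symm_apply]

theorem contDiff_gradient {f : E3 → ℝ} {k m : WithTop ℕ∞} (hf : ContDiff ℝ k f)
    (hm : m + 1 ≤ k) : ContDiff ℝ m (gradient f) :=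
  (InnerProductSpace.toDual ℝ E3).symm.toContinuousLinearEquiv.contDiff.comp
    (hf.fderiv_right hm)

theorem contDiff_projT : ContDiff ℝ ∞ projT := by
  have h1 : ContDiff ℝ ∞ (fun n : E3 => (innerSL ℝ n).smulRight n) :=
    (innerSL ℝ : E3 →L[ℝ] E3 →L[ℝ] ℝ).contDiff.smulRight contDiff_id
  exact contDiff_const.sub h1

theorem contDiff_sgrad {N : E3 → E3} {f : E3 → ℝ} {k m : WithTop ℕ∞} (hN : ContDiff ℝ ∞ N)
    (hf : ContDiff ℝ k f) (hm : m + 1 ≤ k) (hm' : m ≤ ∞) : ContDiff ℝ m (sgrad N f) :=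
  ((contDiff_projT.comp hN).of_le hm').clm_apply (contDiff_gradient hf hm)

theorem inner_fderiv_gradient {f : E3 → ℝ} {x : E3} (hf : ContDiffAt ℝ 2 f x) (v w : E3) :
    ⟪fderiv ℝ (gradient f) x v, w⟫ = fderiv ℝ (fderiv ℝ f) x v w := by
  have h0 : DifferentiableAt ℝ (fderiv ℝ f) x :=
    (hf.fderiv_right (m := 1) (by norm_num)).differentiableAt (by norm_num)
  have h1 : HasFDerivAt (gradient f) _ x :=
    ((InnerProductSpace.toDual ℝ E3).symm.toContinuousLinearEquiv.hasFDerivAt).comp x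
      h0.hasFDerivAt
  rw [h1.fderiv]
  exact InnerProductSpace.toDual_symm_apply

theorem inner_fderiv_gradient_symm {f : E3 → ℝ} {x : E3} (hf : ContDiffAt ℝ 2 f x) (v w : E3) :
    ⟪fderiv ℝ (gradient f) x v, w⟫ = ⟪v, fderiv ℝ (gradient f) x w⟫ := by
  rw [real_inner_comm _ v, inner_fderiv_gradient hf, inner_fderiv_gradient hf]
  exact (hf.isSymmSndFDerivAt (by simp)).eq v w

namespace IsNormalField

variable {O : Set E3} {N : E3 → E3} (hN : IsNormalField O N)
include hN

theorem inner_self {x : E3} (hx : x ∈ frontier O) : ⟪N x, N x⟫ = 1 := by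
  rw [hN.eq x hx]; exact inner_outwardNormal_self hN.smooth_boundary hx

theorem differentiableAt (x : E3) : DifferentiableAt ℝ N x :=
  (hN.smooth.differentiable (by simp)) x

theorem exists_frame {x : E3} (hx : x ∈ frontier O) : ∃ e₁ e₂, IsFrame (N x) e₁ e₂ :=
  exists_isFrame (hN.inner_self hx)

/-- Ambient functions that agree on `M` have the same tangential derivatives. -/
theorem fderiv_congr {F : Type*} [NormedAddCommGroup F] [NormedSpace ℝ F] {f₁ f₂ : E3 → F}
    {x v : E3} (hx : x ∈ frontier O) (h₁ : DifferentiableAt ℝ f₁ x) (h₂ : DifferentiableAt ℝ f₂ x)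
    (heq : ∀ y ∈ frontier O, f₁ y = f₂ y) (hv : ⟪N x, v⟫ = 0) :
    fderiv ℝ f₁ x v = fderiv ℝ f₂ x v := by
  rw [hN.eq x hx] at hv
  exact fderiv_eq_of_tangent hN.smooth_boundary hx h₁.hasFDerivAt.hasFDerivWithinAt
    h₂.hasFDerivAt.hasFDerivWithinAt (by filter_upwards [self_mem_nhdsWithin] with y hy using heq y hy) hv

theorem fderivWithin_eq {F : Type*} [NormedAddCommGroup F] [NormedSpace ℝ F] {f₀ f : E3 → F}
    {x v : E3} (hx : x ∈ frontier O) (hf : DifferentiableAt ℝ f x)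
    (heq : ∀ y ∈ frontier O, f y = f₀ y) (hv : ⟪N x, v⟫ = 0) :
    fderivWithin ℝ f₀ (frontier O) x v = fderiv ℝ f x v := by
  rw [hN.eq x hx] at hv
  have hd : DifferentiableWithinAt ℝ f₀ (frontier O) x :=
    hf.differentiableWithinAt.congr (fun y hy => (heq y hy).symm) (heq x hx).symm
  exact fderiv_eq_of_tangent hN.smooth_boundary hx hd.hasFDerivWithinAt
    hf.hasFDerivAt.hasFDerivWithinAt
    (by filter_upwards [self_mem_nhdsWithin] with y hy using (heq y hy).symm) hv

theorem mem_tangentPlane {x v : E3} (hx : x ∈ frontier O) :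
    v ∈ tangentPlane O x ↔ ⟪N x, v⟫ = 0 := by
  rw [hN.eq x hx]; exact Submodule.mem_orthogonal_singleton_iff_inner_right

theorem coe_projection {x : E3} (hx : x ∈ frontier O) (v : E3) :
    (((tangentPlane O x).orthogonalProjectionOnto v : tangentPlane O x) : E3) = projT (N x) v := by
  rw [hN.eq x hx]
  exact coe_orthogonalProjectionOnto_eq (inner_outwardNormal_self hN.smooth_boundary hx) v

theorem covDeriv_apply {X₀ X : E3 → E3} {x : E3} (hx : x ∈ frontier O)
    (hX : DifferentiableAt ℝ X x) (heq : ∀ y ∈ frontier O, X y = X₀ y) (v : tangentPlane O x) :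
    (covDeriv O X₀ x v : E3) = projT (N x) (fderiv ℝ X x v) := by
  rw [← hN.fderivWithin_eq hx hX heq ((hN.mem_tangentPlane hx).1 v.2), ← hN.coe_projection hx]
  rfl

theorem covDerivAlong_eq {X₀ X : E3 → E3} {x v : E3} (hx : x ∈ frontier O)
    (hX : DifferentiableAt ℝ X x) (heq : ∀ y ∈ frontier O, X y = X₀ y) (hv : ⟪N x, v⟫ = 0) :
    covDerivAlong O v X₀ x = projT (N x) (fderiv ℝ X x v) := by
  rw [covDerivAlong, hN.covDeriv_apply hx hX heq, hN.coe_projection hx, projT_of_inner hv]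

theorem surfaceDiv_eq {X₀ X : E3 → E3} {x : E3} (hx : x ∈ frontier O)
    (hX : DifferentiableAt ℝ X x) (heq : ∀ y ∈ frontier O, X y = X₀ y) :
    surfaceDiv O X₀ x = sdiv N X x := by
  obtain ⟨e₁, e₂, h⟩ := hN.exists_frame hx
  rw [sdiv, h.trT_eq]
  rw [hN.eq x hx] at h
  refine h.trace_plane (covDeriv O X₀ x) (fderiv ℝ X x) (fun v => ?_)
  exact (hN.covDeriv_apply hx hX heq v).trans (by rw [hN.eq x hx])

theorem gaussCurvature_eq {x e₁ e₂ : E3} (hx : x ∈ frontier O) (h : IsFrame (N x) e₁ e₂) :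
    gaussCurvature O x = ⟪e₁, fderiv ℝ N x e₁⟫ * ⟪e₂, fderiv ℝ N x e₂⟫ -
      ⟪e₁, fderiv ℝ N x e₂⟫ * ⟪e₂, fderiv ℝ N x e₁⟫ := by
  rw [hN.eq x hx] at h
  refine h.det_plane (covDeriv O (outwardNormal O) x) (fderiv ℝ N x) (fun v => ?_)
  exact (hN.covDeriv_apply hx (hN.differentiableAt x) hN.eq v).trans (by rw [hN.eq x hx])

theorem trace_adjoint_covDeriv_eq {X₀ X : E3 → E3} {x e₁ e₂ : E3} (hx : x ∈ frontier O)
    (hX : DifferentiableAt ℝ X x) (heq : ∀ y ∈ frontier O, X y = X₀ y)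
    (h : IsFrame (N x) e₁ e₂) :
    LinearMap.trace ℝ (tangentPlane O x)
      (ContinuousLinearMap.adjoint (covDeriv O X₀ x) ∘L covDeriv O X₀ x :
        tangentPlane O x →L[ℝ] tangentPlane O x) =
      ⟪e₁, fderiv ℝ X x e₁⟫ ^ 2 + ⟪e₂, fderiv ℝ X x e₁⟫ ^ 2 + ⟪e₁, fderiv ℝ X x e₂⟫ ^ 2 +
        ⟪e₂, fderiv ℝ X x e₂⟫ ^ 2 := by
  rw [hN.eq x hx] at h
  refine h.trace_adjoint_plane (covDeriv O X₀ x) (fderiv ℝ X x) (fun v => ?_)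
  exact (hN.covDeriv_apply hx hX heq v).trans (by rw [hN.eq x hx])

theorem surfaceGradient_eq {f₀ f : E3 → ℝ} {x : E3} (hx : x ∈ frontier O)
    (hf : DifferentiableAt ℝ f x) (heq : ∀ y ∈ frontier O, f y = f₀ y) :
    surfaceGradient O f₀ x = sgrad N f x := by
  have h1 : surfaceGradient O f₀ x ∈ tangentPlane O x := Submodule.coe_mem _
  have h2 : ∀ v : tangentPlane O x, ⟪surfaceGradient O f₀ x, (v : E3)⟫ = fderiv ℝ f x v := by
    intro v
    rw [← hN.fderivWithin_eq hx hf heq ((hN.mem_tangentPlane hx).1 v.2), surfaceGradient,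
      ← Submodule.coe_inner, InnerProductSpace.toDual_symm_apply]
    rfl
  have h3 : sgrad N f x ∈ tangentPlane O x :=
    (hN.mem_tangentPlane hx).2 (inner_projT (hN.inner_self hx) _)
  have h4 : ∀ v : tangentPlane O x, ⟪sgrad N f x, (v : E3)⟫ = fderiv ℝ f x v := by
    intro v
    rw [real_inner_comm, sgrad, inner_projT_of_inner, real_inner_comm, inner_gradient]
    rw [real_inner_comm]; exact (hN.mem_tangentPlane hx).1 v.2
  have h5 : (⟨surfaceGradient O f₀ x, h1⟩ : tangentPlane O x) = ⟨sgrad N f x, h3⟩ := by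
    apply ext_inner_right ℝ
    intro v
    rw [Submodule.coe_inner, Submodule.coe_inner, h2, h4]
  exact congrArg Subtype.val h5

theorem inner_fderiv_normal {x v : E3} (hx : x ∈ frontier O) (hv : ⟪N x, v⟫ = 0) :
    ⟪N x, fderiv ℝ N x v⟫ = 0 := by
  have hd := (hN.differentiableAt x).hasFDerivAt
  have h1 := hN.fderiv_congr (f₁ := fun y => ⟪N y, N y⟫) (f₂ := fun _ => (1 : ℝ)) hx
    ((hN.differentiableAt x).inner ℝ (hN.differentiableAt x)) (by fun_prop)
    (fun y hy => hN.inner_self hy) hv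
  rw [(hd.inner ℝ hd).fderiv] at h1
  simp [fderivInnerCLM_apply] at h1
  have h2 := real_inner_comm (N x) (fderiv ℝ N x v)
  linarith

/-- For fields tangent to `M`, the normal part of the derivative is given by the Weingarten map. -/
theorem inner_fderiv_tangent {X : E3 → E3} {x v : E3} (hx : x ∈ frontier O)
    (hX : DifferentiableAt ℝ X x) (ht : ∀ y ∈ frontier O, ⟪N y, X y⟫ = 0) (hv : ⟪N x, v⟫ = 0) :
    ⟪N x, fderiv ℝ X x v⟫ = - ⟪fderiv ℝ N x v, X x⟫ := by
  have hd := (hN.differentiableAt x).hasFDerivAt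
  have h1 := hN.fderiv_congr (f₁ := fun y => ⟪N y, X y⟫) (f₂ := fun _ => (0 : ℝ)) hx
    ((hN.differentiableAt x).inner ℝ hX) (by fun_prop) ht hv
  rw [(hd.inner ℝ hX.hasFDerivAt).fderiv] at h1
  simp [fderivInnerCLM_apply] at h1
  linarith

/-- The Weingarten map is symmetric. -/
theorem fderiv_normal_symm {x v w : E3} (hx : x ∈ frontier O) (hv : ⟪N x, v⟫ = 0)
    (hw : ⟪N x, w⟫ = 0) : ⟪fderiv ℝ N x v, w⟫ = ⟪v, fderiv ℝ N x w⟫ := by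
  obtain ⟨g, hg⟩ := hN.smooth_boundary x hx
  obtain ⟨U, hUo, hxU, hgU, hU⟩ := hg.eventually
  have hga := hgU.contDiffAt (hUo.mem_nhds hxU)
  have hgrad : DifferentiableAt ℝ (gradient g) x :=
    ((contDiffOn_gradient hUo hgU).contDiffAt (hUo.mem_nhds hxU)).differentiableAt (by simp)
  have h0 : ‖gradient g x‖ ≠ 0 := norm_ne_zero_iff.2 (hU x hxU).1
  have hinv : DifferentiableAt ℝ (fun y => ‖gradient g y‖⁻¹) x :=
    (hgrad.norm ℝ (hU x hxU).1).inv h0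
  have hNg : N x = ‖gradient g x‖⁻¹ • gradient g x := by rw [hN.eq x hx, outwardNormal_eq hx hg]
  have key : ∀ v w, ⟪N x, v⟫ = 0 → ⟪N x, w⟫ = 0 →
      ⟪fderiv ℝ N x v, w⟫ = ‖gradient g x‖⁻¹ * ⟪fderiv ℝ (gradient g) x v, w⟫ := by
    intro v w hv hw
    have hd := hinv.hasFDerivAt.smul hgrad.hasFDerivAt
    have hv' := hv
    rw [hN.eq x hx] at hv'
    have := fderiv_eq_of_tangent hN.smooth_boundary hx
      (hN.differentiableAt x).hasFDerivAt.hasFDerivWithinAt hd.hasFDerivWithinAt (by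
        filter_upwards [self_mem_nhdsWithin, mem_nhdsWithin_of_mem_nhds (hUo.mem_nhds hxU)]
          with y hy hyU
        rw [hN.eq y hy, outwardNormal_eq hy (hU y hyU).2]
        rfl) hv'
    have hw2 : ⟪gradient g x, w⟫ = 0 := by
      rw [hNg, real_inner_smul_left] at hw
      exact (mul_eq_zero.1 hw).resolve_left (inv_ne_zero h0)
    rw [this]
    simp [inner_add_left, real_inner_smul_left, hw2]
  rw [key v w hv hw, real_inner_comm _ v, key w v hw hv, inner_fderiv_gradient_symm
    (hga.of_le two_le_infty), real_inner_comm]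

theorem srot_eq {X : E3 → E3} {x e₁ e₂ : E3} (hx : x ∈ frontier O) (h : IsFrame (N x) e₁ e₂)
    (hX : DifferentiableAt ℝ X x) (ht : ⟪N x, X x⟫ = 0) :
    srot N X x = ⟪e₂, fderiv ℝ X x e₁⟫ - ⟪e₁, fderiv ℝ X x e₂⟫ := by
  have hd := crossL.hasFDerivAt_of_bilinear (hN.differentiableAt x).hasFDerivAt hX.hasFDerivAt
  rw [srot, sdiv, h.trT_eq, hd.fderiv]
  have a1 : ⟪e₁, crossL (fderiv ℝ N x e₁) (X x)⟫ = 0 := by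
    rw [h.expand_tangent (hN.inner_fderiv_normal hx h.n1), h.expand_tangent ht]
    simp [crossL_self, inner_add_right, real_inner_smul_right, inner_crossL_left,
      inner_crossL_right]
  have a2 : ⟪e₂, crossL (fderiv ℝ N x e₂) (X x)⟫ = 0 := by
    rw [h.expand_tangent (hN.inner_fderiv_normal hx h.n2), h.expand_tangent ht]
    simp [crossL_self, inner_add_right, real_inner_smul_right, inner_crossL_left,
      inner_crossL_right]
  have b1 : ⟪e₁, crossL (N x) (fderiv ℝ X x e₁)⟫ = - ⟪e₂, fderiv ℝ X x e₁⟫ := by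
    rw [inner_crossL_cyclic, crossL_swap, h.cross1, inner_neg_left]
  have b2 : ⟪e₂, crossL (N x) (fderiv ℝ X x e₂)⟫ = ⟪e₁, fderiv ℝ X x e₂⟫ := by
    rw [inner_crossL_cyclic, crossL_swap, h.cross2, neg_neg]
  simp [inner_add_right, a1, a2, b1, b2]
  ring

theorem sdiv_smul {φ : E3 → ℝ} {X : E3 → E3} {x : E3} (hx : x ∈ frontier O)
    (hφ : DifferentiableAt ℝ φ x) (hX : DifferentiableAt ℝ X x) (ht : ⟪N x, X x⟫ = 0) :
    sdiv N (fun y => φ y • X y) x = φ x * sdiv N X x + fderiv ℝ φ x (X x) := by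
  obtain ⟨e₁, e₂, h⟩ := hN.exists_frame hx
  have hd := hφ.hasFDerivAt.smul hX.hasFDerivAt
  have h2 : fderiv ℝ φ x (X x) = ⟪e₁, X x⟫ * fderiv ℝ φ x e₁ + ⟪e₂, X x⟫ * fderiv ℝ φ x e₂ := by
    conv_lhs => rw [h.expand_tangent ht]
    simp
  have h3 : fderiv ℝ (fun y => φ y • X y) x = φ x • fderiv ℝ X x + (fderiv ℝ φ x).smulRight (X x) :=
    hd.fderiv
  rw [sdiv, sdiv, h.trT_eq, h.trT_eq, h3, h2]
  simp [inner_add_right, real_inner_smul_right]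
  ring

/-- The field `J ∇φ` is divergence free. -/
theorem sdiv_cross_gradient {φ : E3 → ℝ} {x : E3} (hx : x ∈ frontier O) (hφ : ContDiff ℝ 2 φ) :
    sdiv N (fun y => crossL (N y) (gradient φ y)) x = 0 := by
  obtain ⟨e₁, e₂, h⟩ := hN.exists_frame hx
  have hG : DifferentiableAt ℝ (gradient φ) x :=
    (contDiff_gradient hφ (m := 1) (by norm_num)).differentiable (by norm_num) x
  have hd := crossL.hasFDerivAt_of_bilinear (hN.differentiableAt x).hasFDerivAt hG.hasFDerivAt
  rw [sdiv, h.trT_eq, hd.fderiv]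
  have a1 : ⟪e₁, crossL (fderiv ℝ N x e₁) (gradient φ x)⟫ =
      ⟪e₂, fderiv ℝ N x e₁⟫ * ⟪N x, gradient φ x⟫ := by
    conv_lhs => rw [h.expand_tangent (hN.inner_fderiv_normal hx h.n1)]
    simp [inner_add_right, real_inner_smul_right, inner_crossL_left, inner_crossL_cyclic,
      h.cross12]
  have a2 : ⟪e₂, crossL (fderiv ℝ N x e₂) (gradient φ x)⟫ =
      - (⟪e₁, fderiv ℝ N x e₂⟫ * ⟪N x, gradient φ x⟫) := by
    conv_lhs => rw [h.expand_tangent (hN.inner_fderiv_normal hx h.n2)]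
    have : crossL e₂ e₁ = - N x := by rw [crossL_swap, h.cross12]
    simp [inner_add_right, real_inner_smul_right, inner_crossL_left, inner_crossL_cyclic,
      this]
  have b1 : ⟪e₁, crossL (N x) (fderiv ℝ (gradient φ) x e₁)⟫ =
      - ⟪e₂, fderiv ℝ (gradient φ) x e₁⟫ := by
    rw [inner_crossL_cyclic, crossL_swap, h.cross1, inner_neg_left]
  have b2 : ⟪e₂, crossL (N x) (fderiv ℝ (gradient φ) x e₂)⟫ =
      ⟪e₁, fderiv ℝ (gradient φ) x e₂⟫ := by
    rw [inner_crossL_cyclic, crossL_swap, h.cross2, neg_neg]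
  have s1 := inner_fderiv_gradient_symm hφ.contDiffAt (x := x) e₁ e₂
  have s2 := hN.fderiv_normal_symm hx h.n1 h.n2
  rw [real_inner_comm] at s1 s2
  simp [inner_add_right, a1, a2, b1, b2, s1, s2]
  ring

/-- The tangential identity `∇_u u = ∇(|u|²/2) + (rot u) J u`, tested against a tangent vector. -/
theorem inner_advection {u : E3 → E3} {x w : E3} (hx : x ∈ frontier O)
    (hu : DifferentiableAt ℝ u x) (ht : ⟪N x, u x⟫ = 0) (hw : ⟪N x, w⟫ = 0) :
    ⟪fderiv ℝ u x (u x), w⟫ = ⟪fderiv ℝ u x w, u x⟫ + srot N u x * ⟪crossL (N x) (u x), w⟫ := by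
  obtain ⟨e₁, e₂, h⟩ := hN.exists_frame hx
  rw [hN.srot_eq hx h hu ht, inner_crossL_triple]
  rw [h.expand_tangent ht, h.expand_tangent hw]
  simp only [map_add, map_smul, inner_add_left, inner_add_right, real_inner_smul_left,
    real_inner_smul_right, h.cross1, h.cross2, inner_neg_right, h.e11, h.e22, h.e12, h.e21,
    real_inner_comm e₁ (fderiv ℝ u x _), real_inner_comm e₂ (fderiv ℝ u x _)]
  ring

/-- The square of the Hilbert–Schmidt norm of `∇X` is `tr ((∇X)²) + (rot X)²`. -/
theorem trace_adjoint_covDeriv_eq_trT {X₀ X : E3 → E3} {x : E3} (hx : x ∈ frontier O)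
    (hX : DifferentiableAt ℝ X x) (heq : ∀ y ∈ frontier O, X y = X₀ y) (ht : ⟪N x, X x⟫ = 0) :
    LinearMap.trace ℝ (tangentPlane O x)
      (ContinuousLinearMap.adjoint (covDeriv O X₀ x) ∘L covDeriv O X₀ x :
        tangentPlane O x →L[ℝ] tangentPlane O x) =
      trT (N x) (fderiv ℝ X x ∘L projT (N x) ∘L fderiv ℝ X x) + srot N X x ^ 2 := by
  obtain ⟨e₁, e₂, h⟩ := hN.exists_frame hx
  rw [hN.trace_adjoint_covDeriv_eq hx hX heq h, h.trT_eq, hN.srot_eq hx h hX ht]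
  have p : ∀ w, projT (N x) w = ⟪e₁, w⟫ • e₁ + ⟪e₂, w⟫ • e₂ := by
    intro w
    have := h.expand_tangent (inner_projT h.nn w)
    rwa [inner_projT_of_inner h.e1n, inner_projT_of_inner h.e2n] at this
  simp only [ContinuousLinearMap.comp_apply, p, map_add, map_smul, inner_add_right,
    real_inner_smul_right]
  ring

theorem srot_sq_le {X₀ X : E3 → E3} {x : E3} (hx : x ∈ frontier O)
    (hX : DifferentiableAt ℝ X x) (heq : ∀ y ∈ frontier O, X y = X₀ y) (ht : ⟪N x, X x⟫ = 0) :
    srot N X x ^ 2 ≤ 2 * LinearMap.trace ℝ (tangentPlane O x)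
      (ContinuousLinearMap.adjoint (covDeriv O X₀ x) ∘L covDeriv O X₀ x :
        tangentPlane O x →L[ℝ] tangentPlane O x) := by
  obtain ⟨e₁, e₂, h⟩ := hN.exists_frame hx
  rw [hN.trace_adjoint_covDeriv_eq hx hX heq h, hN.srot_eq hx h hX ht]
  nlinarith [sq_nonneg (⟪e₂, fderiv ℝ X x e₁⟫ + ⟪e₁, fderiv ℝ X x e₂⟫),
    sq_nonneg (⟪e₁, fderiv ℝ X x e₁⟫), sq_nonneg (⟪e₂, fderiv ℝ X x e₂⟫)]

end IsNormalField

/-! ### The polarized Bochner identity -/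

/-- An ambient representative of the tangent field `∇_v z - (div z) v`. -/
def bochnerField (N z v : E3 → E3) (y : E3) : E3 :=
  fderiv ℝ z y (v y) + ⟪z y, fderiv ℝ N y (v y)⟫ • N y - sdiv N z y • v y

namespace IsNormalField

variable {O : Set E3} {N : E3 → E3} (hN : IsNormalField O N)
include hN

theorem hasFDerivAt_sdiv {z : E3 → E3} (hz : ContDiff ℝ 2 z) (x : E3) :
    ∃ L : E3 →L[ℝ] ℝ, HasFDerivAt (sdiv N z) L x ∧ ∀ w, L w =
      traceL (fderiv ℝ (fderiv ℝ z) x w) - (⟪N x, fderiv ℝ (fderiv ℝ z) x w (N x) +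
        fderiv ℝ z x (fderiv ℝ N x w)⟫ + ⟪fderiv ℝ N x w, fderiv ℝ z x (N x)⟫) := by
  have hNd := (hN.differentiableAt x).hasFDerivAt
  have hz2 : HasFDerivAt (fderiv ℝ z) (fderiv ℝ (fderiv ℝ z) x) x :=
    ((hz.fderiv_right (m := 1) (by norm_num)).differentiable (by norm_num) x).hasFDerivAt
  have h1 := traceL.hasFDerivAt.comp x hz2
  have h2 := hNd.inner ℝ (hz2.clm_apply hNd)
  refine ⟨_, h1.sub h2, fun w => ?_⟩
  simp [fderivInnerCLM_apply, inner_add_right]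
  ring

theorem sdiv_bochnerField {z v : E3 → E3} {x : E3} (hx : x ∈ frontier O) (hz : ContDiff ℝ 2 z)
    (hv : ContDiff ℝ 1 v) (htz : ∀ y ∈ frontier O, ⟪N y, z y⟫ = 0)
    (htv : ∀ y ∈ frontier O, ⟪N y, v y⟫ = 0) :
    sdiv N (bochnerField N z v) x =
      trT (N x) (fderiv ℝ z x ∘L projT (N x) ∘L fderiv ℝ v x) - sdiv N z x * sdiv N v x
        + gaussCurvature O x * ⟪z x, v x⟫ := by
  obtain ⟨e₁, e₂, h⟩ := hN.exists_frame hx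
  have hNd := (hN.differentiableAt x).hasFDerivAt
  have hzd : DifferentiableAt ℝ z x := hz.differentiable (by norm_num) x
  have hvd : DifferentiableAt ℝ v x := hv.differentiable (by norm_num) x
  have hz2 : HasFDerivAt (fderiv ℝ z) (fderiv ℝ (fderiv ℝ z) x) x :=
    ((hz.fderiv_right (m := 1) (by norm_num)).differentiable (by norm_num) x).hasFDerivAt
  have hN2 : HasFDerivAt (fderiv ℝ N) (fderiv ℝ (fderiv ℝ N) x) x :=
    ((hN.smooth.fderiv_right (m := 1) (by rw [one_add_one_eq_two]; exact two_le_infty)).differentiable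
      (by norm_num) x).hasFDerivAt
  obtain ⟨L, hL, hLw⟩ := hN.hasFDerivAt_sdiv hz x
  have d1 := hz2.clm_apply hvd.hasFDerivAt
  have d2 := (hzd.hasFDerivAt.inner ℝ (hN2.clm_apply hvd.hasFDerivAt)).smul hNd
  have d3 := hL.smul hvd.hasFDerivAt
  have d : HasFDerivAt (bochnerField N z v) _ x := (d1.add d2).sub d3
  have hsym : ∀ a b, fderiv ℝ (fderiv ℝ z) x a b = fderiv ℝ (fderiv ℝ z) x b a :=
    fun a b => (hz.contDiffAt.isSymmSndFDerivAt (by simp)).eq a b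
  rw [sdiv, h.trT_eq, d.fderiv]
  have ev := h.expand_tangent (htv x hx)
  have ez := h.expand_tangent (htz x hx)
  have s := hN.fderiv_normal_symm hx h.n1 h.n2
  rw [real_inner_comm] at s
  have eN1 := h.expand_tangent (hN.inner_fderiv_normal hx h.n1)
  have eN2 := h.expand_tangent (hN.inner_fderiv_normal hx h.n2)
  have nz1 := hN.inner_fderiv_tangent hx hzd htz h.n1
  have nz2 := hN.inner_fderiv_tangent hx hzd htz h.n2
  have nv1 := hN.inner_fderiv_tangent hx hvd htv h.n1
  have nv2 := hN.inner_fderiv_tangent hx hvd htv h.n2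
  have ev1 := h.expand (fderiv ℝ v x e₁)
  have ev2 := h.expand (fderiv ℝ v x e₂)
  have htr : ∀ w, traceL (fderiv ℝ (fderiv ℝ z) x w) =
      ⟪e₁, fderiv ℝ (fderiv ℝ z) x w e₁⟫ + ⟪e₂, fderiv ℝ (fderiv ℝ z) x w e₂⟫ +
        ⟪N x, fderiv ℝ (fderiv ℝ z) x w (N x)⟫ := fun w => h.trace_eq _
  have p : ∀ w, projT (N x) w = ⟪e₁, w⟫ • e₁ + ⟪e₂, w⟫ • e₂ := by
    intro w
    have := h.expand_tangent (inner_projT h.nn w)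
    rwa [inner_projT_of_inner h.e1n, inner_projT_of_inner h.e2n] at this
  have hK := hN.gaussCurvature_eq hx h
  have hdz : sdiv N z x = _ := h.trT_eq (fderiv ℝ z x)
  have hdv : sdiv N v x = _ := h.trT_eq (fderiv ℝ v x)
  rw [h.trT_eq, hdz, hdv, hK]
  set Dz := fderiv ℝ z x
  set Dv := fderiv ℝ v x
  set DN := fderiv ℝ N x
  set D2 := fderiv ℝ (fderiv ℝ z) x
  set v1 := ⟪e₁, v x⟫
  set v2 := ⟪e₂, v x⟫
  set z1 := ⟪e₁, z x⟫
  set z2 := ⟪e₂, z x⟫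
  -- the derivative of `div z` only enters in the direction `v`
  have hLv : L e₁ * v1 + L e₂ * v2 = L (v x) := by
    conv_rhs => rw [ev]
    simp; ring
  have hD2 : ∀ w, D2 w (v x) = v1 • D2 w e₁ + v2 • D2 w e₂ := by
    intro w; conv_lhs => rw [ev]
    simp
  have hDNv : DN (v x) = v1 • DN e₁ + v2 • DN e₂ := by
    conv_lhs => rw [ev]
    simp
  have hLv' := hLw (v x)
  rw [htr, ← hLv] at hLv'
  have hs21 : ⟪e₂, DN e₁⟫ = ⟪e₁, DN e₂⟫ := s
  have nz1' : ⟪N x, Dz e₁⟫ = -(⟪e₁, DN e₁⟫ * z1 + ⟪e₂, DN e₁⟫ * z2) := by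
    rw [nz1, eN1, inner_add_left, real_inner_smul_left, real_inner_smul_left]
    simp only [← eN1, z1, z2]
  have nz2' : ⟪N x, Dz e₂⟫ = -(⟪e₁, DN e₂⟫ * z1 + ⟪e₂, DN e₂⟫ * z2) := by
    rw [nz2, eN2, inner_add_left, real_inner_smul_left, real_inner_smul_left]
    simp only [← eN2, z1, z2]
  have nv1' : ⟪N x, Dv e₁⟫ = -(⟪e₁, DN e₁⟫ * v1 + ⟪e₂, DN e₁⟫ * v2) := by
    rw [nv1, eN1, inner_add_left, real_inner_smul_left, real_inner_smul_left]
    simp only [← eN1, v1, v2]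
  have nv2' : ⟪N x, Dv e₂⟫ = -(⟪e₁, DN e₂⟫ * v1 + ⟪e₂, DN e₂⟫ * v2) := by
    rw [nv2, eN2, inner_add_left, real_inner_smul_left, real_inner_smul_left]
    simp only [← eN2, v1, v2]
  have hzin : ∀ w, ⟪z x, w⟫ = z1 * ⟪e₁, w⟫ + z2 * ⟪e₂, w⟫ := by
    intro w; conv_lhs => rw [ez]
    simp [inner_add_left, real_inner_smul_left]
  -- coordinates of the vectors `Dv e_i` and `DN e_i`, pushed through `Dz`
  have a1 : Dz (Dv e₁) = ⟪e₁, Dv e₁⟫ • Dz e₁ + ⟪e₂, Dv e₁⟫ • Dz e₂ + ⟪N x, Dv e₁⟫ • Dz (N x) := by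
    conv_lhs => rw [ev1]
    simp
  have a2 : Dz (Dv e₂) = ⟪e₁, Dv e₂⟫ • Dz e₁ + ⟪e₂, Dv e₂⟫ • Dz e₂ + ⟪N x, Dv e₂⟫ • Dz (N x) := by
    conv_lhs => rw [ev2]
    simp
  have b1 : Dz (DN e₁) = ⟪e₁, DN e₁⟫ • Dz e₁ + ⟪e₂, DN e₁⟫ • Dz e₂ := by
    conv_lhs => rw [eN1]
    simp
  have b2 : Dz (DN e₂) = ⟪e₁, DN e₂⟫ • Dz e₁ + ⟪e₂, DN e₂⟫ • Dz e₂ := by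
    conv_lhs => rw [eN2]
    simp
  have c1 : ∀ w, ⟪DN e₁, w⟫ = ⟪e₁, DN e₁⟫ * ⟪e₁, w⟫ + ⟪e₂, DN e₁⟫ * ⟪e₂, w⟫ := by
    intro w
    conv_lhs => rw [eN1]
    simp [inner_add_left, real_inner_smul_left]
  have c2 : ∀ w, ⟪DN e₂, w⟫ = ⟪e₁, DN e₂⟫ * ⟪e₁, w⟫ + ⟪e₂, DN e₂⟫ * ⟪e₂, w⟫ := by
    intro w
    conv_lhs => rw [eN2]
    simp [inner_add_left, real_inner_smul_left]
  simp only [hDNv, hsym (v x), hD2, map_add, map_smul, inner_add_left, inner_add_right,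
    real_inner_smul_left, real_inner_smul_right, b1, b2, c1, c2, nz1', nz2'] at hLv'
  simp only [sub_apply, add_apply,
    smul_apply, ContinuousLinearMap.smulRight_apply,
    ContinuousLinearMap.comp_apply, ContinuousLinearMap.flip_apply, inner_sub_right,
    inner_add_right, real_inner_smul_right, h.e1n, h.e2n, hsym _ (v x), p, map_add, map_smul]
  simp only [hDNv, hsym (v x), hD2, inner_add_right, real_inner_smul_right, a1, a2, nv1', nv2', hzin, hs21]
  rw [hs21] at hLv'
  simp only [v1, v2, z1, z2] at hLv' ⊢
  have hs1 := hsym e₁ e₂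
  rw [hs1] at hLv' ⊢
  linear_combination -hLv'

end IsNormalField

/-! ### The area formula for parametrized surfaces -/

/-- The parameter plane of charts. -/
abbrev E2 : Type := EuclideanSpace ℝ (Fin 2)

open scoped NNReal ENNReal in
theorem euclideanHausdorffMeasure_image_le {X Y : Type*} [EMetricSpace X] [MeasurableSpace X]
    [BorelSpace X] [EMetricSpace Y] [MeasurableSpace Y] [BorelSpace Y] {K : ℝ≥0} {f : X → Y}
    {s : Set X} (h : LipschitzOnWith K f s) :
    (μHE[2] : Measure Y) (f '' s) ≤ (K : ℝ≥0∞) ^ 2 * (μHE[2] : Measure X) s := by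
  have h1 := h.hausdorffMeasure_image_le (d := (2 : ℕ)) (by positivity)
  rw [ENNReal.rpow_natCast] at h1
  simp only [Measure.euclideanHausdorffMeasure_def, Measure.smul_apply, ENNReal.smul_def, smul_eq_mul]
  rw [mul_left_comm]
  gcongr

open scoped NNReal ENNReal in
/-- A map that distorts all distances like the linear map `L`, up to a factor `K`, distorts areas like
`L`, up to a factor `K ^ 2`. -/
theorem area_image_le_of_linear {Φ : E2 → E3} {L : E2 →L[ℝ] E3} {K : ℝ≥0} {A : Set E2}
    (hL : Function.Injective L)
    (h : ∀ x ∈ A, ∀ y ∈ A, ‖Φ x - Φ y‖ ≤ K * ‖L (x - y)‖) :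
    (μHE[2] : Measure E3) (Φ '' A) ≤
      (K : ℝ≥0∞) ^ 2 * (ENNReal.ofReal (LinearMap.normDet (L : E2 →ₗ[ℝ] E3)) * volume A) := by
  have hlin := LinearMap.euclideanHausdorffMeasure_image_eq_normDet_mul_volume
    (L : E2 →ₗ[ℝ] E3) A
  rw [finrank_euclideanSpace_fin] at hlin
  rw [← hlin]
  have himg : Φ '' A = (fun z => Φ (Function.invFun L z)) '' ((L : E2 →ₗ[ℝ] E3) '' A) := by
    rw [image_image]
    apply image_congr
    intro a _
    change _ = Φ (Function.invFun L (L a))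
    rw [Function.leftInverse_invFun hL a]
  rw [himg]
  apply euclideanHausdorffMeasure_image_le
  apply LipschitzOnWith.of_dist_le_mul
  rintro _ ⟨x, hx, rfl⟩ _ ⟨y, hy, rfl⟩
  change dist (Φ (Function.invFun L (L x))) (Φ (Function.invFun L (L y))) ≤ K * dist (L x) (L y)
  rw [Function.leftInverse_invFun hL x, Function.leftInverse_invFun hL y, dist_eq_norm,
    dist_eq_norm, ← map_sub]
  exact h x hx y hy

open scoped NNReal ENNReal in
theorem linear_area_le_area_image {Φ : E2 → E3} {L : E2 →L[ℝ] E3} {K : ℝ≥0} {A : Set E2}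
    (hΦ : InjOn Φ A) (h : ∀ x ∈ A, ∀ y ∈ A, ‖L (x - y)‖ ≤ K * ‖Φ x - Φ y‖) :
    ENNReal.ofReal (LinearMap.normDet (L : E2 →ₗ[ℝ] E3)) * volume A ≤
      (K : ℝ≥0∞) ^ 2 * (μHE[2] : Measure E3) (Φ '' A) := by
  have hlin := LinearMap.euclideanHausdorffMeasure_image_eq_normDet_mul_volume
    (L : E2 →ₗ[ℝ] E3) A
  rw [finrank_euclideanSpace_fin] at hlin
  rw [← hlin]
  have himg : (L : E2 →ₗ[ℝ] E3) '' A = (fun z => L (Function.invFunOn Φ A z)) '' (Φ '' A) := by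
    rw [image_image]
    apply image_congr
    intro a ha
    rw [hΦ.leftInvOn_invFunOn ha]
    rfl
  rw [himg]
  apply euclideanHausdorffMeasure_image_le
  apply LipschitzOnWith.of_dist_le_mul
  rintro _ ⟨x, hx, rfl⟩ _ ⟨y, hy, rfl⟩
  change dist (L (Function.invFunOn Φ A (Φ x))) (L (Function.invFunOn Φ A (Φ y))) ≤
    K * dist (Φ x) (Φ y)
  rw [hΦ.leftInvOn_invFunOn hx, hΦ.leftInvOn_invFunOn hy, dist_eq_norm,
    dist_eq_norm, ← map_sub]
  exact h x hx y hy

/-- Two measures that compare on all small sets compare on all sets. -/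
theorem measure_le_of_locally_le {X : Type*} [TopologicalSpace X] [SecondCountableTopology X]
    [MeasurableSpace X] [OpensMeasurableSpace X] {μ ν : Measure X} {V : Set X}
    (h : ∀ a ∈ V, ∃ U, IsOpen U ∧ a ∈ U ∧ ∀ A ⊆ U ∩ V, MeasurableSet A → μ A ≤ ν A) {A : Set X}
    (hAV : A ⊆ V) (hA : MeasurableSet A) : μ A ≤ ν A := by
  choose! U hUo haU hU using h
  obtain ⟨t, htV, htc, ht⟩ := TopologicalSpace.countable_cover_nhdsWithin
    (f := U) (s := V) (fun x hx => mem_nhdsWithin_of_mem_nhds ((hUo x hx).mem_nhds (haU x hx)))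
  rcases t.eq_empty_or_nonempty with rfl | hne
  · have : A = ∅ := by
      rw [← subset_empty_iff]; refine hAV.trans (ht.trans ?_); simp
    simp [this]
  obtain ⟨a, rfl⟩ := htc.exists_eq_range hne
  have hcov : A ⊆ ⋃ n, U (a n) := by
    refine hAV.trans (ht.trans ?_)
    simp
  have hdisj : A = ⋃ n, A ∩ disjointed (fun n => U (a n)) n := by
    rw [← inter_iUnion, iUnion_disjointed, inter_eq_left.2 hcov]
  have haV : ∀ n, a n ∈ V := fun n => htV (mem_range_self n)
  have hm : ∀ n, MeasurableSet (A ∩ disjointed (fun n => U (a n)) n) := fun n =>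
    hA.inter (MeasurableSet.disjointed (fun n => (hUo _ (haV n)).measurableSet) n)
  have hd : Pairwise (Function.onFun Disjoint fun n => A ∩ disjointed (fun n => U (a n)) n) :=
    fun i j hij => ((disjoint_disjointed _) hij).mono inter_subset_right inter_subset_right
  rw [hdisj, measure_iUnion hd hm, measure_iUnion hd hm]
  refine ENNReal.tsum_le_tsum (fun n => hU _ (haV n) _ ?_ (hm n))
  exact subset_inter (inter_subset_right.trans (disjointed_subset _ n))
    (inter_subset_left.trans hAV)

/-- The area factor of a parametrization with derivative `L`. -/
def areaFactor (L : E2 →L[ℝ] E3) : ℝ := LinearMap.normDet (L : E2 →ₗ[ℝ] E3)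

theorem areaFactor_eq (L : E2 →L[ℝ] E3) :
    areaFactor L = √(‖L (EuclideanSpace.single 0 1)‖ ^ 2 * ‖L (EuclideanSpace.single 1 1)‖ ^ 2 -
      ⟪L (EuclideanSpace.single 0 1), L (EuclideanSpace.single 1 1)⟫ ^ 2) := by
  have h := LinearMap.normDet_sq_eq_det_gram (L : E2 →ₗ[ℝ] E3) (EuclideanSpace.basisFun (Fin 2) ℝ)
  have h0 : 0 ≤ areaFactor L := LinearMap.normDet_nonneg _
  rw [← Real.sqrt_sq h0]
  congr 1
  have h1 : areaFactor L ^ 2 = _ := h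
  rw [h1, Matrix.det_fin_two]
  simp only [Matrix.gram_apply, EuclideanSpace.basisFun_apply, ContinuousLinearMap.coe_coe,
    real_inner_self_eq_norm_sq]
  rw [real_inner_comm (L (EuclideanSpace.single 0 1))]
  ring

theorem continuous_areaFactor : Continuous areaFactor := by
  have : areaFactor = fun L => _ := funext areaFactor_eq
  rw [this]
  fun_prop

theorem areaFactor_pos {L : E2 →L[ℝ] E3} (hL : Function.Injective L) : 0 < areaFactor L := by
  refine lt_of_le_of_ne (LinearMap.normDet_nonneg _) (fun h => ?_)
  have := LinearMap.normDet_eq_zero_iff_ker_ne_bot.1 h.symm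
  exact this (LinearMap.ker_eq_bot.2 hL)

open Filter Topology in
open scoped NNReal ENNReal in
/-- A `C¹` immersion is locally almost a linear map. -/
theorem exists_almost_linear {Φ : E2 → E3} {V : Set E2} (hV : IsOpen V) (hΦ : ContDiffOn ℝ 1 Φ V)
    {a : E2} (ha : a ∈ V) (hinj : Function.Injective (fderiv ℝ Φ a)) {K : ℝ≥0} (hK : 1 < K) :
    ∃ U, IsOpen U ∧ a ∈ U ∧ U ⊆ V ∧
      (∀ x ∈ U, ∀ y ∈ U, ‖Φ x - Φ y‖ ≤ K * ‖fderiv ℝ Φ a (x - y)‖ ∧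
        ‖fderiv ℝ Φ a (x - y)‖ ≤ K * ‖Φ x - Φ y‖) ∧
      (∀ y ∈ U, areaFactor (fderiv ℝ Φ a) ≤ K * areaFactor (fderiv ℝ Φ y) ∧
        areaFactor (fderiv ℝ Φ y) ≤ K * areaFactor (fderiv ℝ Φ a)) := by
  obtain ⟨L, hL⟩ : ∃ L, L = fderiv ℝ Φ a := ⟨_, rfl⟩
  rw [← hL] at hinj ⊢
  have hs : HasStrictFDerivAt Φ L a :=
    hL ▸ (hΦ.contDiffAt (hV.mem_nhds ha)).hasStrictFDerivAt one_ne_zero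
  obtain ⟨c, hc0, hc⟩ : ∃ c : ℝ, 0 < c ∧ ∀ v, c * ‖v‖ ≤ ‖L v‖ := by
    obtain ⟨C, hC, hCL⟩ := (L : E2 →ₗ[ℝ] E3).exists_antilipschitzWith (LinearMap.ker_eq_bot.2 hinj)
    refine ⟨(C : ℝ)⁻¹, by positivity, fun v => ?_⟩
    have := hCL.le_mul_dist v 0
    simp only [dist_zero_right, map_zero] at this
    rw [inv_mul_le_iff₀ (by exact_mod_cast hC)]
    exact this
  have hK' : (1 : ℝ) < K := by exact_mod_cast hK
  obtain ⟨δ, hδ⟩ : ∃ δ : ℝ, δ = 1 - (K : ℝ)⁻¹ := ⟨_, rfl⟩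
  have hKi : (K : ℝ)⁻¹ < 1 := inv_lt_one_of_one_lt₀ hK'
  have hδ0 : 0 < δ := by rw [hδ]; linarith
  have hKK : (K : ℝ) * (K : ℝ)⁻¹ = 1 := mul_inv_cancel₀ (by linarith)
  obtain ⟨U₁, hU₁, hU₁'⟩ := hs.approximates_deriv_on_nhds (c := Real.toNNReal (δ * c))
    (Or.inr (Real.toNNReal_pos.2 (mul_pos hδ0 hc0)))
  have hJ : ContinuousAt (fun y => areaFactor (fderiv ℝ Φ y)) a :=
    continuous_areaFactor.continuousAt.comp
      ((hΦ.contDiffAt (hV.mem_nhds ha)).fderiv_right (m := 0) (by norm_num)).continuousAt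
  have hJ0 : 0 < areaFactor L := areaFactor_pos hinj
  have hJ1 : ∀ᶠ y in 𝓝 a, areaFactor L < K * areaFactor (fderiv ℝ Φ y) := by
    have h1 : areaFactor L < K * areaFactor L := by nlinarith
    exact (continuousAt_const.mul hJ).eventually (lt_mem_nhds (by
      change _ < (K : ℝ) * areaFactor (fderiv ℝ Φ a); rw [← hL]; exact h1))
  have hJ2 : ∀ᶠ y in 𝓝 a, areaFactor (fderiv ℝ Φ y) < K * areaFactor L := by
    have h1 : areaFactor L < K * areaFactor L := by nlinarith
    exact hJ.eventually (gt_mem_nhds (by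
      change areaFactor (fderiv ℝ Φ a) < _; rw [← hL]; exact h1))
  obtain ⟨U, hU, hUo, haU⟩ := mem_nhds_iff.1 (inter_mem (inter_mem hU₁ (hV.mem_nhds ha))
    (hJ1.and hJ2))
  refine ⟨U, hUo, haU, fun x hx => (hU hx).1.2, ?_, ?_⟩
  · intro x hx y hy
    have h1 := hU₁' x (hU hx).1.1 y (hU hy).1.1
    rw [Real.coe_toNNReal _ (mul_pos hδ0 hc0).le] at h1
    have h2 := hc (x - y)
    have h3 : ‖Φ x - Φ y - L (x - y)‖ ≤ δ * ‖L (x - y)‖ := by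
      refine h1.trans ?_
      rw [mul_assoc]
      exact mul_le_mul_of_nonneg_left h2 hδ0.le
    have h4 : ‖Φ x - Φ y‖ ≤ ‖Φ x - Φ y - L (x - y)‖ + ‖L (x - y)‖ := norm_le_norm_sub_add _ _
    have h5 : ‖L (x - y)‖ ≤ ‖Φ x - Φ y - L (x - y)‖ + ‖Φ x - Φ y‖ := by
      rw [norm_sub_rev (Φ x - Φ y)]; exact norm_le_norm_sub_add _ _
    have h6 := norm_nonneg (L (x - y))
    constructor
    · have : 1 + δ ≤ K := by
        have : (K : ℝ)⁻¹ + K ≥ 2 := by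
          nlinarith [sq_nonneg ((K : ℝ) - 1), inv_pos.2 (zero_lt_one.trans hK')]
        rw [hδ]; linarith
      nlinarith
    · have h7 : (K : ℝ)⁻¹ * ‖L (x - y)‖ ≤ ‖Φ x - Φ y‖ := by
        have : (K : ℝ)⁻¹ = 1 - δ := by rw [hδ]; ring
        rw [this]; linarith
      rwa [inv_mul_le_iff₀ (by linarith)] at h7
  · intro y hy
    exact ⟨(hU hy).2.1.le, (hU hy).2.2.le⟩

open Filter Topology in
open scoped NNReal ENNReal in
/-- The area formula for a `C¹` parametrization `Φ` with an affine left inverse. -/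
theorem map_areaMeasure_chart {Φ : E2 → E3} {V : Set E2} (hV : IsOpen V)
    (hΦ : ContDiffOn ℝ 1 Φ V) (P : E3 →L[ℝ] E2) (x₀ : E3) (hP : ∀ y ∈ V, P (Φ y - x₀) = y) :
    (((μHE[2] : Measure E3).restrict (Φ '' V)).map fun x => P (x - x₀)) =
      (volume.restrict V).withDensity (fun y => ENNReal.ofReal (areaFactor (fderiv ℝ Φ y))) := by
  have hinjV : InjOn Φ V := fun x hx y hy hxy => by rw [← hP x hx, ← hP y hy, hxy]
  have hmeas : Measurable fun x : E3 => P (x - x₀) := by fun_prop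
  have hinj : ∀ a ∈ V, Function.Injective (fderiv ℝ Φ a) := by
    intro a ha
    have h1 : HasFDerivAt (fun y => P (Φ y - x₀)) (P ∘L fderiv ℝ Φ a) a :=
      P.hasFDerivAt.comp a ((((hΦ.contDiffAt (hV.mem_nhds ha)).differentiableAt
        one_ne_zero).hasFDerivAt).sub_const x₀)
    have h2 : HasFDerivAt (fun y => P (Φ y - x₀)) (ContinuousLinearMap.id ℝ E2) a :=
      (hasFDerivAt_id a).congr_of_eventuallyEq (by
        filter_upwards [hV.mem_nhds ha] with y hy using hP y hy)
    have h3 := h1.unique h2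
    intro v w hvw
    have h4 : ∀ u, P (fderiv ℝ Φ a u) = u := fun u => DFunLike.congr_fun h3 u
    rw [← h4 v, ← h4 w, hvw]
  set μ := ((μHE[2] : Measure E3).restrict (Φ '' V)).map fun x => P (x - x₀) with hμ
  set ν := (volume.restrict V).withDensity
    (fun y => ENNReal.ofReal (areaFactor (fderiv ℝ Φ y))) with hν
  have hμA : ∀ A ⊆ V, MeasurableSet A → μ A = (μHE[2] : Measure E3) (Φ '' A) := by
    intro A hAV hA
    rw [hμ, Measure.map_apply hmeas hA, Measure.restrict_apply (hmeas hA)]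
    congr 1
    ext x
    constructor
    · rintro ⟨h1, y, hy, rfl⟩
      simp only [mem_preimage, hP y hy] at h1
      exact ⟨y, h1, rfl⟩
    · rintro ⟨y, hy, rfl⟩
      exact ⟨by rw [mem_preimage, hP y (hAV hy)]; exact hy, y, hAV hy, rfl⟩
  have hνA : ∀ A ⊆ V, MeasurableSet A →
      ν A = ∫⁻ y in A, ENNReal.ofReal (areaFactor (fderiv ℝ Φ y)) := by
    intro A hAV hA
    rw [hν, withDensity_apply _ hA, Measure.restrict_restrict hA, inter_eq_left.2 hAV]
  have hle : ∀ K : ℝ≥0, 1 < K → ∀ A ⊆ V, MeasurableSet A →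
      μ A ≤ (K : ℝ≥0∞) ^ 3 * ν A ∧ ν A ≤ (K : ℝ≥0∞) ^ 3 * μ A := by
    intro K hK A hAV hA
    have hK0 : (K : ℝ≥0∞) ≠ ⊤ := ENNReal.coe_ne_top
    have key : ∀ a ∈ V, ∃ U, IsOpen U ∧ a ∈ U ∧ ∀ A ⊆ U ∩ V, MeasurableSet A →
        μ A ≤ (K : ℝ≥0∞) ^ 3 * ν A ∧ ν A ≤ (K : ℝ≥0∞) ^ 3 * μ A := by
      intro a ha
      obtain ⟨U, hUo, haU, hUV, h1, h2⟩ := exists_almost_linear hV hΦ ha (hinj a ha) hK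
      refine ⟨U, hUo, haU, fun A hA hAm => ?_⟩
      have hAU : A ⊆ U := fun x hx => (hA hx).1
      have hAV : A ⊆ V := fun x hx => (hA hx).2
      rw [hμA A hAV hAm, hνA A hAV hAm]
      have e1 := area_image_le_of_linear (A := A) (hinj a ha)
        (fun x hx y hy => (h1 x (hAU hx) y (hAU hy)).1)
      have e2 := linear_area_le_area_image (A := A) (hinjV.mono hAV)
        (fun x hx y hy => (h1 x (hAU hx) y (hAU hy)).2)
      have e3 : ENNReal.ofReal (areaFactor (fderiv ℝ Φ a)) * volume A ≤
          K * ∫⁻ y in A, ENNReal.ofReal (areaFactor (fderiv ℝ Φ y)) := by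
        rw [← lintegral_const_mul' _ _ hK0, ← setLIntegral_const]
        apply setLIntegral_mono' hAm
        intro y hy
        rw [← ENNReal.ofReal_coe_nnreal, ← ENNReal.ofReal_mul (by positivity)]
        exact ENNReal.ofReal_le_ofReal (h2 y (hAU hy)).1
      have e4 : ∫⁻ y in A, ENNReal.ofReal (areaFactor (fderiv ℝ Φ y)) ≤
          K * (ENNReal.ofReal (areaFactor (fderiv ℝ Φ a)) * volume A) := by
        rw [← setLIntegral_const, ← lintegral_const_mul' _ _ hK0]
        apply setLIntegral_mono' hAm
        intro y hy
        rw [← ENNReal.ofReal_coe_nnreal, ← ENNReal.ofReal_mul (by positivity)]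
        exact ENNReal.ofReal_le_ofReal (h2 y (hAU hy)).2
      have e1' : (μHE[2] : Measure E3) (Φ '' A) ≤
        (K : ℝ≥0∞) ^ 2 * (ENNReal.ofReal (areaFactor (fderiv ℝ Φ a)) * volume A) := e1
      have e2' : ENNReal.ofReal (areaFactor (fderiv ℝ Φ a)) * volume A ≤
        (K : ℝ≥0∞) ^ 2 * (μHE[2] : Measure E3) (Φ '' A) := e2
      constructor
      · refine e1'.trans ((mul_le_mul_right e3 _).trans (le_of_eq ?_))
        ring
      · refine e4.trans ((mul_le_mul_right e2' _).trans (le_of_eq ?_))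
        ring
    constructor
    · refine measure_le_of_locally_le (ν := (K : ℝ≥0∞) ^ 3 • ν) (fun a ha => ?_) hAV hA
      obtain ⟨U, h1, h2, h3⟩ := key a ha
      exact ⟨U, h1, h2, fun A hA hAm => (h3 A hA hAm).1⟩
    · refine measure_le_of_locally_le (ν := (K : ℝ≥0∞) ^ 3 • μ) (fun a ha => ?_) hAV hA
      obtain ⟨U, h1, h2, h3⟩ := key a ha
      exact ⟨U, h1, h2, fun A hA hAm => (h3 A hA hAm).2⟩
  have hlim : ∀ c : ℝ≥0∞, Tendsto (fun K : ℝ≥0 => (K : ℝ≥0∞) ^ 3 * c) (𝓝[>] 1) (𝓝 c) := by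
    intro c
    have h1 : Tendsto (fun K : ℝ≥0 => (K : ℝ≥0∞) ^ 3) (𝓝[>] 1) (𝓝 1) := by
      have : Continuous fun K : ℝ≥0 => ((K ^ 3 : ℝ≥0) : ℝ≥0∞) :=
        ENNReal.continuous_coe.comp (continuous_id.pow 3)
      have h2 := (this.tendsto 1).mono_left (nhdsWithin_le_nhds (s := Ioi 1))
      simpa using h2
    have := ENNReal.Tendsto.mul_const (b := c) h1 (Or.inl one_ne_zero)
    simpa using this
  have heq : ∀ A ⊆ V, MeasurableSet A → μ A = ν A := by
    intro A hAV hA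
    apply le_antisymm
    · refine ge_of_tendsto (hlim (ν A)) ?_
      filter_upwards [self_mem_nhdsWithin] with K hK using (hle K hK A hAV hA).1
    · refine ge_of_tendsto (hlim (μ A)) ?_
      filter_upwards [self_mem_nhdsWithin] with K hK using (hle K hK A hAV hA).2
  have hμV : μ Vᶜ = 0 := by
    rw [hμ, Measure.map_apply hmeas hV.measurableSet.compl,
      Measure.restrict_apply (hmeas hV.measurableSet.compl)]
    convert measure_empty (μ := (μHE[2] : Measure E3))
    rw [← disjoint_iff_inter_eq_empty, Set.disjoint_left]
    rintro _ h1 ⟨y, hy, rfl⟩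
    exact h1 (by change P (Φ y - x₀) ∈ V; rw [hP y hy]; exact hy)
  have hνV : ν Vᶜ = 0 := by
    rw [hν, withDensity_apply _ hV.measurableSet.compl,
      Measure.restrict_restrict hV.measurableSet.compl]
    simp
  ext A hA
  rw [← measure_inter_add_sdiff A hV.measurableSet, ← measure_inter_add_sdiff (μ := ν) A hV.measurableSet,
    heq _ inter_subset_right (hA.inter hV.measurableSet),
    measure_mono_null (fun x hx => hx.2 : A \ V ⊆ Vᶜ) hμV,
    measure_mono_null (fun x hx => hx.2 : A \ V ⊆ Vᶜ) hνV]

/-! ### Graph charts -/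

open Filter Topology in
/-- The normal is orthogonal to the derivative of every map into the surface. -/
theorem IsNormalField.inner_normal_of_mapsTo {O : Set E3} {N : E3 → E3} (hN : IsNormalField O N)
    {E : Type*} [NormedAddCommGroup E] [NormedSpace ℝ E] {γ : E → E3} {γ' : E →L[ℝ] E3} {y : E}
    (hγ : HasFDerivAt γ γ' y) (hM : ∀ᶠ z in 𝓝 y, γ z ∈ frontier O) (w : E) :
    ⟪N (γ y), γ' w⟫ = 0 := by
  have hx : γ y ∈ frontier O := hM.self_of_nhds
  obtain ⟨g, hg⟩ := hN.smooth_boundary _ hx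
  obtain ⟨U, hUo, hxU, hgU, hU⟩ := id hg
  have hgd : HasFDerivAt g (fderiv ℝ g (γ y)) (γ y) :=
    ((hgU.contDiffAt (hUo.mem_nhds hxU)).differentiableAt (by simp)).hasFDerivAt
  have h1 := hgd.comp y hγ
  have h2 : HasFDerivAt (g ∘ γ) (0 : E →L[ℝ] ℝ) y := by
    refine (hasFDerivAt_const (0 : ℝ) y).congr_of_eventuallyEq ?_
    filter_upwards [hM, hγ.continuousAt.eventually (hUo.mem_nhds hxU)] with z hz hzU
    exact (hU _ hzU).2.2.1 hz
  have h3 := DFunLike.congr_fun (h1.unique h2) w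
  rw [hN.eq _ hx, outwardNormal_eq hx hg, real_inner_smul_left, inner_gradient]
  have h4 : fderiv ℝ g (γ y) (γ' w) = 0 := h3
  rw [h4, mul_zero]

/-- The inclusion of the parameter plane spanned by two vectors of `ℝ³`. -/
def planeIncl (e₁ e₂ : E3) : E2 →L[ℝ] E3 :=
  (EuclideanSpace.proj 0 : E2 →L[ℝ] ℝ).smulRight e₁ +
    (EuclideanSpace.proj 1 : E2 →L[ℝ] ℝ).smulRight e₂

theorem planeIncl_apply (e₁ e₂ : E3) (y : E2) : planeIncl e₁ e₂ y = y 0 • e₁ + y 1 • e₂ := by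
  simp [planeIncl]

/-- The coordinates of a vector of `ℝ³` with respect to two vectors. -/
def planeProj (e₁ e₂ : E3) : E3 →L[ℝ] E2 :=
  (innerSL ℝ e₁).smulRight (EuclideanSpace.single 0 1) +
    (innerSL ℝ e₂).smulRight (EuclideanSpace.single 1 1)

theorem planeProj_apply_zero (e₁ e₂ v : E3) : planeProj e₁ e₂ v 0 = ⟪e₁, v⟫ := by
  simp [planeProj]

theorem planeProj_apply_one (e₁ e₂ v : E3) : planeProj e₁ e₂ v 1 = ⟪e₂, v⟫ := by
  simp [planeProj]

theorem IsFrame.norm_planeProj_le {n e₁ e₂ : E3} (h : IsFrame n e₁ e₂) (v : E3) :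
    ‖planeProj e₁ e₂ v‖ ≤ ‖v‖ := by
  rw [EuclideanSpace.norm_eq, Fin.sum_univ_two, planeProj_apply_zero, planeProj_apply_one]
  apply Real.sqrt_le_iff.2 ⟨norm_nonneg _, ?_⟩
  rw [← real_inner_self_eq_norm_sq v, h.inner_expand v v, Real.norm_eq_abs, Real.norm_eq_abs,
    sq_abs, sq_abs]
  nlinarith [mul_self_nonneg ⟪n, v⟫]

theorem IsFrame.norm_planeIncl {n e₁ e₂ : E3} (h : IsFrame n e₁ e₂) (y : E2) :
    ‖planeIncl e₁ e₂ y‖ = ‖y‖ := by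
  have : ‖planeIncl e₁ e₂ y‖ ^ 2 = ‖y‖ ^ 2 := by
    rw [← real_inner_self_eq_norm_sq, planeIncl_apply, EuclideanSpace.norm_sq_eq, Fin.sum_univ_two]
    simp only [inner_add_left, inner_add_right, real_inner_smul_left, real_inner_smul_right,
      h.e11, h.e22, h.e12, h.e21, Real.norm_eq_abs, sq_abs]
    ring
  exact (sq_eq_sq₀ (norm_nonneg _) (norm_nonneg _)).1 this

/-- `Φ` parametrizes the surface near `x₀` as a graph over the ball of radius `r` in the plane
spanned by `e₁, e₂`. -/
structure IsGraphChart (O : Set E3) (x₀ n e₁ e₂ : E3) (r : ℝ) (Φ : E2 → E3) : Prop where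
  pos : 0 < r
  frame : IsFrame n e₁ e₂
  smooth : ContDiffOn ℝ ∞ Φ (Metric.ball 0 r)
  mapsTo : MapsTo Φ (Metric.ball 0 r) (frontier O)
  graph : ∀ y ∈ Metric.ball (0 : E2) r, ∃ s : ℝ, Φ y = x₀ + planeIncl e₁ e₂ y + s • n
  surj : ∀ x ∈ frontier O, x ∈ Metric.ball x₀ r → Φ (planeProj e₁ e₂ (x - x₀)) = x

theorem IsNormalField.exists_graphChart {O : Set E3} {N : E3 → E3} (hN : IsNormalField O N)
    {x₀ : E3} (hx₀ : x₀ ∈ frontier O) :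
    ∃ (e₁ e₂ : E3) (r : ℝ) (Φ : E2 → E3), IsGraphChart O x₀ (N x₀) e₁ e₂ r Φ := by
  obtain ⟨e₁, e₂, h⟩ := hN.exists_frame hx₀
  obtain ⟨g, hg⟩ := hN.smooth_boundary _ hx₀
  obtain ⟨Ψ, r, hr, h1, -, -, h2, h3, h4⟩ := exists_local_straightening hx₀ hg
  rw [← outwardNormal_eq hx₀ hg, ← hN.eq x₀ hx₀] at h2 h3 h4
  have hin : MapsTo (fun y => x₀ + planeIncl e₁ e₂ y) (Metric.ball 0 r) (Metric.ball x₀ r) := by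
    intro y hy
    rw [Metric.mem_ball, dist_eq_norm] at hy ⊢
    rw [add_sub_cancel_left, h.norm_planeIncl]
    simpa using hy
  refine ⟨e₁, e₂, r, fun y => Ψ (x₀ + planeIncl e₁ e₂ y), hr, h, ?_, ?_, ?_, ?_⟩
  · exact h1.comp (contDiff_const.add (planeIncl e₁ e₂).contDiff).contDiffOn hin
  · intro y hy
    apply h3 _ (hin hy)
    rw [add_sub_cancel_left, planeIncl_apply]
    simp [inner_add_right, real_inner_smul_right, h.n1, h.n2]
  · intro y hy
    exact h2 _ (hin hy)
  · intro x hx hxr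
    rw [planeIncl_apply, planeProj_apply_zero, planeProj_apply_one]
    have := h4 x hxr hx
    have h5 := h.expand_tangent (inner_projT h.nn (x - x₀))
    rw [inner_projT_of_inner h.e1n, inner_projT_of_inner h.e2n] at h5
    rwa [← h5]

namespace IsGraphChart

variable {O : Set E3} {x₀ n e₁ e₂ : E3} {r : ℝ} {Φ : E2 → E3}
  (hc : IsGraphChart O x₀ n e₁ e₂ r Φ)
include hc

theorem proj_apply {y : E2} (hy : y ∈ Metric.ball (0 : E2) r) :
    planeProj e₁ e₂ (Φ y - x₀) = y := by
  obtain ⟨s, hs⟩ := hc.graph y hy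
  have h := hc.frame
  have h0 : Φ y - x₀ = y 0 • e₁ + y 1 • e₂ + s • n := by
    rw [hs, planeIncl_apply]; abel
  ext i
  fin_cases i
  · change planeProj e₁ e₂ _ 0 = _
    rw [planeProj_apply_zero, h0]
    simp [inner_add_right, real_inner_smul_right, h.e11, h.e12, h.e1n,
      -inner_self_eq_norm_sq_to_K]
  · change planeProj e₁ e₂ _ 1 = _
    rw [planeProj_apply_one, h0]
    simp [inner_add_right, real_inner_smul_right, h.e22, h.e21, h.e2n,
      -inner_self_eq_norm_sq_to_K]

theorem norm_le {y : E2} (hy : y ∈ Metric.ball (0 : E2) r) : ‖y‖ ≤ ‖Φ y - x₀‖ := by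
  conv_lhs => rw [← hc.proj_apply hy]
  exact hc.frame.norm_planeProj_le _

theorem proj_mem_ball {x : E3} {ρ : ℝ} (hx : x ∈ Metric.ball x₀ ρ) :
    planeProj e₁ e₂ (x - x₀) ∈ Metric.ball (0 : E2) ρ := by
  rw [mem_ball_zero_iff]
  rw [Metric.mem_ball, dist_eq_norm] at hx
  exact (hc.frame.norm_planeProj_le _).trans_lt hx

theorem subset_image {ρ : ℝ} (hρ : ρ ≤ r) :
    frontier O ∩ Metric.ball x₀ ρ ⊆ Φ '' Metric.ball 0 ρ := fun x hx =>
  ⟨_, hc.proj_mem_ball hx.2, hc.surj x hx.1 (Metric.ball_subset_ball hρ hx.2)⟩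

theorem injOn : InjOn Φ (Metric.ball 0 r) := fun y hy z hz h => by
  rw [← hc.proj_apply hy, ← hc.proj_apply hz, h]

theorem map_eq :
    (((μHE[2] : Measure E3).restrict (Φ '' Metric.ball 0 r)).map
      fun x => planeProj e₁ e₂ (x - x₀)) = (volume.restrict (Metric.ball 0 r)).withDensity
        (fun y => ENNReal.ofReal (areaFactor (fderiv ℝ Φ y))) :=
  map_areaMeasure_chart Metric.isOpen_ball (hc.smooth.of_le (by simp)) _ _
    (fun _ hy => hc.proj_apply hy)

theorem measure_image {A : Set E2} (hA : A ⊆ Metric.ball 0 r) (hAm : MeasurableSet A) :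
    (μHE[2] : Measure E3) (Φ '' A) = ∫⁻ y in A, ENNReal.ofReal (areaFactor (fderiv ℝ Φ y)) := by
  have h := congrArg (fun μ : Measure E2 => μ A) hc.map_eq
  have hmeas : Measurable fun x : E3 => planeProj e₁ e₂ (x - x₀) := by fun_prop
  simp only [withDensity_apply _ hAm, Measure.restrict_restrict hAm, inter_eq_left.2 hA,
    Measure.map_apply hmeas hAm, Measure.restrict_apply (hmeas hAm)] at h
  rw [← h]
  congr 1
  ext x
  constructor
  · rintro ⟨y, hy, rfl⟩
    exact ⟨by rw [mem_preimage, hc.proj_apply (hA hy)]; exact hy, y, hA hy, rfl⟩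
  · rintro ⟨h1, y, hy, rfl⟩
    rw [mem_preimage, hc.proj_apply hy] at h1
    exact ⟨y, h1, rfl⟩

theorem measure_image_lt_top {ρ : ℝ} (hρ : ρ < r) :
    (μHE[2] : Measure E3) (Φ '' Metric.ball 0 ρ) < ⊤ := by
  rw [hc.measure_image (Metric.ball_subset_ball hρ.le) measurableSet_ball]
  have hcont : ContinuousOn (fun y => areaFactor (fderiv ℝ Φ y)) (Metric.closedBall 0 ρ) := by
    apply continuous_areaFactor.comp_continuousOn
    exact (hc.smooth.continuousOn_fderiv_of_isOpen Metric.isOpen_ball (by simp)).mono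
      (Metric.closedBall_subset_ball hρ)
  have hint : IntegrableOn (fun y => areaFactor (fderiv ℝ Φ y)) (Metric.ball 0 ρ) :=
    (hcont.integrableOn_compact (isCompact_closedBall _ _)).mono_set Metric.ball_subset_closedBall
  exact hint.lintegral_lt_top

/-- Lower bound for the area of small pieces of the surface. -/
theorem exists_area_lower_bound : ∃ ρ > 0, ∃ c > 0, ∃ ε₀ > 0, ∀ x ∈ frontier O,
    x ∈ Metric.ball x₀ ρ → ∀ ε, 0 < ε → ε ≤ ε₀ →
      ENNReal.ofReal (c * ε ^ 2) ≤ areaMeasure O (Metric.ball x ε) := by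
  have hr := hc.pos
  obtain ⟨L, hL⟩ : ∃ L : NNReal, LipschitzOnWith L Φ (Metric.closedBall 0 (r / 2)) := by
    have h1 : ContDiffOn ℝ 1 Φ (Metric.closedBall 0 (r / 2)) :=
      (hc.smooth.of_le (by simp)).mono (Metric.closedBall_subset_ball (by linarith))
    exact h1.exists_lipschitzOnWith one_ne_zero (convex_closedBall _ _) (isCompact_closedBall _ _)
  set K : ℝ := L + 1 with hK
  have hK0 : 0 < K := by positivity
  refine ⟨r / 4, by positivity, Real.pi / K ^ 2, by positivity, K * (r / 4), by positivity, ?_⟩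
  intro x hx hxr ε hε hε'
  set y := planeProj e₁ e₂ (x - x₀) with hy
  have hyb : y ∈ Metric.ball (0 : E2) (r / 4) := hc.proj_mem_ball hxr
  have hxy : Φ y = x := hc.surj x hx (Metric.ball_subset_ball (by linarith) hxr)
  have hεK : ε / K ≤ r / 4 := by rw [div_le_iff₀ hK0]; linarith
  have hsub : Metric.ball y (ε / K) ⊆ Metric.ball (0 : E2) (r / 2) := by
    apply Metric.ball_subset_ball'
    rw [Metric.mem_ball] at hyb
    linarith
  have hsub' : Φ '' Metric.ball y (ε / K) ⊆ Metric.ball x ε ∩ frontier O := by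
    rintro _ ⟨z, hz, rfl⟩
    refine ⟨?_, hc.mapsTo (Metric.ball_subset_ball (by linarith) (hsub hz))⟩
    rw [Metric.mem_ball, ← hxy]
    have h1 := hL.dist_le_mul z (Metric.ball_subset_closedBall (hsub hz)) y
      (Metric.ball_subset_closedBall (Metric.ball_subset_ball (by linarith) hyb))
    rw [Metric.mem_ball] at hz
    have h2 : (L : ℝ) * dist z y ≤ K * dist z y := by
      rw [hK]; nlinarith [dist_nonneg (x := z) (y := y)]
    have h3 : K * dist z y < ε := by rwa [lt_div_iff₀' hK0] at hz
    linarith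
  rw [areaMeasure, Measure.restrict_apply measurableSet_ball]
  refine le_trans ?_ (measure_mono hsub')
  have himg : (fun x => planeProj e₁ e₂ (x - x₀)) '' (Φ '' Metric.ball y (ε / K)) =
      Metric.ball y (ε / K) := by
    rw [image_image]
    conv_rhs => rw [← image_id (Metric.ball y (ε / K))]
    apply image_congr
    intro z hz
    exact hc.proj_apply (Metric.ball_subset_ball (by linarith) (hsub hz))
  have hlip : LipschitzOnWith 1 (fun x : E3 => planeProj e₁ e₂ (x - x₀))
      (Φ '' Metric.ball y (ε / K)) := by
    apply LipschitzOnWith.of_dist_le_mul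
    intro a _ b _
    rw [dist_eq_norm, dist_eq_norm, ← map_sub, sub_sub_sub_cancel_right]
    simpa using hc.frame.norm_planeProj_le (a - b)
  have h1 := euclideanHausdorffMeasure_image_le hlip
  rw [himg] at h1
  have hvol : (μHE[2] : Measure E2) = volume :=
    EuclideanSpace.euclideanHausdorffMeasure_eq_volume 2
  rw [hvol, EuclideanSpace.volume_ball_fin_two] at h1
  simp only [ENNReal.coe_one, one_pow, one_mul] at h1
  refine le_trans (le_of_eq ?_) h1
  rw [← ENNReal.ofReal_pow (by positivity), ← ENNReal.ofReal_mul (by positivity)]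
  congr 1
  field_simp

end IsGraphChart

/-! ### The area measure -/

theorem sdiv_add {N X Y : E3 → E3} {x : E3} (hX : DifferentiableAt ℝ X x)
    (hY : DifferentiableAt ℝ Y x) :
    sdiv N (fun y => X y + Y y) x = sdiv N X x + sdiv N Y x := by
  have h : fderiv ℝ (fun y => X y + Y y) x = fderiv ℝ X x + fderiv ℝ Y x := fderiv_fun_add hX hY
  simp only [sdiv, trT_eq_traceL, h, map_add, add_apply, inner_add_right]
  ring

namespace IsNormalField

variable {O : Set E3} {N : E3 → E3} (hN : IsNormalField O N)
include hN

open Filter Topology in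
theorem isFiniteMeasure : IsFiniteMeasure (areaMeasure O) := by
  refine ⟨?_⟩
  rw [areaMeasure, Measure.restrict_apply_univ]
  refine hN.isCompact.measure_lt_top_of_nhdsWithin (fun x hx => ?_)
  obtain ⟨e₁, e₂, r, Φ, hc⟩ := hN.exists_graphChart hx
  have hr := hc.pos
  refine ⟨frontier O ∩ Metric.ball x (r / 2), ?_, ?_⟩
  · exact inter_mem self_mem_nhdsWithin
      (mem_nhdsWithin_of_mem_nhds (Metric.ball_mem_nhds x (by positivity)))
  · exact (measure_mono (hc.subset_image (by linarith))).trans_lt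
      (hc.measure_image_lt_top (by linarith))

theorem exists_area_lower_bound : ∃ c > 0, ∃ ε₀ > 0, ∀ x ∈ frontier O, ∀ ε, 0 < ε → ε ≤ ε₀ →
    ENNReal.ofReal (c * ε ^ 2) ≤ areaMeasure O (Metric.ball x ε) := by
  have hloc : ∀ x₀ ∈ frontier O, ∃ ρ > 0, ∃ c > 0, ∃ ε₀ > 0, ∀ x ∈ frontier O,
      x ∈ Metric.ball x₀ ρ → ∀ ε, 0 < ε → ε ≤ ε₀ →
      ENNReal.ofReal (c * ε ^ 2) ≤ areaMeasure O (Metric.ball x ε) := by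
    intro x₀ hx₀
    obtain ⟨e₁, e₂, r, Φ, hc⟩ := hN.exists_graphChart hx₀
    exact hc.exists_area_lower_bound
  choose! ρ hρ c hc ε₀ hε₀ h using hloc
  obtain ⟨t, htM, ht⟩ := hN.isCompact.elim_nhds_subcover (fun x => Metric.ball x (ρ x))
    (fun x hx => Metric.ball_mem_nhds x (hρ x hx))
  rcases t.eq_empty_or_nonempty with rfl | hne
  · refine ⟨1, one_pos, 1, one_pos, fun x hx => ?_⟩
    simpa using ht hx
  refine ⟨t.inf' hne c, ?_, t.inf' hne ε₀, ?_, ?_⟩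
  · rw [gt_iff_lt, Finset.lt_inf'_iff]; exact fun x hx => hc x (htM x hx)
  · rw [gt_iff_lt, Finset.lt_inf'_iff]; exact fun x hx => hε₀ x (htM x hx)
  · intro x hx ε hε hε'
    obtain ⟨x₀, hx₀, hxb⟩ := mem_iUnion₂.1 (ht hx)
    refine le_trans (ENNReal.ofReal_le_ofReal ?_) (h x₀ (htM x₀ hx₀) x hx hxb ε hε
      (hε'.trans (Finset.inf'_le _ hx₀)))
    gcongr
    exact Finset.inf'_le _ hx₀

theorem areaMeasure_restrict : (areaMeasure O).restrict (frontier O) = areaMeasure O := by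
  rw [areaMeasure, Measure.restrict_restrict hN.isCompact.isClosed.measurableSet, inter_self]

theorem ae_mem : ∀ᵐ x ∂(areaMeasure O), x ∈ frontier O := by
  rw [areaMeasure]; exact ae_restrict_mem hN.isCompact.isClosed.measurableSet

theorem integrable {F : Type*} [NormedAddCommGroup F] {f : E3 → F}
    (hf : ContinuousOn f (frontier O)) : Integrable f (areaMeasure O) := by
  have := hN.isFiniteMeasure
  have h := hf.integrableOn_compact (μ := areaMeasure O) hN.isCompact
  rwa [IntegrableOn, hN.areaMeasure_restrict] at h

theorem integral_congr {F : Type*} [NormedAddCommGroup F] [NormedSpace ℝ F] {f g : E3 → F}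
    (h : ∀ x ∈ frontier O, f x = g x) : ∫ x, f x ∂(areaMeasure O) = ∫ x, g x ∂(areaMeasure O) :=
  integral_congr_ae (by filter_upwards [hN.ae_mem] with x hx using h x hx)

theorem continuous_sdiv {X : E3 → E3} (hX : ContDiff ℝ 1 X) : Continuous (sdiv N X) := by
  have h1 : Continuous (fderiv ℝ X) := hX.continuous_fderiv one_ne_zero
  have h2 := hN.smooth.continuous
  have : sdiv N X = fun x => traceL (fderiv ℝ X x) - ⟪N x, fderiv ℝ X x (N x)⟫ := rfl
  rw [this]
  exact (traceL.continuous.comp h1).sub (h2.inner (h1.clm_apply h2))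

theorem sdiv_congr {X Y : E3 → E3} {x : E3} (hx : x ∈ frontier O) (hX : DifferentiableAt ℝ X x)
    (hY : DifferentiableAt ℝ Y x) (h : ∀ y ∈ frontier O, X y = Y y) :
    sdiv N X x = sdiv N Y x := by
  rw [← hN.surfaceDiv_eq hx hX (fun _ _ => rfl), ← hN.surfaceDiv_eq hx hY (fun y hy => (h y hy).symm)]

end IsNormalField

/-! ### The divergence theorem -/

theorem integral_fderiv_eq_zero {G : E2 → ℝ} (hG : ContDiff ℝ 1 G) (hc : HasCompactSupport G)
    (v : E2) : ∫ y, fderiv ℝ G y v = 0 := by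
  have hcont : Continuous fun y => fderiv ℝ G y v :=
    (hG.continuous_fderiv one_ne_zero).clm_apply continuous_const
  have h := integral_mul_fderiv_eq_neg_fderiv_mul_of_integrable (μ := (volume : Measure E2))
    (f := fun _ : E2 => (1 : ℝ)) (g := G) (v := v) (by simp)
    (by simpa using hcont.integrable_of_hasCompactSupport (hc.fderiv_apply ℝ v))
    (by simpa using hG.continuous.integrable_of_hasCompactSupport hc)
    (fun x _ => by fun_prop) (fun x _ => hG.differentiable one_ne_zero x)
  simpa using h

/-- A function on a ball that vanishes away from the center extends by zero. -/
theorem contDiff_extend_zero {G : E2 → ℝ} {r ρ : ℝ} (hρ : ρ < r)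
    (hG : ContDiffOn ℝ 1 G (Metric.ball 0 r))
    (h0 : ∀ y ∈ Metric.ball (0 : E2) r, ρ ≤ ‖y‖ → G y = 0) :
    ContDiff ℝ 1 ((Metric.ball (0 : E2) r).indicator G) ∧
      HasCompactSupport ((Metric.ball (0 : E2) r).indicator G) := by
  have hz : ∀ y : E2, ρ ≤ ‖y‖ → (Metric.ball (0 : E2) r).indicator G y = 0 := by
    intro y hy
    by_cases hyr : y ∈ Metric.ball (0 : E2) r
    · rw [indicator_of_mem hyr, h0 y hyr hy]
    · rw [indicator_of_notMem hyr]
  constructor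
  · rw [contDiff_iff_contDiffAt]
    intro y
    by_cases hyr : y ∈ Metric.ball (0 : E2) r
    · refine (hG.contDiffAt (Metric.isOpen_ball.mem_nhds hyr)).congr_of_eventuallyEq ?_
      filter_upwards [Metric.isOpen_ball.mem_nhds hyr] with z hz
      rw [indicator_of_mem hz]
    · have hy : ρ < ‖y‖ := by
        rw [mem_ball_zero_iff, not_lt] at hyr; linarith
      refine contDiffAt_const (c := (0 : ℝ)) |>.congr_of_eventuallyEq ?_
      filter_upwards [(isOpen_lt continuous_const continuous_norm).mem_nhds hy] with z hz'
      exact hz z (le_of_lt hz')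
  · apply HasCompactSupport.intro (isCompact_closedBall (0 : E2) ρ)
    intro y hy
    rw [mem_closedBall_zero_iff, not_le] at hy
    exact hz y hy.le

namespace IsGraphChart

variable {O : Set E3} {x₀ n e₁ e₂ : E3} {r : ℝ} {Φ : E2 → E3}
  (hc : IsGraphChart O x₀ n e₁ e₂ r Φ)
include hc

/-- Integrals over the surface of functions supported in the chart. -/
theorem integral_eq {F : E3 → ℝ} (hM : IsCompact (frontier O)) (hF : Continuous F)
    (hF0 : ∀ x ∈ frontier O, x ∉ Metric.ball x₀ r → F x = 0) :
    ∫ x, F x ∂(areaMeasure O) =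
      ∫ y in Metric.ball (0 : E2) r, areaFactor (fderiv ℝ Φ y) * F (Φ y) := by
  set V := Metric.ball (0 : E2) r with hV
  have hΦc : ContinuousOn Φ V := hc.smooth.continuousOn
  have hmV : MeasurableSet (Φ '' V) :=
    measurableSet_ball.image_of_continuousOn_injOn hΦc hc.injOn
  have hJm : Measurable fun y => ENNReal.ofReal (areaFactor (fderiv ℝ Φ y)) :=
    (continuous_areaFactor.measurable.comp (measurable_fderiv ℝ Φ)).ennreal_ofReal
  have h1 : ∫ x, F x ∂(areaMeasure O) = ∫ x in Φ '' V, F x ∂(μHE[2] : Measure E3) := by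
    rw [areaMeasure]
    apply setIntegral_eq_of_subset_of_forall_sdiff_eq_zero hM.isClosed.measurableSet
      hc.mapsTo.image_subset
    intro x hx
    refine hF0 x hx.1 (fun hxb => hx.2 ?_)
    exact hc.subset_image le_rfl ⟨hx.1, hxb⟩
  have h2 : ∫ x in Φ '' V, F x ∂(μHE[2] : Measure E3) =
      ∫ x in Φ '' V, F (Φ (planeProj e₁ e₂ (x - x₀))) ∂(μHE[2] : Measure E3) := by
    apply setIntegral_congr_fun hmV
    rintro _ ⟨y, hy, rfl⟩
    simp only [hc.proj_apply hy]
  have h3 : ∫ x in Φ '' V, F (Φ (planeProj e₁ e₂ (x - x₀))) ∂(μHE[2] : Measure E3) =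
      ∫ y, F (Φ y) ∂(((μHE[2] : Measure E3).restrict (Φ '' V)).map
        fun x => planeProj e₁ e₂ (x - x₀)) := by
    rw [integral_map]
    · exact (by fun_prop : Measurable fun x : E3 => planeProj e₁ e₂ (x - x₀)).aemeasurable
    · rw [hc.map_eq]
      apply AEStronglyMeasurable.mono_ac (withDensity_absolutelyContinuous _ _)
      exact (hF.comp_continuousOn hΦc).aestronglyMeasurable measurableSet_ball
  rw [h1, h2, h3, hc.map_eq, integral_withDensity_eq_integral_toReal_smul hJm
    (Filter.Eventually.of_forall fun _ => ENNReal.ofReal_lt_top)]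
  refine setIntegral_congr_fun measurableSet_ball (fun y _ => ?_)
  simp only [smul_eq_mul]
  rw [ENNReal.toReal_ofReal]
  exact LinearMap.normDet_nonneg _

end IsGraphChart

/-- Pointwise form of the divergence in a graph chart: in the chart of the graph of `h`, with
`σ² = 1 + |∇h|²`, one has `σ div Y = ∂₁(σ c₁) + ∂₂(σ c₂)`. Here `bᵢ` and `vᵢⱼ` are the components of
the derivative of `Y` in the normal and tangential directions. -/
theorem divergence_graph_identity {h₁ h₂ h₁₁ h₁₂ h₂₂ σ σ₁ σ₂ c₁ c₂ k b₁ b₂ b₃ v₁₁ v₁₂ v₂₁ v₂₂ v₃₁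
    v₃₂ : ℝ} (hσ0 : 0 < σ)
    (hσ1 : σ * σ₁ = h₁ * h₁₁ + h₂ * h₁₂) (hσ2 : σ * σ₂ = h₁ * h₁₂ + h₂ * h₂₂)
    (hk : k ^ 2 * σ ^ 2 = 1)
    (hv1 : v₃₁ = h₁₁ * c₁ + h₁ * v₁₁ + h₁₂ * c₂ + h₂ * v₂₁)
    (hv2 : v₃₂ = h₁₂ * c₁ + h₁ * v₁₂ + h₂₂ * c₂ + h₂ * v₂₂) :
    σ * ((v₁₁ - h₁ * b₁) + (v₂₂ - h₂ * b₂) + b₃ -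
      k ^ 2 * (σ ^ 2 * (b₃ - h₁ * b₁ - h₂ * b₂) - h₁ * (v₃₁ - h₁ * v₁₁ - h₂ * v₂₁)
        - h₂ * (v₃₂ - h₁ * v₁₂ - h₂ * v₂₂))) =
      σ₁ * c₁ + σ * v₁₁ + (σ₂ * c₂ + σ * v₂₂) := by
  have hσ' : σ ≠ 0 := hσ0.ne'
  have hk' : k ^ 2 = (σ ^ 2)⁻¹ := eq_inv_of_mul_eq_one_left hk
  have h1 : σ₁ = (h₁ * h₁₁ + h₂ * h₁₂) / σ := by rw [eq_div_iff hσ', mul_comm]; exact hσ1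
  have h2 : σ₂ = (h₁ * h₁₂ + h₂ * h₂₂) / σ := by rw [eq_div_iff hσ', mul_comm]; exact hσ2
  rw [hk', h1, h2, hv1, hv2]
  field_simp
  ring

namespace IsNormalField

variable {O : Set E3} {N : E3 → E3} (hN : IsNormalField O N)
include hN

open Filter Topology in
/-- The divergence theorem for tangent fields supported in a graph chart. -/
theorem integral_sdiv_eq_zero_of_chart {x₀ e₁ e₂ : E3} {r : ℝ} {Φ : E2 → E3}
    (hc : IsGraphChart O x₀ (N x₀) e₁ e₂ r Φ) {Y : E3 → E3} (hY : ContDiff ℝ 1 Y)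
    (ht : ∀ x ∈ frontier O, ⟪N x, Y x⟫ = 0) (hs : tsupport Y ⊆ Metric.ball x₀ (r / 2)) :
    ∫ x, sdiv N Y x ∂(areaMeasure O) = 0 := by
  have hr := hc.pos
  obtain ⟨n, hn⟩ : ∃ n, n = N x₀ := ⟨_, rfl⟩
  rw [← hn] at hc
  have hf := hc.frame
  obtain ⟨V, hV⟩ : ∃ V, V = Metric.ball (0 : E2) r := ⟨_, rfl⟩
  have hVo : IsOpen V := hV ▸ Metric.isOpen_ball
  have hYd : Differentiable ℝ Y := hY.differentiable one_ne_zero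
  have hF0 : ∀ x ∉ tsupport Y, sdiv N Y x = 0 := by
    intro x hx
    have : fderiv ℝ Y x = 0 := by
      by_contra h
      exact hx (support_fderiv_subset ℝ h)
    simp [sdiv, trT, this]
  rw [hc.integral_eq hN.isCompact (hN.continuous_sdiv hY) (fun x _ hx => hF0 x (fun h =>
    hx (Metric.ball_subset_ball (by linarith) (hs h)))), ← hV]
  set h : E2 → ℝ := fun y => ⟪n, Φ y - x₀⟫ with hh
  have hΦs : ContDiffOn ℝ ∞ Φ V := hV ▸ hc.smooth
  have hhs : ContDiffOn ℝ ∞ h V := contDiffOn_const.inner ℝ (hΦs.sub contDiffOn_const)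
  have hgraph : ∀ y ∈ V, Φ y = x₀ + planeIncl e₁ e₂ y + h y • n := by
    intro y hy
    obtain ⟨s, hs⟩ := hc.graph y (hV ▸ hy)
    have : h y = s := by
      simp only [hh, hs, planeIncl_apply]
      rw [show x₀ + (y 0 • e₁ + y 1 • e₂) + s • n - x₀ = y 0 • e₁ + y 1 • e₂ + s • n by abel]
      simp only [inner_add_right, real_inner_smul_right, hf.n1, hf.n2, hf.nn]
      ring
    rw [this, hs]
  obtain ⟨d, hd⟩ : ∃ d : Fin 2 → E2, d = fun i => EuclideanSpace.single i (1 : ℝ) := ⟨_, rfl⟩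
  have hhd : ∀ y ∈ V, DifferentiableAt ℝ h y := fun y hy =>
    (hhs.contDiffAt (hVo.mem_nhds hy)).differentiableAt (by simp)
  have hΦd : ∀ y ∈ V, HasFDerivAt Φ (planeIncl e₁ e₂ + (fderiv ℝ h y).smulRight n) y := by
    intro y hy
    have h1 : HasFDerivAt (fun y => x₀ + planeIncl e₁ e₂ y + h y • n)
        (planeIncl e₁ e₂ + (fderiv ℝ h y).smulRight n) y :=
      ((planeIncl e₁ e₂).hasFDerivAt.const_add x₀).add ((hhd y hy).hasFDerivAt.smul_const n)
    exact h1.congr_of_eventuallyEq (by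
      filter_upwards [hVo.mem_nhds hy] with z hz using hgraph z hz)
  -- the gradient of the graph function and the area factor
  set p : Fin 2 → E2 → ℝ := fun i y => fderiv ℝ h y (d i) with hp
  have hps : ∀ i, ContDiffOn ℝ ∞ (p i) V := fun i =>
    (hhs.fderiv_of_isOpen hVo (by simp)).clm_apply contDiffOn_const
  have hpd : ∀ i, ∀ y ∈ V, DifferentiableAt ℝ (p i) y := fun i y hy =>
    ((hps i).contDiffAt (hVo.mem_nhds hy)).differentiableAt (by simp)
  set σ : E2 → ℝ := fun y => √(1 + p 0 y ^ 2 + p 1 y ^ 2) with hσ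
  have hσpos : ∀ y, 0 < 1 + p 0 y ^ 2 + p 1 y ^ 2 := fun y => by positivity
  have hσs : ContDiffOn ℝ ∞ σ V :=
    ((contDiffOn_const.add ((hps 0).pow 2)).add ((hps 1).pow 2)).sqrt (fun y _ => (hσpos y).ne')
  have hσd : ∀ y ∈ V, DifferentiableAt ℝ σ y := fun y hy =>
    (hσs.contDiffAt (hVo.mem_nhds hy)).differentiableAt (by simp)
  have hσ0 : ∀ y, 0 < σ y := fun y => Real.sqrt_pos.2 (hσpos y)
  have hσsq : ∀ y, σ y ^ 2 = 1 + p 0 y ^ 2 + p 1 y ^ 2 := fun y => Real.sq_sqrt (hσpos y).le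
  have hΦ0 : ∀ y ∈ V, fderiv ℝ Φ y (d 0) = e₁ + p 0 y • n := by
    intro y hy
    rw [(hΦd y hy).fderiv]
    simp [planeIncl_apply, hd, hp]
  have hΦ1 : ∀ y ∈ V, fderiv ℝ Φ y (d 1) = e₂ + p 1 y • n := by
    intro y hy
    rw [(hΦd y hy).fderiv]
    simp [planeIncl_apply, hd, hp]
  have hJ : ∀ y ∈ V, areaFactor (fderiv ℝ Φ y) = σ y := by
    intro y hy
    have e0 : EuclideanSpace.single 0 (1 : ℝ) = d 0 := by rw [hd]
    have e1 : EuclideanSpace.single 1 (1 : ℝ) = d 1 := by rw [hd]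
    rw [areaFactor_eq, hσ, e0, e1, hΦ0 y hy, hΦ1 y hy, ← real_inner_self_eq_norm_sq,
      ← real_inner_self_eq_norm_sq]
    congr 1
    simp only [inner_add_left, inner_add_right, real_inner_smul_left, real_inner_smul_right,
      hf.e11, hf.e22, hf.e12, hf.e1n, hf.e2n, hf.n1, hf.n2, hf.nn]
    ring
  -- the components of the field in the chart
  have hYΦ : ContDiffOn ℝ 1 (fun y => Y (Φ y)) V :=
    hY.comp_contDiffOn (hΦs.of_le (by simp))
  have hYΦd : ∀ y ∈ V, HasFDerivAt (fun y => Y (Φ y)) (fderiv ℝ Y (Φ y) ∘L fderiv ℝ Φ y) y :=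
    fun y hy => (hYd (Φ y)).hasFDerivAt.comp y (hΦd y hy).differentiableAt.hasFDerivAt
  set c : E3 → E2 → ℝ := fun e y => ⟪e, Y (Φ y)⟫ with hcdef
  have hcs : ∀ e, ContDiffOn ℝ 1 (c e) V := fun e => contDiffOn_const.inner ℝ hYΦ
  have hcd : ∀ e, ∀ y ∈ V, HasFDerivAt (c e) ((innerSL ℝ e) ∘L fderiv ℝ Y (Φ y) ∘L fderiv ℝ Φ y) y :=
    fun e y hy => (innerSL ℝ e).hasFDerivAt.comp y (hYΦd y hy)
  have hc0 : ∀ e, ∀ y ∈ V, r / 2 ≤ ‖y‖ → c e y = 0 := by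
    intro e y hy hyr
    have h1 : Φ y ∉ tsupport Y := by
      intro hmem
      have h2 := hs hmem
      rw [Metric.mem_ball, dist_eq_norm] at h2
      have := hc.norm_le (hV ▸ hy)
      linarith
    simp only [hcdef, image_eq_zero_of_notMem_tsupport h1, inner_zero_right]
  have hG : ∀ e, ContDiff ℝ 1 (V.indicator fun y => σ y * c e y) ∧
      HasCompactSupport (V.indicator fun y => σ y * c e y) := by
    intro e
    have h1 : ContDiffOn ℝ 1 (fun y => σ y * c e y) V := (hσs.of_le (by simp)).mul (hcs e)
    rw [hV] at h1 ⊢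
    exact contDiff_extend_zero (ρ := r / 2) (by linarith) h1
      (fun y hy hyr => by rw [hc0 e y (hV ▸ hy) hyr, mul_zero])
  have hI : ∀ e i, ∫ y in V, fderiv ℝ (fun y => σ y * c e y) y (d i) = 0 := by
    intro e i
    rw [← integral_fderiv_eq_zero (hG e).1 (hG e).2 (d i)]
    rw [← integral_indicator hVo.measurableSet]
    congr 1
    ext y
    by_cases hy : y ∈ V
    · rw [indicator_of_mem hy]
      congr 1
      apply Filter.EventuallyEq.fderiv_eq
      filter_upwards [hVo.mem_nhds hy] with z hz
      rw [indicator_of_mem hz]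
    · rw [indicator_of_notMem hy]
      have h1 : fderiv ℝ (V.indicator fun y => σ y * c e y) y = 0 := by
        have h2 : V.indicator (fun y => σ y * c e y) =ᶠ[𝓝 y] fun _ => 0 := by
          have hyr : r / 2 < ‖y‖ := by
            rw [hV, mem_ball_zero_iff, not_lt] at hy; linarith
          filter_upwards [(isOpen_lt continuous_const continuous_norm).mem_nhds hyr] with z hz
          by_cases hzV : z ∈ V
          · rw [indicator_of_mem hzV, hc0 e z hzV (le_of_lt hz), mul_zero]
          · rw [indicator_of_notMem hzV]
        rw [h2.fderiv_eq]
        simp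
      rw [h1]; simp
  have hint : ∀ e i, IntegrableOn (fun y => fderiv ℝ (fun y => σ y * c e y) y (d i)) V := by
    intro e i
    have h1 : Integrable fun y => fderiv ℝ (V.indicator fun y => σ y * c e y) y (d i) :=
      (((hG e).1.continuous_fderiv one_ne_zero).clm_apply
        continuous_const).integrable_of_hasCompactSupport ((hG e).2.fderiv_apply ℝ (d i))
    refine (h1.integrableOn (s := V)).congr_fun (fun y hy => ?_) hVo.measurableSet
    change fderiv ℝ _ y (d i) = fderiv ℝ _ y (d i)
    congr 1
    apply Filter.EventuallyEq.fderiv_eq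
    filter_upwards [hVo.mem_nhds hy] with z hz
    rw [indicator_of_mem hz]
  have hkey : ∀ y ∈ V, areaFactor (fderiv ℝ Φ y) * sdiv N Y (Φ y) =
      fderiv ℝ (fun y => σ y * c e₁ y) y (d 0) + fderiv ℝ (fun y => σ y * c e₂ y) y (d 1) := by
    intro y hy
    have hyM : ∀ᶠ z in 𝓝 y, Φ z ∈ frontier O := by
      filter_upwards [hVo.mem_nhds hy] with z hz using hc.mapsTo (hV ▸ hz)
    -- the normal at `Φ y`
    have hperp : ∀ z ∈ V, N (Φ z) = ⟪n, N (Φ z)⟫ • (n - p 0 z • e₁ - p 1 z • e₂) := by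
      intro z hz
      have hzM : ∀ᶠ w in 𝓝 z, Φ w ∈ frontier O := by
        filter_upwards [hVo.mem_nhds hz] with w hw using hc.mapsTo (hV ▸ hw)
      have q0 := hN.inner_normal_of_mapsTo (hΦd z hz).differentiableAt.hasFDerivAt hzM (d 0)
      have q1 := hN.inner_normal_of_mapsTo (hΦd z hz).differentiableAt.hasFDerivAt hzM (d 1)
      rw [hΦ0 z hz, inner_add_right, real_inner_smul_right, real_inner_comm, real_inner_comm n] at q0
      rw [hΦ1 z hz, inner_add_right, real_inner_smul_right, real_inner_comm, real_inner_comm n] at q1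
      apply hf.ext_inner
      · simp only [real_inner_smul_right, inner_sub_right, hf.e11, hf.e12, hf.e1n]
        linarith
      · simp only [real_inner_smul_right, inner_sub_right, hf.e22, hf.e21, hf.e2n]
        linarith
      · simp only [real_inner_smul_right, inner_sub_right, hf.n1, hf.n2, hf.nn]
        ring
    have hm := hperp y hy
    set k := ⟪n, N (Φ y)⟫ with hk
    have hkσ : k ^ 2 * σ y ^ 2 = 1 := by
      have h1 := hN.inner_self (hyM.self_of_nhds)
      rw [hm] at h1
      simp only [inner_sub_left, inner_sub_right, real_inner_smul_left, real_inner_smul_right,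
        hf.e11, hf.e22, hf.e12, hf.e21, hf.e1n, hf.e2n, hf.n1, hf.n2, hf.nn] at h1
      rw [hσsq]
      linarith
    -- tangency in the chart
    have htan : ∀ z ∈ V, c n z = p 0 z * c e₁ z + p 1 z * c e₂ z := by
      intro z hz
      have h1 := ht (Φ z) (hc.mapsTo (hV ▸ hz))
      rw [hperp z hz, real_inner_smul_left] at h1
      have h2 : ⟪n, N (Φ z)⟫ ≠ 0 := by
        intro h0
        have h3 := hN.inner_self (hc.mapsTo (hV ▸ hz))
        rw [hperp z hz, h0] at h3
        simp at h3
      have h3 := (mul_eq_zero.1 h1).resolve_left h2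
      simp only [inner_sub_left, real_inner_smul_left] at h3
      simp only [hcdef]
      linarith
    have htd : ∀ w, fderiv ℝ (c n) y w = fderiv ℝ (p 0) y w * c e₁ y + p 0 y * fderiv ℝ (c e₁) y w
        + (fderiv ℝ (p 1) y w * c e₂ y + p 1 y * fderiv ℝ (c e₂) y w) := by
      intro w
      have h1 : c n =ᶠ[𝓝 y] fun z => p 0 z * c e₁ z + p 1 z * c e₂ z := by
        filter_upwards [hVo.mem_nhds hy] with z hz using htan z hz
      rw [h1.fderiv_eq]
      have h2 := ((hpd 0 y hy).hasFDerivAt.mul (hcd e₁ y hy).differentiableAt.hasFDerivAt).add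
        ((hpd 1 y hy).hasFDerivAt.mul (hcd e₂ y hy).differentiableAt.hasFDerivAt)
      have h3 := h2.fderiv
      change fderiv ℝ (fun z => p 0 z * c e₁ z + p 1 z * c e₂ z) y = _ at h3
      rw [h3]
      simp
      ring
    have hsym : fderiv ℝ (p 0) y (d 1) = fderiv ℝ (p 1) y (d 0) := by
      have h1 : HasFDerivAt (fderiv ℝ h) (fderiv ℝ (fderiv ℝ h) y) y :=
        (((hhs.contDiffAt (hVo.mem_nhds hy)).fderiv_right (m := 1)
          (by rw [one_add_one_eq_two]; exact two_le_infty)).differentiableAt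
            one_ne_zero).hasFDerivAt
      have h2 : ∀ i w, fderiv ℝ (p i) y w = fderiv ℝ (fderiv ℝ h) y w (d i) := by
        intro i w
        have := (h1.clm_apply (hasFDerivAt_const (d i) y)).fderiv
        rw [show fderiv ℝ (p i) y = _ from this]
        simp
      rw [h2, h2]
      exact (((hhs.contDiffAt (hVo.mem_nhds hy)).of_le two_le_infty).isSymmSndFDerivAt
        (by simp)).eq _ _
    have hσder : ∀ w, σ y * fderiv ℝ σ y w =
        p 0 y * fderiv ℝ (p 0) y w + p 1 y * fderiv ℝ (p 1) y w := by
      intro w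
      have h1 : HasFDerivAt (fun z => σ z ^ 2) _ y := (hσd y hy).hasFDerivAt.pow 2
      have h2 : HasFDerivAt (fun z => σ z ^ 2) _ y :=
        ((((hpd 0 y hy).hasFDerivAt.pow 2).const_add 1).add ((hpd 1 y hy).hasFDerivAt.pow 2)
          ).congr_of_eventuallyEq (Filter.Eventually.of_forall hσsq)
      have h3 := DFunLike.congr_fun (h1.unique h2) w
      simp at h3
      linarith
    have hcv : ∀ e w, fderiv ℝ (c e) y w = ⟪e, fderiv ℝ Y (Φ y) (fderiv ℝ Φ y w)⟫ := by
      intro e w; rw [(hcd e y hy).fderiv]; rfl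
    have hσc : ∀ e w, fderiv ℝ (fun y => σ y * c e y) y w =
        fderiv ℝ σ y w * c e y + σ y * fderiv ℝ (c e) y w := by
      intro e w
      have h2 := ((hσd y hy).hasFDerivAt.mul (hcd e y hy).differentiableAt.hasFDerivAt).fderiv
      change fderiv ℝ (fun y => σ y * c e y) y = _ at h2
      rw [h2]
      simp
      ring
    rw [hJ y hy, hσc, hσc, sdiv, trT, hf.trace_eq]
    set B := fderiv ℝ Y (Φ y) with hB
    have b1 : B e₁ = B (fderiv ℝ Φ y (d 0)) - p 0 y • B n := by
      rw [hΦ0 y hy]; simp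
    have b2 : B e₂ = B (fderiv ℝ Φ y (d 1)) - p 1 y • B n := by
      rw [hΦ1 y hy]; simp
    have hid := divergence_graph_identity (hσ0 y) (hσder (d 0))
      (by rw [hσder (d 1), hsym]) hkσ
      (v₃₁ := fderiv ℝ (c n) y (d 0)) (v₃₂ := fderiv ℝ (c n) y (d 1)) (c₁ := c e₁ y) (c₂ := c e₂ y)
      (v₁₁ := fderiv ℝ (c e₁) y (d 0)) (v₂₁ := fderiv ℝ (c e₂) y (d 0))
      (v₁₂ := fderiv ℝ (c e₁) y (d 1)) (v₂₂ := fderiv ℝ (c e₂) y (d 1))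
      (b₁ := ⟪e₁, B n⟫) (b₂ := ⟪e₂, B n⟫) (b₃ := ⟪n, B n⟫)
      (by rw [htd]; ring) (by rw [htd, hsym]; ring)
    rw [← hid, hm]
    simp only [map_sub, map_smul, b1, b2, inner_sub_left, inner_sub_right, real_inner_smul_left,
      real_inner_smul_right, hcv]
    have hσ2 := hσsq y
    linear_combination (σ y * k ^ 2 * (⟪n, B n⟫ - p 0 y * ⟪e₁, B n⟫ - p 1 y * ⟪e₂, B n⟫)) * hσ2
  rw [setIntegral_congr_fun hVo.measurableSet hkey, integral_add (hint e₁ 0) (hint e₂ 1), hI, hI,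
    add_zero]

/-- The divergence theorem on the closed surface `M`. -/
theorem integral_sdiv_eq_zero {X : E3 → E3} (hX : ContDiff ℝ 1 X)
    (ht : ∀ x ∈ frontier O, ⟪N x, X x⟫ = 0) : ∫ x, sdiv N X x ∂(areaMeasure O) = 0 := by
  have hloc : ∀ x₀ : E3, ∃ b : ContDiffBump x₀, x₀ ∈ frontier O →
      ∀ Y : E3 → E3, ContDiff ℝ 1 Y → (∀ x ∈ frontier O, ⟪N x, Y x⟫ = 0) →
        ∫ x, sdiv N (fun y => b y • Y y) x ∂(areaMeasure O) = 0 := by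
    intro x₀
    by_cases hx₀ : x₀ ∈ frontier O
    · obtain ⟨e₁, e₂, r, Φ, hc⟩ := hN.exists_graphChart hx₀
      have hr := hc.pos
      refine ⟨⟨r / 8, r / 4, by linarith, by linarith⟩, fun _ Y hY hYt => ?_⟩
      apply hN.integral_sdiv_eq_zero_of_chart hc
      · exact (ContDiffBump.contDiff _).smul hY
      · intro x hx
        rw [real_inner_smul_right, hYt x hx, mul_zero]
      · refine (tsupport_smul_subset_left _ _).trans ?_
        rw [ContDiffBump.tsupport_eq]
        exact Metric.closedBall_subset_ball (by simp only; linarith)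
    · exact ⟨⟨1, 2, one_pos, one_lt_two⟩, fun h => absurd h hx₀⟩
  choose b hb using hloc
  obtain ⟨t, htM, htc⟩ := hN.isCompact.elim_nhds_subcover
    (fun x => Metric.ball x (b x).rIn) (fun x _ => Metric.ball_mem_nhds x (b x).rIn_pos)
  have hprod : ∀ s : Finset E3, ContDiff ℝ 1 fun y => ∏ j ∈ s, (1 - b j y) := fun s =>
    contDiff_prod (fun j _ => contDiff_const.sub (b j).contDiff)
  have key : ∀ s : Finset E3, (∀ x ∈ s, x ∈ frontier O) →
      ∫ x, sdiv N X x ∂(areaMeasure O) =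
        ∫ x, sdiv N (fun y => (∏ j ∈ s, (1 - b j y)) • X y) x ∂(areaMeasure O) := by
    intro s
    induction s using Finset.induction_on with
    | empty => intro _; simp
    | insert j s hj ih =>
      intro hs
      rw [ih (fun x hx => hs x (Finset.mem_insert_of_mem hx))]
      set Z : E3 → E3 := fun y => (∏ j ∈ s, (1 - b j y)) • X y with hZ
      have hZs : ContDiff ℝ 1 Z := (hprod s).smul hX
      have hZt : ∀ x ∈ frontier O, ⟪N x, Z x⟫ = 0 := fun x hx => by
        rw [hZ, real_inner_smul_right, ht x hx, mul_zero]
      have h0 := hb j (hs j (Finset.mem_insert_self _ _)) Z hZs hZt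
      have h1 : ContDiff ℝ 1 fun y => b j y • Z y := (b j).contDiff.smul hZs
      have h2 : ContDiff ℝ 1 fun y => (1 - b j y) • Z y :=
        (contDiff_const.sub (b j).contDiff).smul hZs
      have h3 : ∀ x, sdiv N Z x = sdiv N (fun y => b j y • Z y) x +
          sdiv N (fun y => (1 - b j y) • Z y) x := by
        intro x
        rw [← sdiv_add (h1.differentiable one_ne_zero x) (h2.differentiable one_ne_zero x)]
        congr 1
        ext1 y
        rw [← add_smul]; simp
      have h4 : (fun y => (∏ j ∈ insert j s, (1 - b j y)) • X y) =
          fun y => (1 - b j y) • Z y := by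
        ext1 y
        rw [Finset.prod_insert hj, mul_smul]
      rw [h4, integral_congr_ae (Filter.Eventually.of_forall h3), integral_add
        (hN.integrable (hN.continuous_sdiv h1).continuousOn)
        (hN.integrable (hN.continuous_sdiv h2).continuousOn), h0, zero_add]
  rw [key t htM, hN.integral_congr (g := fun _ => 0), integral_zero]
  intro x hx
  have hz : ∀ y ∈ frontier O, (∏ j ∈ t, (1 - b j y)) • X y = (fun _ : E3 => (0 : E3)) y := by
    intro y hy
    obtain ⟨j, hj, hyj⟩ := mem_iUnion₂.1 (htc hy)
    have : 1 - b j y = 0 := by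
      rw [(b j).one_of_mem_closedBall (Metric.ball_subset_closedBall hyj), sub_self]
    rw [Finset.prod_eq_zero hj this, zero_smul]
  have hd : DifferentiableAt ℝ (fun y => (∏ j ∈ t, (1 - b j y)) • X y) x :=
    ((hprod t).smul hX).differentiable one_ne_zero x
  rw [hN.sdiv_congr hx hd (by fun_prop) hz]
  simp [sdiv, trT]

end IsNormalField

/-! ### The elliptic estimate -/

/-- Mollification: `C¹` fields are `C¹`-limits of smooth fields. -/
theorem exists_smooth_approx {V : E3 → E3} (hV : ContDiff ℝ 1 V) (hc : HasCompactSupport V)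
    {ε : ℝ} (hε : 0 < ε) :
    ∃ W : E3 → E3, ContDiff ℝ ∞ W ∧ ∀ x, dist (W x) (V x) ≤ ε ∧
      dist (fderiv ℝ W x) (fderiv ℝ V x) ≤ ε := by
  have hcont : Continuous (fderiv ℝ V) := hV.continuous_fderiv one_ne_zero
  obtain ⟨δ₁, hδ₁, h₁⟩ := Metric.uniformContinuous_iff.1
    (hc.uniformContinuous_of_continuous hV.continuous) ε hε
  obtain ⟨δ₂, hδ₂, h₂⟩ := Metric.uniformContinuous_iff.1
    ((hc.fderiv ℝ).uniformContinuous_of_continuous hcont) ε hε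
  have hδ : 0 < min δ₁ δ₂ := lt_min hδ₁ hδ₂
  let φ : ContDiffBump (0 : E3) := ⟨min δ₁ δ₂ / 2, min δ₁ δ₂, by linarith, by linarith⟩
  have hloc : LocallyIntegrable (φ.normed volume) (volume : Measure E3) :=
    φ.continuous_normed.locallyIntegrable
  have hder : ∀ x, fderiv ℝ (convolution (φ.normed volume) V (ContinuousLinearMap.lsmul ℝ ℝ)
      volume) x = convolution (φ.normed volume) (fderiv ℝ V) (ContinuousLinearMap.lsmul ℝ ℝ)
      volume x := by
    intro x
    rw [(hc.hasFDerivAt_convolution_right (ContinuousLinearMap.lsmul ℝ ℝ) hloc hV x).fderiv]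
    rfl
  refine ⟨convolution (φ.normed volume) V (ContinuousLinearMap.lsmul ℝ ℝ) volume,
    φ.hasCompactSupport_normed.contDiff_convolution_left _ φ.contDiff_normed
      hV.continuous.locallyIntegrable, fun x => ⟨?_, ?_⟩⟩
  · apply ContDiffBump.dist_normed_convolution_le hV.continuous.aestronglyMeasurable
    intro y hy
    exact (h₁ (lt_of_lt_of_le hy (min_le_left _ _))).le
  · rw [hder]
    apply ContDiffBump.dist_normed_convolution_le hcont.aestronglyMeasurable
    intro y hy
    exact (h₂ (lt_of_lt_of_le hy (min_le_right _ _))).le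

/-- The derivative at `x` of the tangential part of a field with value `w` and derivative `A`
at `x`. -/
def projDeriv (N : E3 → E3) (x w : E3) (A : E3 →L[ℝ] E3) : E3 →L[ℝ] E3 :=
  projT (N x) ∘L A -
    ((innerSL ℝ w ∘L fderiv ℝ N x).smulRight (N x) + ⟪N x, w⟫ • fderiv ℝ N x)

namespace IsNormalField

variable {O : Set E3} {N : E3 → E3} (hN : IsNormalField O N)
include hN

theorem fderiv_projT {W : E3 → E3} {x : E3} (hW : DifferentiableAt ℝ W x) :
    fderiv ℝ (fun y => projT (N y) (W y)) x = projDeriv N x (W x) (fderiv ℝ W x) := by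
  have hd := (hN.differentiableAt x).hasFDerivAt
  have h1 := (hd.inner ℝ hW.hasFDerivAt).smul hd
  have h2 : HasFDerivAt (fun y => projT (N y) (W y)) _ x := hW.hasFDerivAt.sub h1
  rw [h2.fderiv]
  ext1 v
  simp only [projDeriv, sub_apply, add_apply, smul_apply, ContinuousLinearMap.smulRight_apply,
    ContinuousLinearMap.comp_apply, projT_apply, ContinuousLinearMap.prod_apply,
    fderivInnerCLM_apply, innerSL_apply_apply]
  rw [real_inner_comm (W x) (fderiv ℝ N x v), add_smul]
  abel

theorem continuous_fderiv_normal : Continuous (fderiv ℝ N) :=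
  hN.smooth.continuous_fderiv (by simp)

theorem continuous_projT : Continuous fun x => projT (N x) :=
  contDiff_projT.continuous.comp hN.smooth.continuous

theorem gaussCurvature_eq_trT {x : E3} (hx : x ∈ frontier O) :
    gaussCurvature O x = (sdiv N N x ^ 2 -
      trT (N x) (fderiv ℝ N x ∘L projT (N x) ∘L fderiv ℝ N x)) / 2 := by
  obtain ⟨e₁, e₂, h⟩ := hN.exists_frame hx
  have p : ∀ w, projT (N x) w = ⟪e₁, w⟫ • e₁ + ⟪e₂, w⟫ • e₂ := by
    intro w
    have := h.expand_tangent (inner_projT h.nn w)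
    rwa [inner_projT_of_inner h.e1n, inner_projT_of_inner h.e2n] at this
  rw [hN.gaussCurvature_eq hx h, sdiv, h.trT_eq, h.trT_eq]
  simp only [ContinuousLinearMap.comp_apply, p, map_add, map_smul, inner_add_right,
    real_inner_smul_right]
  ring

theorem continuous_trT {Z : Type*} [TopologicalSpace Z] {g : Z → E3} {A : Z → E3 →L[ℝ] E3}
    (hg : Continuous g) (hA : Continuous A) : Continuous fun z => trT (N (g z)) (A z) := by
  have h1 : Continuous fun z => N (g z) := hN.smooth.continuous.comp hg
  exact (traceL.continuous.comp hA).sub (h1.inner (hA.clm_apply h1))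

theorem continuousOn_gaussCurvature : ContinuousOn (gaussCurvature O) (frontier O) := by
  have h : Continuous fun x => (sdiv N N x ^ 2 -
      trT (N x) (fderiv ℝ N x ∘L projT (N x) ∘L fderiv ℝ N x)) / 2 :=
    (((hN.continuous_sdiv (hN.smooth.of_le (by simp))).pow 2).sub (hN.continuous_trT continuous_id
      (hN.continuous_fderiv_normal.clm_comp (hN.continuous_projT.clm_comp
        hN.continuous_fderiv_normal)))).div_const 2
  exact h.continuousOn.congr (fun x hx => hN.gaussCurvature_eq_trT hx)

theorem contDiff_sdiv {z : E3 → E3} (hz : ContDiff ℝ 2 z) : ContDiff ℝ 1 (sdiv N z) := by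
  have h1 : ContDiff ℝ 1 (fderiv ℝ z) := hz.fderiv_right (by norm_num)
  have h2 : ContDiff ℝ 1 N := hN.smooth.of_le (by simp)
  exact (traceL.contDiff.comp h1).sub (h2.inner ℝ (h1.clm_apply h2))

theorem contDiff_bochnerField {z v : E3 → E3} (hz : ContDiff ℝ 2 z) (hv : ContDiff ℝ 1 v) :
    ContDiff ℝ 1 (bochnerField N z v) := by
  have h1 : ContDiff ℝ 1 (fderiv ℝ z) := hz.fderiv_right (by norm_num)
  have h2 : ContDiff ℝ 1 N := hN.smooth.of_le (by simp)
  have h3 : ContDiff ℝ 1 (fderiv ℝ N) := hN.smooth.fderiv_right (by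
    rw [one_add_one_eq_two]; exact two_le_infty)
  have h4 : ContDiff ℝ 1 z := hz.of_le (by norm_num)
  exact ((h1.clm_apply hv).add ((h4.inner ℝ (h3.clm_apply hv)).smul h2)).sub
    ((hN.contDiff_sdiv hz).smul hv)

/-- The polarized Bochner identity, integrated over `M`. -/
theorem integral_bochner_polarized {z v : E3 → E3} (hz : ContDiff ℝ 2 z) (hv : ContDiff ℝ 1 v)
    (htz : ∀ y ∈ frontier O, ⟪N y, z y⟫ = 0) (htv : ∀ y ∈ frontier O, ⟪N y, v y⟫ = 0) :
    ∫ x, (trT (N x) (fderiv ℝ z x ∘L projT (N x) ∘L fderiv ℝ v x) - sdiv N z x * sdiv N v x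
        + gaussCurvature O x * ⟪z x, v x⟫) ∂(areaMeasure O) = 0 := by
  rw [← hN.integral_sdiv_eq_zero (hN.contDiff_bochnerField hz hv)]
  · exact hN.integral_congr (fun x hx => (hN.sdiv_bochnerField hx hz hv htz htv).symm)
  · intro x hx
    have h1 := hN.inner_fderiv_tangent hx (hz.differentiable (by norm_num) x) htz (htv x hx)
    simp only [bochnerField, inner_sub_right, inner_add_right, real_inner_smul_right, h1,
      htv x hx, hN.inner_self hx]
    rw [real_inner_comm (z x)]
    ring

/-- The integrated Bochner identity for a tangent field of class `C¹`; the field is replaced in one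
of its two slots by smooth approximations. -/
theorem integral_bochner {X : E3 → E3} (hX : ContDiff ℝ 1 X) (hc : HasCompactSupport X)
    (ht : ∀ x ∈ frontier O, ⟪N x, X x⟫ = 0) :
    ∫ x, (trT (N x) (fderiv ℝ X x ∘L projT (N x) ∘L fderiv ℝ X x) - sdiv N X x ^ 2
        + gaussCurvature O x * ‖X x‖ ^ 2) ∂(areaMeasure O) = 0 := by
  have hfin := hN.isFiniteMeasure
  choose W hWs hW using fun n : ℕ => exists_smooth_approx hX hc (Nat.one_div_pos_of_nat (n := n)
    (α := ℝ))
  let K : E3 → ℝ := fun x => (sdiv N N x ^ 2 -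
      trT (N x) (fderiv ℝ N x ∘L projT (N x) ∘L fderiv ℝ N x)) / 2
  have hK : Continuous K :=
    (((hN.continuous_sdiv (hN.smooth.of_le (by simp))).pow 2).sub (hN.continuous_trT continuous_id
      (hN.continuous_fderiv_normal.clm_comp (hN.continuous_projT.clm_comp
        hN.continuous_fderiv_normal)))).div_const 2
  have hDX : Continuous (fderiv ℝ X) := hX.continuous_fderiv one_ne_zero
  let G : E3 × E3 × (E3 →L[ℝ] E3) → ℝ := fun a =>
    trT (N a.1) (projDeriv N a.1 a.2.1 a.2.2 ∘L projT (N a.1) ∘L fderiv ℝ X a.1) -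
      trT (N a.1) (projDeriv N a.1 a.2.1 a.2.2) * sdiv N X a.1 +
      K a.1 * ⟪projT (N a.1) a.2.1, X a.1⟫
  have c1 : Continuous fun a : E3 × E3 × (E3 →L[ℝ] E3) => N a.1 :=
    hN.smooth.continuous.comp continuous_fst
  have c2 : Continuous fun a : E3 × E3 × (E3 →L[ℝ] E3) => fderiv ℝ N a.1 :=
    hN.continuous_fderiv_normal.comp continuous_fst
  have c3 : Continuous fun a : E3 × E3 × (E3 →L[ℝ] E3) => projT (N a.1) :=
    hN.continuous_projT.comp continuous_fst
  have c4 : Continuous fun a : E3 × E3 × (E3 →L[ℝ] E3) => fderiv ℝ X a.1 :=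
    hDX.comp continuous_fst
  have c5 : Continuous fun a : E3 × E3 × (E3 →L[ℝ] E3) => projDeriv N a.1 a.2.1 a.2.2 := by
    have s1 : Continuous fun a : E3 × E3 × (E3 →L[ℝ] E3) => innerSL ℝ a.2.1 :=
      (innerSL ℝ (E := E3)).continuous.comp (by fun_prop)
    have s2 : Continuous fun a : E3 × E3 × (E3 →L[ℝ] E3) =>
        (innerSL ℝ a.2.1 ∘L fderiv ℝ N a.1).smulRight (N a.1) :=
      ((ContinuousLinearMap.smulRightL ℝ E3 E3).continuous.comp (s1.clm_comp c2)).clm_apply c1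
    have s3 : Continuous fun a : E3 × E3 × (E3 →L[ℝ] E3) => a.2.1 := by fun_prop
    have s4 : Continuous fun a : E3 × E3 × (E3 →L[ℝ] E3) => a.2.2 := by fun_prop
    have s5 : Continuous fun a : E3 × E3 × (E3 →L[ℝ] E3) => ⟪N a.1, a.2.1⟫ := c1.inner s3
    exact (c3.clm_comp s4).sub (s2.add (s5.smul c2))
  have hG : Continuous G := by
    refine ((hN.continuous_trT continuous_fst (c5.clm_comp (c3.clm_comp c4))).sub
      ((hN.continuous_trT continuous_fst c5).mul
        ((hN.continuous_sdiv hX).comp continuous_fst))).add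
      ((hK.comp continuous_fst).mul ((c3.clm_apply (by fun_prop)).inner
        (hX.continuous.comp continuous_fst)))
  have hpd : ∀ n x, fderiv ℝ (fun y => projT (N y) (W n y)) x =
      projDeriv N x (W n x) (fderiv ℝ (W n) x) := fun n x =>
    hN.fderiv_projT ((hWs n).differentiable (by simp) x)
  have hzero : ∀ n, ∫ x, G (x, W n x, fderiv ℝ (W n) x) ∂(areaMeasure O) = 0 := by
    intro n
    have hz : ContDiff ℝ 2 fun y => projT (N y) (W n y) :=
      ((contDiff_projT.comp hN.smooth).clm_apply (hWs n)).of_le two_le_infty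
    rw [← hN.integral_bochner_polarized hz hX
      (fun y hy => inner_projT (hN.inner_self hy) _) ht]
    apply hN.integral_congr
    intro x hx
    simp only [G, K, sdiv, hpd, hN.gaussCurvature_eq_trT hx]
  have hlim : Filter.Tendsto (fun n => ∫ x, G (x, W n x, fderiv ℝ (W n) x) ∂(areaMeasure O))
      Filter.atTop (nhds (∫ x, G (x, X x, fderiv ℝ X x) ∂(areaMeasure O))) := by
    obtain ⟨c, hc1⟩ := hX.continuous.bounded_above_of_compact_support hc
    obtain ⟨d, hd1⟩ := hDX.bounded_above_of_compact_support (hc.fderiv ℝ)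
    have hcomp : IsCompact (frontier O ×ˢ (Metric.closedBall (0 : E3) (c + 1) ×ˢ
        Metric.closedBall (0 : E3 →L[ℝ] E3) (d + 1))) :=
      hN.isCompact.prod ((isCompact_closedBall _ _).prod (isCompact_closedBall _ _))
    obtain ⟨B, hB⟩ := hcomp.exists_bound_of_continuousOn hG.continuousOn
    have hle : ∀ n : ℕ, (1 : ℝ) / (n + 1) ≤ 1 := fun n => by
      rw [div_le_one (by positivity)]; linarith [(Nat.cast_nonneg n : (0 : ℝ) ≤ n)]
    apply tendsto_integral_of_dominated_convergence (fun _ => B)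
    · intro n
      exact (hG.comp (continuous_id.prodMk ((hWs n).continuous.prodMk
        ((hWs n).continuous_fderiv (by simp))))).aestronglyMeasurable
    · exact integrable_const B
    · intro n
      filter_upwards [hN.ae_mem] with x hx
      apply hB
      refine ⟨hx, ?_, ?_⟩
      · rw [mem_closedBall_zero_iff]
        have h1 := (hW n x).1
        rw [dist_eq_norm] at h1
        calc ‖W n x‖ = ‖X x + (W n x - X x)‖ := by congr 1; abel
          _ ≤ _ := (norm_add_le _ _).trans (add_le_add (hc1 x) (h1.trans (hle n)))
      · rw [mem_closedBall_zero_iff]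
        have h1 := (hW n x).2
        rw [dist_eq_norm] at h1
        calc ‖fderiv ℝ (W n) x‖ = ‖fderiv ℝ X x + (fderiv ℝ (W n) x - fderiv ℝ X x)‖ := by
              congr 1; abel
          _ ≤ _ := (norm_add_le _ _).trans (add_le_add (hd1 x) (h1.trans (hle n)))
    · refine Filter.Eventually.of_forall fun x => ?_
      have t0 := tendsto_one_div_add_atTop_nhds_zero_nat (𝕜 := ℝ)
      have t1 : Filter.Tendsto (fun n => W n x) Filter.atTop (nhds (X x)) :=
        tendsto_iff_dist_tendsto_zero.2 (squeeze_zero (fun _ => dist_nonneg)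
          (fun n => (hW n x).1) t0)
      have t2 : Filter.Tendsto (fun n => fderiv ℝ (W n) x) Filter.atTop (nhds (fderiv ℝ X x)) :=
        tendsto_iff_dist_tendsto_zero.2 (squeeze_zero (fun _ => dist_nonneg)
          (fun n => (hW n x).2) t0)
      exact (hG.tendsto _).comp (tendsto_const_nhds.prodMk_nhds (t1.prodMk_nhds t2))
  simp only [hzero] at hlim
  rw [← tendsto_nhds_unique hlim tendsto_const_nhds]
  apply hN.integral_congr
  intro x hx
  obtain ⟨e₁, e₂, h⟩ := hN.exists_frame hx
  have hXd : DifferentiableAt ℝ X x := hX.differentiable one_ne_zero x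
  have hPd : DifferentiableAt ℝ (fun y => projT (N y) (X y)) x :=
    ((contDiff_projT.comp hN.smooth).differentiable (by simp) x).clm_apply hXd
  have hPX : ∀ y ∈ frontier O, projT (N y) (X y) = X y := fun y hy => projT_of_inner (ht y hy)
  have hP : ∀ w, ⟪N x, w⟫ = 0 → projDeriv N x (X x) (fderiv ℝ X x) w = fderiv ℝ X x w := by
    intro w hw
    rw [← hN.fderiv_projT hXd]
    exact hN.fderiv_congr hx hPd hXd hPX hw
  have htr : ∀ w, ⟪N x, projT (N x) w⟫ = 0 := fun w => inner_projT (hN.inner_self hx) w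
  simp only [G, K, sdiv, h.trT_eq, hN.gaussCurvature_eq_trT hx, ContinuousLinearMap.comp_apply,
    hP _ (htr _), hP _ h.n1, hP _ h.n2, hPX x hx, real_inner_self_eq_norm_sq]
  ring

theorem integrable_of_continuous {F : Type*} [NormedAddCommGroup F] {f : E3 → F}
    (hf : Continuous f) : Integrable f (areaMeasure O) := hN.integrable hf.continuousOn

theorem contDiff_cross {X : E3 → E3} {k : WithTop ℕ∞} (hX : ContDiff ℝ k X) (hk : k ≤ ∞) :
    ContDiff ℝ k fun y => crossL (N y) (X y) :=
  (crossL.contDiff.comp (hN.smooth.of_le hk)).clm_apply hX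

theorem continuous_srot {X : E3 → E3} (hX : ContDiff ℝ 1 X) : Continuous (srot N X) :=
  (hN.continuous_sdiv (hN.contDiff_cross hX (by simp))).neg

theorem h1Norm_sq {X₀ X : E3 → E3} (hX : ContDiff ℝ 1 X) (heq : ∀ y ∈ frontier O, X y = X₀ y)
    (ht : ∀ x ∈ frontier O, ⟪N x, X x⟫ = 0) :
    h1Norm O X₀ ^ 2 = ∫ x, (‖X x‖ ^ 2 +
      (trT (N x) (fderiv ℝ X x ∘L projT (N x) ∘L fderiv ℝ X x) + srot N X x ^ 2))
        ∂(areaMeasure O) := by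
  have h1 : ∀ x ∈ frontier O, ‖X₀ x‖ ^ 2 + LinearMap.trace ℝ (tangentPlane O x)
      (ContinuousLinearMap.adjoint (covDeriv O X₀ x) ∘L covDeriv O X₀ x :
        tangentPlane O x →L[ℝ] tangentPlane O x) = ‖X x‖ ^ 2 +
      (trT (N x) (fderiv ℝ X x ∘L projT (N x) ∘L fderiv ℝ X x) + srot N X x ^ 2) := by
    intro x hx
    rw [hN.trace_adjoint_covDeriv_eq_trT hx (hX.differentiable one_ne_zero x) heq (ht x hx),
      heq x hx]
  rw [h1Norm, Real.sq_sqrt, hN.integral_congr h1]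
  rw [hN.integral_congr h1]
  apply integral_nonneg_of_ae
  filter_upwards [hN.ae_mem] with x hx
  have h2 := hN.srot_sq_le hx (hX.differentiable one_ne_zero x) heq (ht x hx)
  rw [hN.trace_adjoint_covDeriv_eq_trT hx (hX.differentiable one_ne_zero x) heq (ht x hx)] at h2
  simp only [Pi.zero_apply]
  nlinarith [sq_nonneg ‖X x‖, sq_nonneg (srot N X x)]

/-- The vorticity is controlled by the `H¹` norm. -/
theorem integral_srot_sq_le {X₀ X : E3 → E3} (hX : ContDiff ℝ 1 X)
    (heq : ∀ y ∈ frontier O, X y = X₀ y) (ht : ∀ x ∈ frontier O, ⟪N x, X x⟫ = 0) :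
    ∫ x, srot N X x ^ 2 ∂(areaMeasure O) ≤ 2 * h1Norm O X₀ ^ 2 := by
  have hDX : Continuous (fderiv ℝ X) := hX.continuous_fderiv one_ne_zero
  have ct : Continuous fun x => trT (N x) (fderiv ℝ X x ∘L projT (N x) ∘L fderiv ℝ X x) :=
    hN.continuous_trT continuous_id (hDX.clm_comp (hN.continuous_projT.clm_comp hDX))
  rw [hN.h1Norm_sq hX heq ht, ← integral_const_mul]
  apply integral_mono_ae
  · exact hN.integrable_of_continuous ((hN.continuous_srot hX).pow 2)
  · exact hN.integrable_of_continuous (((hX.continuous.norm.pow 2).add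
      (ct.add ((hN.continuous_srot hX).pow 2))).const_mul 2)
  · filter_upwards [hN.ae_mem] with x hx
    have h2 := hN.srot_sq_le hx (hX.differentiable one_ne_zero x) heq (ht x hx)
    rw [hN.trace_adjoint_covDeriv_eq_trT hx (hX.differentiable one_ne_zero x) heq (ht x hx)] at h2
    nlinarith [sq_nonneg ‖X x‖]

/-- On a surface of positive curvature the `H¹` norm of a divergence-free field is controlled by its
vorticity. -/
theorem exists_h1Norm_sq_le (hpos : ∀ x ∈ frontier O, 0 < gaussCurvature O x) :
    ∃ C > 0, ∀ X₀ X : E3 → E3, ContDiff ℝ 1 X → HasCompactSupport X →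
      (∀ y ∈ frontier O, X y = X₀ y) → (∀ x ∈ frontier O, ⟪N x, X x⟫ = 0) →
      (∀ x ∈ frontier O, sdiv N X x = 0) →
        h1Norm O X₀ ^ 2 ≤ C * ∫ x, srot N X x ^ 2 ∂(areaMeasure O) := by
  obtain ⟨k, hk, hkK⟩ : ∃ k > 0, ∀ x ∈ frontier O, k ≤ gaussCurvature O x := by
    rcases (frontier O).eq_empty_or_nonempty with he | hne
    · exact ⟨1, one_pos, by simp [he]⟩
    · obtain ⟨x₀, hx₀, hmin⟩ := hN.isCompact.exists_isMinOn hne hN.continuousOn_gaussCurvature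
      exact ⟨_, hpos x₀ hx₀, fun x hx => hmin hx⟩
  refine ⟨1 + 1 / k, by positivity, fun X₀ X hX hc heq ht hdiv => ?_⟩
  have hb := hN.integral_bochner hX hc ht
  have hDX : Continuous (fderiv ℝ X) := hX.continuous_fderiv one_ne_zero
  have ct : Continuous fun x => trT (N x) (fderiv ℝ X x ∘L projT (N x) ∘L fderiv ℝ X x) :=
    hN.continuous_trT continuous_id (hDX.clm_comp (hN.continuous_projT.clm_comp hDX))
  have cr := hN.continuous_srot hX
  have i1 : Integrable (fun x => trT (N x) (fderiv ℝ X x ∘L projT (N x) ∘L fderiv ℝ X x) -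
      sdiv N X x ^ 2 + gaussCurvature O x * ‖X x‖ ^ 2) (areaMeasure O) :=
    hN.integrable (((ct.sub ((hN.continuous_sdiv hX).pow 2)).continuousOn).add
      (hN.continuousOn_gaussCurvature.mul (hX.continuous.norm.pow 2).continuousOn))
  have i2 : Integrable (fun x => srot N X x ^ 2) (areaMeasure O) :=
    hN.integrable_of_continuous (cr.pow 2)
  rw [hN.h1Norm_sq hX heq ht, ← integral_const_mul]
  have hsum : ∫ x, (1 + 1 / k) * srot N X x ^ 2 ∂(areaMeasure O) =
      ∫ x, ((1 + 1 / k) * srot N X x ^ 2 + (1 + 1 / k) *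
        (trT (N x) (fderiv ℝ X x ∘L projT (N x) ∘L fderiv ℝ X x) -
      sdiv N X x ^ 2 + gaussCurvature O x * ‖X x‖ ^ 2)) ∂(areaMeasure O) := by
    rw [integral_add (i2.const_mul _) (i1.const_mul _), integral_const_mul (1 + 1 / k) (fun x =>
      trT (N x) (fderiv ℝ X x ∘L projT (N x) ∘L fderiv ℝ X x) -
      sdiv N X x ^ 2 + gaussCurvature O x * ‖X x‖ ^ 2), hb, mul_zero, add_zero]
  rw [hsum]
  apply integral_mono_ae
  · exact hN.integrable_of_continuous ((hX.continuous.norm.pow 2).add (ct.add (cr.pow 2)))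
  · exact (i2.const_mul _).add (i1.const_mul _)
  · filter_upwards [hN.ae_mem] with x hx
    have h2 := hN.srot_sq_le hx (hX.differentiable one_ne_zero x) heq (ht x hx)
    rw [hN.trace_adjoint_covDeriv_eq_trT hx (hX.differentiable one_ne_zero x) heq (ht x hx)] at h2
    rw [hdiv x hx]
    have h3 := hkK x hx
    have h4 : 0 ≤ trT (N x) (fderiv ℝ X x ∘L projT (N x) ∘L fderiv ℝ X x) + srot N X x ^ 2 := by
      nlinarith [sq_nonneg (srot N X x)]
    have h5 : ‖X x‖ ^ 2 ≤ 1 / k * (gaussCurvature O x * ‖X x‖ ^ 2) := by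
      rw [one_div, ← mul_assoc]
      have : 1 ≤ k⁻¹ * gaussCurvature O x := by
        rw [← div_eq_inv_mul, one_le_div hk]; exact h3
      nlinarith [sq_nonneg ‖X x‖]
    have h6 : 0 ≤ 1 / k := by positivity
    have h7 : 0 ≤ gaussCurvature O x * ‖X x‖ ^ 2 := by
      have := hpos x hx; positivity
    nlinarith [mul_nonneg h6 h4]

end IsNormalField

/-! ### Convex duality for bi-Lipschitz functions of one variable -/

theorem nonneg_of_deriv_mul_sub_nonneg {g g' : ℝ → ℝ} {w : ℝ} (hg : ∀ x, HasDerivAt g (g' x) x)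
    (h0 : g w = 0) (h : ∀ x, 0 ≤ g' x * (x - w)) (z : ℝ) : 0 ≤ g z := by
  have hc : Continuous g := continuous_iff_continuousAt.2 fun x => (hg x).continuousAt
  rcases lt_trichotomy w z with hz | hz | hz
  · obtain ⟨c, hc1, hc2⟩ := exists_hasDerivAt_eq_slope g g' hz hc.continuousOn
      (fun x _ => hg x)
    have h1 := h c
    have h2 : 0 < c - w := sub_pos.2 hc1.1
    have h3 : 0 ≤ g' c := nonneg_of_mul_nonneg_left h1 h2
    rw [hc2, h0, sub_zero] at h3
    by_contra hlt
    exact absurd h3 (not_le.2 (div_neg_of_neg_of_pos (not_le.1 hlt) (sub_pos.2 hz)))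
  · rw [← hz, h0]
  · obtain ⟨c, hc1, hc2⟩ := exists_hasDerivAt_eq_slope g g' hz hc.continuousOn
      (fun x _ => hg x)
    have h1 := h c
    have h2 : c - w < 0 := sub_neg.2 hc1.2
    have h3 : g' c ≤ 0 := by
      by_contra hlt
      nlinarith [mul_neg_of_pos_of_neg (not_le.1 hlt) h2]
    rw [hc2, h0, zero_sub] at h3
    by_contra hlt
    have h4 : 0 < -g z := by linarith
    exact absurd h3 (not_le.2 (div_pos h4 (sub_pos.2 hz)))

/-- A bi-Lipschitz increasing function on an interval has a uniformly convex potential of its inverse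
with quadratic upper and lower bounds. -/
theorem exists_potential_of_increasing {q : ℝ → ℝ} {a b c C : ℝ} (hab : a ≤ b) (hc : 0 < c)
    (hcC : c ≤ C) (h : ∀ s ∈ Icc a b, ∀ t ∈ Icc a b, s ≤ t →
      c * (t - s) ≤ q t - q s ∧ q t - q s ≤ C * (t - s)) :
    ∃ Φ ψ : ℝ → ℝ, Continuous ψ ∧ (∀ z, HasDerivAt Φ (ψ z) z) ∧ ∀ s ∈ Icc a b, ∀ z,
      (2 * C)⁻¹ * (z - q s) ^ 2 ≤ Φ z - Φ (q s) - s * (z - q s) ∧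
        Φ z - Φ (q s) - s * (z - q s) ≤ (2 * c)⁻¹ * (z - q s) ^ 2 := by
  have hC : 0 < C := lt_of_lt_of_le hc hcC
  let p : ℝ → ℝ := fun x => max a (min b x)
  have hp : ∀ x, p x ∈ Icc a b := fun x =>
    ⟨le_max_left _ _, max_le hab (min_le_left _ _)⟩
  have hpm : ∀ x y, x ≤ y → p x ≤ p y := fun x y hxy =>
    max_le_max le_rfl (min_le_min le_rfl hxy)
  have hpl : ∀ x y, x ≤ y → p y - p x ≤ y - x := by
    intro x y hxy
    simp only [p]
    rcases max_cases a (min b x) with h1 | h1 <;> rcases max_cases a (min b y) with h2 | h2 <;>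
      rcases min_cases b x with h3 | h3 <;> rcases min_cases b y with h4 | h4 <;> linarith
  have hps : ∀ s ∈ Icc a b, p s = s := fun s hs => by
    simp only [p]; rw [min_eq_right hs.2, max_eq_right hs.1]
  -- `q` is extended affinely with slope `c`, so that its inverse is defined on all of `ℝ`
  let Q : ℝ → ℝ := fun x => q (p x) + c * (x - p x)
  have hQ : ∀ x y, x ≤ y → c * (y - x) ≤ Q y - Q x ∧ Q y - Q x ≤ C * (y - x) := by
    intro x y hxy
    obtain ⟨h1, h2⟩ := h (p x) (hp x) (p y) (hp y) (hpm x y hxy)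
    have h3 := hpl x y hxy
    have h4 : 0 ≤ (C - c) * ((y - x) - (p y - p x)) :=
      mul_nonneg (by linarith) (by linarith)
    simp only [Q]
    constructor <;> nlinarith
  have hQc : Continuous Q := by
    have : LipschitzWith C.toNNReal Q := by
      apply LipschitzWith.of_dist_le_mul
      intro x y
      rw [Real.dist_eq, Real.dist_eq, Real.coe_toNNReal _ hC.le]
      rcases le_total x y with hxy | hxy
      · obtain ⟨h1, h2⟩ := hQ x y hxy
        rw [abs_sub_comm, abs_sub_comm x, abs_of_nonneg (sub_nonneg.2 hxy), abs_of_nonneg]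
        · exact h2
        · exact (mul_nonneg hc.le (sub_nonneg.2 hxy)).trans h1
      · obtain ⟨h1, h2⟩ := hQ y x hxy
        rw [abs_of_nonneg (sub_nonneg.2 hxy), abs_of_nonneg]
        · exact h2
        · exact (mul_nonneg hc.le (sub_nonneg.2 hxy)).trans h1
    exact this.continuous
  have hQs : Function.Surjective Q := by
    apply hQc.surjective
    · apply Filter.tendsto_atTop_mono' _ (f₁ := fun x => Q 0 + c * x)
      · filter_upwards [Filter.eventually_ge_atTop (0 : ℝ)] with x hx
        have := (hQ 0 x hx).1
        linarith
      · exact Filter.tendsto_atTop_add_const_left _ _ (Filter.tendsto_id.const_mul_atTop hc)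
    · refine Filter.tendsto_atBot_mono' _ (?_ : Q ≤ᶠ[Filter.atBot] fun x => Q 0 + c * x) ?_
      · filter_upwards [Filter.eventually_le_atBot (0 : ℝ)] with x hx
        have := (hQ x 0 hx).1
        linarith
      · exact Filter.tendsto_atBot_add_const_left _ _ (Filter.tendsto_id.const_mul_atBot hc)
  -- the inverse of the extension is the derivative of the potential
  obtain ⟨ψ, hψ⟩ := hQs.hasRightInverse
  have hψm : ∀ x y, x ≤ y → (y - x) ≤ C * (ψ y - ψ x) ∧ c * (ψ y - ψ x) ≤ y - x := by
    intro x y hxy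
    rcases le_total (ψ x) (ψ y) with h1 | h1
    · have h2 := hQ _ _ h1
      rw [hψ, hψ] at h2
      exact ⟨h2.2, h2.1⟩
    · have h2 := hQ _ _ h1
      rw [hψ, hψ] at h2
      have h3 : ψ x = ψ y := by nlinarith
      rw [h3] at h2 ⊢
      constructor <;> linarith
  have hψc : Continuous ψ := by
    have : LipschitzWith c⁻¹.toNNReal ψ := by
      apply LipschitzWith.of_dist_le_mul
      intro x y
      rw [Real.dist_eq, Real.dist_eq, Real.coe_toNNReal _ (by positivity), ← div_eq_inv_mul,
        le_div_iff₀ hc]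
      rcases le_total x y with hxy | hxy
      · obtain ⟨h1, h2⟩ := hψm x y hxy
        rw [abs_sub_comm, abs_sub_comm x, abs_of_nonneg (sub_nonneg.2 hxy), abs_of_nonneg]
        · linarith
        · exact nonneg_of_mul_nonneg_right ((sub_nonneg.2 hxy).trans h1) hC
      · obtain ⟨h1, h2⟩ := hψm y x hxy
        rw [abs_of_nonneg (sub_nonneg.2 hxy), abs_of_nonneg]
        · linarith
        · exact nonneg_of_mul_nonneg_right ((sub_nonneg.2 hxy).trans h1) hC
    exact this.continuous
  let Φ : ℝ → ℝ := fun z => ∫ r in (0 : ℝ)..z, ψ r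
  have hΦ : ∀ z, HasDerivAt Φ (ψ z) z := fun z => (hψc.integral_hasStrictDerivAt 0 z).hasDerivAt
  refine ⟨Φ, ψ, hψc, hΦ, fun s hs z => ?_⟩
  have hQq : Q s = q s := by simp only [Q]; rw [hps s hs]; ring
  have hψq : ψ (q s) = s := by
    have h1 := hψ (q s)
    rw [← hQq] at h1 ⊢
    rcases le_total (ψ (Q s)) s with h2 | h2
    · have h3 := (hQ _ _ h2).1
      rw [h1] at h3
      nlinarith
    · have h3 := (hQ _ _ h2).1
      rw [h1] at h3
      nlinarith
  generalize q s = w at hψq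
  have hd : ∀ k x : ℝ, HasDerivAt (fun z => k * (z - w) ^ 2) (k * (2 * (x - w))) x := by
    intro k x
    have := (((hasDerivAt_id x).sub_const w).pow 2).const_mul k
    simpa using this
  have hd2 : ∀ x, HasDerivAt (fun z => Φ z - Φ w - s * (z - w)) (ψ x - s) x := by
    intro x
    have := ((hΦ x).sub_const (Φ w)).sub (((hasDerivAt_id x).sub_const w).const_mul s)
    exact this.congr_deriv (by simp)
  constructor
  · have := nonneg_of_deriv_mul_sub_nonneg (fun x => (hd2 x).sub (hd (2 * C)⁻¹ x)) (w := w)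
      (by simp) (fun x => ?_) z
    · simpa using this
    · have e : (2 * C)⁻¹ * (2 * (x - w)) = (x - w) / C := by field_simp
      rw [e]
      rcases le_total w x with hx | hx
      · have h1 := (hψm w x hx).1
        rw [hψq] at h1
        apply mul_nonneg _ (sub_nonneg.2 hx)
        rw [sub_nonneg, div_le_iff₀ hC]; linarith
      · have h1 := (hψm x w hx).1
        rw [hψq] at h1
        apply mul_nonneg_of_nonpos_of_nonpos _ (sub_nonpos.2 hx)
        rw [sub_nonpos, le_div_iff₀ hC]; linarith
  · have := nonneg_of_deriv_mul_sub_nonneg (fun x => (hd (2 * c)⁻¹ x).sub (hd2 x)) (w := w)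
      (by simp) (fun x => ?_) z
    · simpa using this
    · have e : (2 * c)⁻¹ * (2 * (x - w)) = (x - w) / c := by field_simp
      rw [e]
      rcases le_total w x with hx | hx
      · have h1 := (hψm w x hx).2
        rw [hψq] at h1
        apply mul_nonneg _ (sub_nonneg.2 hx)
        rw [sub_nonneg, le_div_iff₀ hc]; linarith
      · have h1 := (hψm x w hx).2
        rw [hψq] at h1
        apply mul_nonneg_of_nonpos_of_nonpos _ (sub_nonpos.2 hx)
        rw [sub_nonpos, div_le_iff₀ hc]; linarith

/-- A derivative on an interval that is at least `c` everywhere and at most `C` off a finite set is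
at most `C` everywhere, by Darboux's theorem. -/
theorem derivative_le_of_finite {q q' : ℝ → ℝ} {a b C : ℝ} (hab : a < b)
    (hq : ∀ s ∈ Icc a b, HasDerivWithinAt q (q' s) (Icc a b) s) {B : Set ℝ} (hB : B.Finite)
    (h : ∀ s ∈ Icc a b, s ∉ B → q' s ≤ C) : ∀ s ∈ Icc a b, q' s ≤ C := by
  intro s hs
  by_contra hlt
  rw [not_le] at hlt
  obtain ⟨t, ht, htB⟩ : ∃ t ∈ Icc a b, t ∉ B := by
    by_contra hcon
    push Not at hcon
    exact Icc_infinite hab (hB.subset hcon)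
  have himg := ordConnected_Icc.image_hasDerivWithinAt hq
  have hsub : Ioo C (q' s) ⊆ q' '' B := by
    intro r hr
    obtain ⟨x, hx, rfl⟩ := himg.out (mem_image_of_mem q' ht) (mem_image_of_mem q' hs)
      ⟨(h t ht htB).trans hr.1.le, hr.2.le⟩
    refine ⟨x, ?_, rfl⟩
    by_contra hxB
    exact absurd (h x hx hxB) (not_le.2 hr.1)
  exact Ioo_infinite hlt ((hB.image q').subset hsub)

/-- The potential of the inverse of a monotone function, increasing (`σ = 1`) or decreasing
(`σ = -1`), whose derivative is bounded and bounded away from zero. -/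
theorem exists_potential {q q' : ℝ → ℝ} {a b c C : ℝ} (hab : a < b) (hc : 0 < c)
    (hq : ∀ s ∈ Icc a b, HasDerivWithinAt q (q' s) (Icc a b) s)
    (hlow : ∀ s ∈ Icc a b, c ≤ |q' s|) {B : Set ℝ} (hB : B.Finite)
    (hup : ∀ s ∈ Icc a b, s ∉ B → |q' s| ≤ C) :
    ∃ (σ : ℝ) (Φ ψ : ℝ → ℝ) (k K : ℝ), 0 < k ∧ 0 < K ∧ Continuous ψ ∧
      (∀ z, HasDerivAt Φ (ψ z) z) ∧ ∀ s ∈ Icc a b, ∀ z,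
        k * (z - q s) ^ 2 ≤ σ * (Φ z - Φ (q s) - s * (z - q s)) ∧
          σ * (Φ z - Φ (q s) - s * (z - q s)) ≤ K * (z - q s) ^ 2 := by
  -- the increasing case
  have key : ∀ r r' : ℝ → ℝ, (∀ s ∈ Icc a b, HasDerivWithinAt r (r' s) (Icc a b) s) →
      (∀ s ∈ Icc a b, c ≤ r' s) → (∀ s ∈ Icc a b, s ∉ B → r' s ≤ C) →
      ∃ (Φ ψ : ℝ → ℝ) (k K : ℝ), 0 < k ∧ 0 < K ∧ Continuous ψ ∧
      (∀ z, HasDerivAt Φ (ψ z) z) ∧ ∀ s ∈ Icc a b, ∀ z,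
        k * (z - r s) ^ 2 ≤ Φ z - Φ (r s) - s * (z - r s) ∧
          Φ z - Φ (r s) - s * (z - r s) ≤ K * (z - r s) ^ 2 := by
    intro r r' hr h1 h2
    have h3 := derivative_le_of_finite hab hr hB h2
    have hcC : c ≤ C := (h1 a (left_mem_Icc.2 hab.le)).trans (h3 a (left_mem_Icc.2 hab.le))
    have hcont : ContinuousOn r (Icc a b) := fun s hs => (hr s hs).continuousWithinAt
    have hd : ∀ s ∈ interior (Icc a b), HasDerivAt r (r' s) s := fun s hs =>
      (hr s (interior_subset hs)).hasDerivAt (mem_interior_iff_mem_nhds.1 hs)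
    have hdiff : DifferentiableOn ℝ r (interior (Icc a b)) := fun s hs =>
      (hd s hs).differentiableAt.differentiableWithinAt
    obtain ⟨Φ, ψ, e1, e2, e3⟩ := exists_potential_of_increasing (q := r) hab.le hc hcC
      (fun s hs t ht hst =>
        ⟨(convex_Icc a b).mul_sub_le_image_sub_of_le_deriv hcont hdiff (fun x hx => by
            rw [(hd x hx).deriv]; exact h1 x (interior_subset hx)) s hs t ht hst,
          (convex_Icc a b).image_sub_le_mul_sub_of_deriv_le hcont hdiff (fun x hx => by
            rw [(hd x hx).deriv]; exact h3 x (interior_subset hx)) s hs t ht hst⟩)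
    have hC : 0 < C := lt_of_lt_of_le hc hcC
    exact ⟨Φ, ψ, (2 * C)⁻¹, (2 * c)⁻¹, by positivity, by positivity, e1, e2, e3⟩
  have hne : ∀ s ∈ Icc a b, q' s ≠ 0 := fun s hs h0 => by
    have := hlow s hs
    rw [h0, abs_zero] at this
    linarith
  rcases hasDerivWithinAt_forall_lt_or_forall_gt_of_forall_ne (convex_Icc a b) hq hne with hs | hs
  · obtain ⟨Φ, ψ, k, K, hk, hK, e1, e2, e3⟩ := key (fun s => - q s) (fun s => - q' s)
      (fun s hs => (hq s hs).neg)
      (fun s hs' => by have := hlow s hs'; rwa [abs_of_neg (hs s hs')] at this)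
      (fun s hs' hB' => by have := hup s hs' hB'; rwa [abs_of_neg (hs s hs')] at this)
    refine ⟨-1, fun z => - Φ (-z), fun z => ψ (-z), k, K, hk, hK, e1.comp continuous_neg,
      fun z => ?_, fun s hs' z => ?_⟩
    · have := ((e2 (-z)).comp z (hasDerivAt_neg z)).neg
      exact this.congr_deriv (by simp)
    · obtain ⟨f1, f2⟩ := e3 s hs' (-z)
      constructor <;> nlinarith
  · obtain ⟨Φ, ψ, k, K, hk, hK, e1, e2, e3⟩ := key q q' hq
      (fun s hs' => by have := hlow s hs'; rwa [abs_of_pos (hs s hs')] at this)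
      (fun s hs' hB' => by have := hup s hs' hB'; rwa [abs_of_pos (hs s hs')] at this)
    exact ⟨1, Φ, ψ, k, K, hk, hK, e1, e2, fun s hs' z => by simpa using e3 s hs' z⟩

/-! ### The rotation axis -/

theorem X3_eq_crossL (x : E3) : X3 x = crossL (EuclideanSpace.single 2 1) x := by
  ext i; fin_cases i <;> simp [X3, crossL_apply, cross_apply]

theorem contDiff_X3 : ContDiff ℝ ∞ X3 := by
  have : X3 = fun x => crossL (EuclideanSpace.single 2 1) x := funext X3_eq_crossL
  rw [this]
  exact (crossL (EuclideanSpace.single 2 1)).contDiff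

theorem norm_X3_sq (x : E3) : ‖X3 x‖ ^ 2 = x 0 ^ 2 + x 1 ^ 2 := by
  rw [EuclideanSpace.norm_sq_eq]
  simp [X3, Fin.sum_univ_three]
  ring

theorem X3_eq_zero_iff {x : E3} : X3 x = 0 ↔ x 0 = 0 ∧ x 1 = 0 := by
  rw [← norm_eq_zero, ← sq_eq_zero_iff, norm_X3_sq]
  constructor
  · intro h
    constructor <;> nlinarith [sq_nonneg (x 0), sq_nonneg (x 1)]
  · rintro ⟨h0, h1⟩
    simp [h0, h1]

theorem inner_X3_eq_zero {O : Set E3} {N : E3 → E3} {Ξ : E3 → ℝ}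
    (hΞX : ∀ x ∈ frontier O, crossL (N x) (sgrad N Ξ x) = -X3 x) {x : E3} (hx : x ∈ frontier O) :
    ⟪N x, X3 x⟫ = 0 := by
  rw [← neg_neg (X3 x), ← hΞX x hx, inner_neg_right, inner_crossL_left, neg_zero]

/-- Rotation about the axis as a linear map. -/
def rotL (s : ℝ) : E3 →L[ℝ] E3 :=
  LinearMap.toContinuousLinearMap
    { toFun := rotation s
      map_add' := by
        intro x y; ext i; fin_cases i <;> simp [rotation] <;> ring
      map_smul' := by
        intro c x; ext i; fin_cases i <;> simp [rotation] <;> ring }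

theorem rotL_apply (s : ℝ) (x : E3) : rotL s x = rotation s x := rfl

namespace IsNormalField

variable {O : Set E3} {N : E3 → E3} (hN : IsNormalField O N)
include hN

open Topology Filter

/-- Near a point of `M`, the surface is close to its tangent plane. -/
theorem eventually_inner_normal_sub_le {P : E3} (hP : P ∈ frontier O) :
    ∀ᶠ x in 𝓝[frontier O] P, |⟪N P, x - P⟫| ≤ 1 / 2 * ‖x - P‖ := by
  obtain ⟨g, hg⟩ := hN.smooth_boundary P hP
  obtain ⟨U, hUo, hPU, hgU, hU⟩ := id hg
  have hG0 := (hU P hPU).1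
  have hgd : HasFDerivAt g (fderiv ℝ g P) P :=
    ((hgU.contDiffAt (hUo.mem_nhds hPU)).differentiableAt (by simp)).hasFDerivAt
  have hpos : 0 < ‖gradient g P‖ := norm_pos_iff.2 hG0
  have h1 := hgd.isLittleO.def (c := ‖gradient g P‖ / 2) (by positivity)
  filter_upwards [mem_nhdsWithin_of_mem_nhds h1, mem_nhdsWithin_of_mem_nhds (hUo.mem_nhds hPU),
    self_mem_nhdsWithin] with x hx hxU hxM
  have h2 : g x = 0 := (hU x hxU).2.2.1 hxM
  have h3 : g P = 0 := (hU P hPU).2.2.1 hP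
  rw [h2, h3, sub_zero, zero_sub, norm_neg, ← inner_gradient] at hx
  rw [hN.eq P hP, outwardNormal_eq hP hg, real_inner_smul_left, abs_mul,
    abs_of_pos (inv_pos.2 hpos), ← Real.norm_eq_abs, inv_mul_le_iff₀ hpos]
  linarith

/-- At a point of the axis the normal is vertical. -/
theorem normal_of_X3_eq_zero (hrot : ∀ s : ℝ, ∀ x ∈ frontier O, rotation s x ∈ frontier O)
    {P : E3} (hP : P ∈ frontier O) (h0 : X3 P = 0) : N P 0 = 0 ∧ N P 1 = 0 ∧ N P 2 ^ 2 = 1 := by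
  obtain ⟨h00, h01⟩ := X3_eq_zero_iff.1 h0
  have hfix : ∀ s, rotation s P = P := by
    intro s; ext i; fin_cases i <;> simp [rotation, h00, h01]
  obtain ⟨g, hg⟩ := hN.smooth_boundary P hP
  obtain ⟨U, hUo, hPU, hgU, hU⟩ := id hg
  have hG0 := (hU P hPU).1
  have hgd : HasFDerivAt g (fderiv ℝ g P) P :=
    ((hgU.contDiffAt (hUo.mem_nhds hPU)).differentiableAt (by simp)).hasFDerivAt
  -- rotations preserve the tangent plane
  have hpres : ∀ s v, ⟪N P, v⟫ = 0 → ⟪N P, rotation s v⟫ = 0 := by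
    intro s v hv
    rw [hN.eq P hP] at hv
    have hd : HasFDerivAt (fun x => g (rotL s x)) (fderiv ℝ g P ∘L rotL s) P := by
      apply HasFDerivAt.comp P _ (rotL s).hasFDerivAt
      rw [rotL_apply, hfix]; exact hgd
    have hev : (fun x => g (rotL s x)) =ᶠ[𝓝[frontier O] P] fun _ => (0 : ℝ) := by
      have h1 : ∀ᶠ x in 𝓝 P, rotL s x ∈ U := by
        apply (rotL s).continuous.continuousAt.eventually_mem
        rw [rotL_apply, hfix]; exact hUo.mem_nhds hPU
      filter_upwards [mem_nhdsWithin_of_mem_nhds h1, self_mem_nhdsWithin] with x hxU hxM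
      exact (hU _ hxU).2.2.1 (hrot s x hxM)
    have h2 := fderiv_eq_of_tangent hN.smooth_boundary hP hd.hasFDerivWithinAt
      (hasFDerivAt_const (0 : ℝ) P).hasFDerivWithinAt hev hv
    rw [hN.eq P hP, outwardNormal_eq hP hg, real_inner_smul_left, inner_gradient]
    rw [ContinuousLinearMap.comp_apply, rotL_apply] at h2
    rw [h2]; simp
  have hnn := hN.inner_self hP
  rw [PiLp.inner_apply, Fin.sum_univ_three] at hnn
  simp only [RCLike.inner_apply, conj_trivial] at hnn
  set n := N P
  have h1 := hpres Real.pi (!₂[-(n 2 * n 0), -(n 2 * n 1), 1 - n 2 ^ 2]) (by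
    rw [PiLp.inner_apply, Fin.sum_univ_three]
    simp
    linear_combination (-n 2) * hnn)
  have hz : n 2 * (1 - n 2 ^ 2) = 0 := by
    rw [PiLp.inner_apply, Fin.sum_univ_three] at h1
    simp [rotation] at h1
    linear_combination (1 / 2) * h1 - (1 / 2) * n 2 * hnn
  have h2 := hpres (-(Real.pi / 2)) (!₂[-n 1, n 0, 0]) (by
    rw [PiLp.inner_apply, Fin.sum_univ_three]
    simp
    ring)
  rw [PiLp.inner_apply, Fin.sum_univ_three] at h2
  simp [rotation] at h2
  have h3 : n 2 ^ 2 = 1 := by nlinarith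
  refine ⟨?_, ?_, h3⟩ <;> nlinarith [sq_nonneg (n 0), sq_nonneg (n 1)]

/-- Near a point of the axis, the distance to it is controlled by the rotation field. -/
theorem eventually_norm_sub_le_X3 (hrot : ∀ s : ℝ, ∀ x ∈ frontier O, rotation s x ∈ frontier O)
    {P : E3} (hP : P ∈ frontier O) (h0 : X3 P = 0) :
    ∀ᶠ x in 𝓝[frontier O] P, ‖x - P‖ ≤ 2 * ‖X3 x‖ := by
  obtain ⟨h00, h01⟩ := X3_eq_zero_iff.1 h0
  obtain ⟨hn0, hn1, hn2⟩ := hN.normal_of_X3_eq_zero hrot hP h0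
  filter_upwards [hN.eventually_inner_normal_sub_le hP] with x hx
  apply le_of_sq_le_sq _ (by positivity)
  have h1 : ‖x - P‖ ^ 2 = x 0 ^ 2 + x 1 ^ 2 + (x 2 - P 2) ^ 2 := by
    rw [EuclideanSpace.norm_sq_eq]
    simp [Fin.sum_univ_three, h00, h01]
  have h2 := pow_le_pow_left₀ (abs_nonneg _) hx 2
  rw [sq_abs, PiLp.inner_apply, Fin.sum_univ_three] at h2
  simp only [RCLike.inner_apply, conj_trivial, hn0, hn1, PiLp.sub_apply, mul_zero, zero_add] at h2
  rw [mul_pow, hn2, mul_one, mul_pow, h1] at h2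
  rw [mul_pow, norm_X3_sq, h1]
  nlinarith [sq_nonneg (x 0), sq_nonneg (x 1), sq_nonneg (x 2 - P 2)]

/-- The axis meets `M` in finitely many points. -/
theorem finite_axis (hrot : ∀ s : ℝ, ∀ x ∈ frontier O, rotation s x ∈ frontier O) :
    {x ∈ frontier O | X3 x = 0}.Finite := by
  have hcl : IsClosed {x : E3 | X3 x = 0} := isClosed_singleton.preimage contDiff_X3.continuous
  apply (hN.isCompact.inter_right hcl).finite
  apply IsDiscrete.of_nhdsWithin
  rintro P ⟨hP, h0⟩
  rw [Filter.le_pure_iff]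
  filter_upwards [nhdsWithin_mono P inter_subset_left (hN.eventually_norm_sub_le_X3 hrot hP h0),
    self_mem_nhdsWithin] with x hx hx0
  have h1 : X3 x = 0 := hx0.2
  rw [h1, norm_zero, mul_zero] at hx
  exact sub_eq_zero.1 (norm_le_zero_iff.1 hx)

/-- A `C¹` field that vanishes on the axis is controlled by the rotation field. -/
theorem exists_norm_le_X3 (hrot : ∀ s : ℝ, ∀ x ∈ frontier O, rotation s x ∈ frontier O)
    {F : E3 → E3} (hF : ContDiff ℝ 1 F) (hF0 : ∀ x ∈ frontier O, X3 x = 0 → F x = 0) :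
    ∃ C, ∀ x ∈ frontier O, ‖F x‖ ≤ C * ‖X3 x‖ := by
  apply hN.isCompact.induction_on (p := fun s => ∃ C, ∀ x ∈ s, ‖F x‖ ≤ C * ‖X3 x‖)
  · exact ⟨0, by simp⟩
  · rintro s t hst ⟨C, hC⟩
    exact ⟨C, fun x hx => hC x (hst hx)⟩
  · rintro s t ⟨C, hC⟩ ⟨D, hD⟩
    refine ⟨max C D, ?_⟩
    rintro x (hx | hx)
    · exact (hC x hx).trans (mul_le_mul_of_nonneg_right (le_max_left _ _) (norm_nonneg _))
    · exact (hD x hx).trans (mul_le_mul_of_nonneg_right (le_max_right _ _) (norm_nonneg _))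
  · intro P hP
    by_cases h0 : X3 P = 0
    · obtain ⟨c, hc⟩ := (hF.differentiable one_ne_zero P).hasFDerivAt.isBigO_sub.bound
      refine ⟨_, (hN.eventually_norm_sub_le_X3 hrot hP h0).and
        (mem_nhdsWithin_of_mem_nhds hc), |c| * 2, ?_⟩
      rintro x ⟨h1, h2⟩
      rw [hF0 P hP h0, sub_zero] at h2
      calc ‖F x‖ ≤ c * ‖x - P‖ := h2
        _ ≤ |c| * (2 * ‖X3 x‖) := mul_le_mul (le_abs_self c) h1 (norm_nonneg _) (abs_nonneg c)
        _ = _ := by ring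
    · have hX : 0 < ‖X3 P‖ := norm_pos_iff.2 h0
      have hcont : ContinuousAt (fun x => ‖F x‖ / ‖X3 x‖) P :=
        hF.continuous.norm.continuousAt.div contDiff_X3.continuous.norm.continuousAt hX.ne'
      have h1 := hcont.eventually_lt_const (lt_add_one _)
      have h2 := (contDiff_X3.continuous.norm.tendsto P).eventually_const_lt hX
      refine ⟨_, mem_nhdsWithin_of_mem_nhds (h1.and h2), ‖F P‖ / ‖X3 P‖ + 1, ?_⟩
      rintro x ⟨h3, h4⟩
      exact ((div_lt_iff₀ h4).1 h3).le

/-- The gradient of the rotation potential is `J X₃`. -/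
theorem fderiv_rotation_potential {Ξ : E3 → ℝ}
    (hΞX : ∀ x ∈ frontier O, crossL (N x) (sgrad N Ξ x) = -X3 x) {x v : E3} (hx : x ∈ frontier O)
    (hv : ⟪N x, v⟫ = 0) : fderiv ℝ Ξ x v = ⟪crossL (N x) (X3 x), v⟫ := by
  have h1 : crossL (N x) (crossL (N x) (sgrad N Ξ x)) = - sgrad N Ξ x := by
    rw [crossL_crossL, hN.inner_self hx, sgrad, inner_projT (hN.inner_self hx)]
    simp
  rw [hΞX x hx, map_neg, neg_inj] at h1
  rw [h1, real_inner_comm, sgrad, inner_projT_of_inner (by rw [real_inner_comm]; exact hv),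
    real_inner_comm, inner_gradient]

/-- The chain rule for `Z = q ∘ Ξ` on `M`, where `q` is only differentiable within the range of
`Ξ`. -/
theorem fderiv_eq_of_eq_comp {Ξ Z : E3 → ℝ} {q : ℝ → ℝ} {J : Set ℝ} {d : ℝ} {x v : E3}
    (hx : x ∈ frontier O) (hΞ : DifferentiableAt ℝ Ξ x) (hZ : DifferentiableAt ℝ Z x)
    (hmaps : MapsTo Ξ (frontier O) J) (hq : ∀ y ∈ frontier O, Z y = q (Ξ y))
    (hqd : HasDerivWithinAt q d J (Ξ x)) (hv : ⟪N x, v⟫ = 0) :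
    fderiv ℝ Z x v = d * fderiv ℝ Ξ x v := by
  rw [hN.eq x hx] at hv
  exact fderiv_eq_of_tangent hN.smooth_boundary hx hZ.hasFDerivAt.hasFDerivWithinAt
    (hqd.comp_hasFDerivWithinAt x hΞ.hasFDerivAt.hasFDerivWithinAt hmaps)
    (by filter_upwards [self_mem_nhdsWithin] with y hy using hq y hy) hv

/-- The potential `Φ` with `Φ' = q⁻¹`, where `q` expresses the absolute vorticity `Z` of the
stationary flow through the rotation potential `Ξ`. -/
theorem exists_potential (hO : IsRotationalBody O) {Ξ Z : E3 → ℝ} (hΞ : ContDiff ℝ ∞ Ξ)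
    (hΞX : ∀ x ∈ frontier O, crossL (N x) (sgrad N Ξ x) = -X3 x) (hZ : ContDiff ℝ ∞ Z)
    {q : ℝ → ℝ} (hq : ∀ x ∈ frontier O, Z x = q (Ξ x))
    (hmono : DerivBoundedAwayFromZeroOn q (Ξ '' frontier O)) :
    ∃ (σ : ℝ) (Φ ψ : ℝ → ℝ) (k K : ℝ), 0 < k ∧ 0 < K ∧ Continuous ψ ∧
      (∀ z, HasDerivAt Φ (ψ z) z) ∧ ∀ x ∈ frontier O, ∀ z,
        k * (z - Z x) ^ 2 ≤ σ * (Φ z - Φ (Z x) - Ξ x * (z - Z x)) ∧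
          σ * (Φ z - Φ (Z x) - Ξ x * (z - Z x)) ≤ K * (z - Z x) ^ 2 := by
  have hconn : IsConnected (frontier O) := by
    obtain ⟨Φ, Ψ, h1, h2, h3, h4, h5⟩ := hO.diffeo_sphere
    have himg : Φ '' Metric.sphere 0 1 = frontier O :=
      Subset.antisymm h2.image_subset (fun y hy => ⟨Ψ y, h4 hy, h5.2 hy⟩)
    rw [← himg]
    refine (isConnected_sphere ?_ (0 : E3) zero_le_one).image Φ h1.continuousOn
    rw [← Module.finrank_eq_rank]
    simp
  obtain ⟨a, b, hab⟩ : ∃ a b, Ξ '' frontier O = Icc a b :=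
    ⟨_, _, eq_Icc_of_connected_compact (hconn.image Ξ hΞ.continuous.continuousOn)
      (hN.isCompact.image hΞ.continuous)⟩
  obtain ⟨c, hc, hlow⟩ := hmono
  rw [hab] at hlow
  have hne : (Icc a b).Nonempty := hab ▸ hconn.nonempty.image Ξ
  have hlt : a < b := by
    rcases (nonempty_Icc.1 hne).lt_or_eq with h | h
    · exact h
    · exfalso
      have h1 := hlow a (h ▸ left_mem_Icc.2 le_rfl)
      rw [← h, Icc_self, derivWithin_zero_of_not_accPt, abs_zero] at h1
      · linarith
      · intro hacc
        have h2 : 𝓝[≠] a ⊓ 𝓟 {a} = ⊥ := by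
          rw [nhdsWithin, inf_assoc, inf_principal, compl_inter_self, principal_empty, inf_bot_eq]
        exact hacc.ne h2
  have hqd : ∀ s ∈ Icc a b, HasDerivWithinAt q (derivWithin q (Icc a b) s) (Icc a b) s := by
    intro s hs
    apply DifferentiableWithinAt.hasDerivWithinAt
    by_contra hnd
    have h1 := hlow s hs
    rw [derivWithin_zero_of_not_differentiableWithinAt hnd, abs_zero] at h1
    linarith
  -- `∇Z = q'(ξ) ∇ξ` and `|∇ξ| = |X₃|`
  have hgrad : ∀ x ∈ frontier O, sgrad N Z x = derivWithin q (Icc a b) (Ξ x) • sgrad N Ξ x := by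
    intro x hx
    have hnn := hN.inner_self hx
    have hmaps : MapsTo Ξ (frontier O) (Icc a b) := fun y hy => hab ▸ mem_image_of_mem Ξ hy
    have h2 : ∀ v, ⟪N x, v⟫ = 0 → fderiv ℝ Z x v =
        derivWithin q (Icc a b) (Ξ x) * fderiv ℝ Ξ x v := fun v hv =>
      hN.fderiv_eq_of_eq_comp hx (hΞ.differentiable (by simp) x) (hZ.differentiable (by simp) x)
        hmaps hq (hqd (Ξ x) (hmaps hx)) hv
    obtain ⟨e₁, e₂, h⟩ := hN.exists_frame hx
    apply h.ext_inner
    · rw [real_inner_smul_right, sgrad, sgrad, inner_projT_of_inner h.e1n,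
        inner_projT_of_inner h.e1n, real_inner_comm, inner_gradient, real_inner_comm,
        inner_gradient, h2 _ h.n1]
    · rw [real_inner_smul_right, sgrad, sgrad, inner_projT_of_inner h.e2n,
        inner_projT_of_inner h.e2n, real_inner_comm, inner_gradient, real_inner_comm,
        inner_gradient, h2 _ h.n2]
    · rw [real_inner_smul_right, sgrad, sgrad, inner_projT hnn, inner_projT hnn, mul_zero]
  have hnorm : ∀ x ∈ frontier O, ‖sgrad N Ξ x‖ = ‖X3 x‖ := by
    intro x hx
    have hnn := hN.inner_self hx
    rw [← sq_eq_sq₀ (norm_nonneg _) (norm_nonneg _), ← norm_neg (X3 x), ← hΞX x hx,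
      ← real_inner_self_eq_norm_sq, ← real_inner_self_eq_norm_sq, inner_crossL_crossL, hnn]
    rw [sgrad, inner_projT hnn]
    ring
  obtain ⟨C, hC⟩ := hN.exists_norm_le_X3 hO.rotation_invariant
    (contDiff_sgrad hN.smooth hZ (m := 1) (by rw [one_add_one_eq_two]; exact two_le_infty)
      (by simp)) (fun x hx h0 => by
        rw [hgrad x hx]
        have := hnorm x hx
        rw [h0, norm_zero, norm_eq_zero] at this
        rw [this, smul_zero])
  obtain ⟨σ, Φ, ψ, k, K, h1, h2, h3, h4, h5⟩ := RotatingSurface.exists_potential hlt hc hqd hlow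
    (C := C) ((hN.finite_axis hO.rotation_invariant).image Ξ) (fun s hs hsB => by
      obtain ⟨x, hx, rfl⟩ : s ∈ Ξ '' frontier O := hab ▸ hs
      have hX : X3 x ≠ 0 := fun h0 => hsB ⟨x, ⟨hx, h0⟩, rfl⟩
      have h6 := hC x hx
      rw [hgrad x hx, norm_smul, hnorm x hx, Real.norm_eq_abs] at h6
      exact le_of_mul_le_mul_right h6 (norm_pos_iff.2 hX))
  refine ⟨σ, Φ, ψ, k, K, h1, h2, h3, h4, fun x hx z => ?_⟩
  rw [hq x hx]
  exact h5 (Ξ x) (hab ▸ mem_image_of_mem Ξ hx) z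

end IsNormalField

/-! ### Integrals depending on parameters -/

namespace IsNormalField

variable {O : Set E3} {N : E3 → E3} (hN : IsNormalField O N)
include hN

theorem continuous_integral {X F : Type*} [TopologicalSpace X] [FirstCountableTopology X]
    [LocallyCompactSpace X] [NormedAddCommGroup F] [NormedSpace ℝ F] {f : X → E3 → F}
    (hf : Continuous (Function.uncurry f)) :
    Continuous fun x => ∫ y, f x y ∂(areaMeasure O) := by
  have := hN.isFiniteMeasure
  have h := continuous_parametric_integral_of_continuous (μ := areaMeasure O) hf hN.isCompact
  rwa [hN.areaMeasure_restrict] at h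

open Topology in
theorem hasFDerivAt_integral {f : E3 → E3 → ℝ} {f' : E3 → E3 → E3 →L[ℝ] ℝ}
    (hf : Continuous (Function.uncurry f)) (hf' : Continuous (Function.uncurry f'))
    (hd : ∀ x y, HasFDerivAt (fun x => f x y) (f' x y) x) (x₀ : E3) :
    HasFDerivAt (fun x => ∫ y, f x y ∂(areaMeasure O)) (∫ y, f' x₀ y ∂(areaMeasure O)) x₀ := by
  have := hN.isFiniteMeasure
  obtain ⟨C, hC⟩ := ((isCompact_closedBall x₀ 1).prod hN.isCompact).exists_bound_of_continuousOn
    hf'.continuousOn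
  refine hasFDerivAt_integral_of_dominated_of_fderiv_le (bound := fun _ => C)
    (Metric.closedBall_mem_nhds x₀ one_pos) (Filter.Eventually.of_forall fun x => ?_) ?_ ?_ ?_
    (integrable_const C) (Filter.Eventually.of_forall fun y x _ => hd x y)
  · exact (hf.comp (Continuous.prodMk_right x)).aestronglyMeasurable
  · exact hN.integrable_of_continuous (hf.comp (Continuous.prodMk_right x₀))
  · exact (hf'.comp (Continuous.prodMk_right x₀)).aestronglyMeasurable
  · filter_upwards [hN.ae_mem] with y hy x hx using hC (x, y) ⟨hx, hy⟩

open Topology in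
theorem hasDerivAt_integral {f f' : ℝ → E3 → ℝ} {U : Set ℝ} (hU : IsOpen U)
    (hf : ∀ t ∈ U, ContinuousOn (f t) (frontier O))
    (hf' : ContinuousOn (Function.uncurry f') (U ×ˢ frontier O))
    (hd : ∀ t ∈ U, ∀ y ∈ frontier O, HasDerivAt (fun t => f t y) (f' t y) t) {t₀ : ℝ}
    (ht₀ : t₀ ∈ U) :
    HasDerivAt (fun t => ∫ y, f t y ∂(areaMeasure O)) (∫ y, f' t₀ y ∂(areaMeasure O)) t₀ := by
  have := hN.isFiniteMeasure
  obtain ⟨r, hr, hrU⟩ := Metric.nhds_basis_closedBall.mem_iff.1 (hU.mem_nhds ht₀)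
  obtain ⟨C, hC⟩ := ((isCompact_closedBall t₀ r).prod hN.isCompact).exists_bound_of_continuousOn
    (hf'.mono (prod_mono hrU Subset.rfl))
  refine (hasDerivAt_integral_of_dominated_loc_of_deriv_le (bound := fun _ => C)
    (Metric.closedBall_mem_nhds t₀ hr) ?_ (hN.integrable (hf t₀ ht₀)) ?_ ?_
    (integrable_const C) ?_).2
  · filter_upwards [hU.mem_nhds ht₀] with t ht using (hN.integrable (hf t ht)).1
  · exact (hN.integrable (hf'.comp (Continuous.prodMk_right t₀).continuousOn
      fun y hy => ⟨ht₀, hy⟩)).1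
  · filter_upwards [hN.ae_mem] with y hy t ht using hC (t, y) ⟨ht, hy⟩
  · filter_upwards [hN.ae_mem] with y hy t ht using hd t (hrU ht) y hy

/-- Integration by parts against a divergence-free tangent field. -/
theorem integral_fderiv_eq_zero {V : E3 → E3} {g : E3 → ℝ} (hV : ContDiff ℝ 1 V)
    (ht : ∀ x ∈ frontier O, ⟪N x, V x⟫ = 0) (hdiv : ∀ x ∈ frontier O, sdiv N V x = 0)
    (hg : ContDiff ℝ 1 g) : ∫ x, fderiv ℝ g x (V x) ∂(areaMeasure O) = 0 := by
  have hgV : ContDiff ℝ 1 fun x => g x • V x := hg.smul hV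
  rw [← hN.integral_sdiv_eq_zero hgV
    (fun x hx => by rw [real_inner_smul_right, ht x hx, mul_zero])]
  apply hN.integral_congr
  intro x hx
  rw [hN.sdiv_smul hx (hg.differentiable one_ne_zero x) (hV.differentiable one_ne_zero x)
    (ht x hx), hdiv x hx, mul_zero, zero_add]

end IsNormalField

/-! ### The regularizing kernel -/

/-- The kernel `(ε² + |v|²)⁻²`. Its derivative satisfies `|v| |∇ker| ≤ 4 ker`, so that commutators
with Lipschitz fields are bounded by the kernel itself. -/
def ker (ε : ℝ) (v : E3) : ℝ := ((ε ^ 2 + ‖v‖ ^ 2) ^ 2)⁻¹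

/-- The derivative of the kernel. -/
def dker (ε : ℝ) (v : E3) : E3 →L[ℝ] ℝ := (-(4 * ((ε ^ 2 + ‖v‖ ^ 2) ^ 3)⁻¹)) • innerSL ℝ v

section Kernel

variable {ε : ℝ} (hε : 0 < ε)
include hε

theorem ker_base_pos (v : E3) : 0 < ε ^ 2 + ‖v‖ ^ 2 := by positivity

theorem ker_pos (v : E3) : 0 < ker ε v := inv_pos.2 (pow_pos (ker_base_pos hε v) 2)

theorem contDiff_ker : ContDiff ℝ ∞ (ker ε) :=
  ((contDiff_const.add (contDiff_norm_sq ℝ)).pow 2).inv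
    fun v => (pow_pos (ker_base_pos hε v) 2).ne'

theorem hasFDerivAt_ker (v : E3) : HasFDerivAt (ker ε) (dker ε v) v := by
  have h0 := ker_base_pos hε v
  have h1 : HasFDerivAt (fun v : E3 => ε ^ 2 + ‖v‖ ^ 2) _ v :=
    (hasStrictFDerivAt_norm_sq v).hasFDerivAt.const_add (ε ^ 2)
  have h2 := (hasDerivAt_inv (pow_pos h0 2).ne').comp_hasFDerivAt v (h1.pow 2)
  have h3 : HasFDerivAt (ker ε) _ v := h2
  refine h3.congr_fderiv ?_
  ext w
  simp [dker]
  field_simp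
  ring

theorem continuous_dker : Continuous (dker ε) := by
  have h1 : Continuous fun v : E3 => -(4 * ((ε ^ 2 + ‖v‖ ^ 2) ^ 3)⁻¹) :=
    (continuous_const.mul (((continuous_const.add (continuous_norm.pow 2)).pow 3).inv₀
      fun v => (pow_pos (ker_base_pos hε v) 3).ne')).neg
  exact h1.smul (innerSL ℝ (E := E3)).continuous

theorem abs_dker_le {v w : E3} {L : ℝ} (hL : 0 ≤ L) (hw : ‖w‖ ≤ L * ‖v‖) :
    |dker ε v w| ≤ 4 * L * ker ε v := by
  have h0 := ker_base_pos hε v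
  have h1 : |⟪v, w⟫| ≤ L * (ε ^ 2 + ‖v‖ ^ 2) := by
    have h2 : |⟪v, w⟫| ≤ ‖v‖ * (L * ‖v‖) :=
      (abs_real_inner_le_norm v w).trans (mul_le_mul_of_nonneg_left hw (norm_nonneg _))
    nlinarith [mul_nonneg hL (sq_nonneg ε)]
  simp only [dker, ker, smul_apply, innerSL_apply_apply, smul_eq_mul]
  rw [abs_mul, abs_neg, abs_of_pos (by positivity)]
  calc 4 * ((ε ^ 2 + ‖v‖ ^ 2) ^ 3)⁻¹ * |⟪v, w⟫|
      ≤ 4 * ((ε ^ 2 + ‖v‖ ^ 2) ^ 3)⁻¹ * (L * (ε ^ 2 + ‖v‖ ^ 2)) := by gcongr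
    _ = _ := by field_simp

end Kernel

/-! ### Kernel averages on the surface -/

/-- The total mass of the kernel centered at `x`. -/
def kmass (O : Set E3) (ε : ℝ) (x : E3) : ℝ := ∫ y, ker ε (x - y) ∂(areaMeasure O)

/-- The average of `g` over `M`, weighted by the kernel centered at `x`. -/
def kavg (O : Set E3) (ε : ℝ) (g : E3 → ℝ) (x : E3) : ℝ :=
  (∫ y, g y * ker ε (x - y) ∂(areaMeasure O)) * (kmass O ε x)⁻¹

theorem continuous_ker_sub {ε : ℝ} (hε : 0 < ε) :
    Continuous fun p : E3 × E3 => ker ε (p.1 - p.2) :=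
  (contDiff_ker hε).continuous.comp (by fun_prop)

theorem continuous_dker_sub {ε : ℝ} (hε : 0 < ε) :
    Continuous fun p : E3 × E3 => dker ε (p.1 - p.2) :=
  (continuous_dker hε).comp (by fun_prop)

theorem kmass_eq (O : Set E3) (ε : ℝ) : kmass O ε = fun x => ∫ y, (1 : ℝ) * ker ε (x - y) ∂(areaMeasure O) := by
  ext x; simp [kmass]

theorem continuous_ker_right {ε : ℝ} (hε : 0 < ε) (x : E3) : Continuous fun y => ker ε (x - y) :=
  (contDiff_ker hε).continuous.comp (by fun_prop)

theorem continuous_dker_right {ε : ℝ} (hε : 0 < ε) (x : E3) {V : E3 → E3} (hV : Continuous V) :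
    Continuous fun y => dker ε (x - y) (V y) :=
  ((continuous_dker hε).comp (by fun_prop)).clm_apply hV

namespace IsNormalField

variable {O : Set E3} {N : E3 → E3} (hN : IsNormalField O N)
include hN

theorem hasFDerivAt_integral_ker {ε : ℝ} (hε : 0 < ε) {g : E3 → ℝ} (hg : Continuous g) (x : E3) :
    HasFDerivAt (fun x => ∫ y, g y * ker ε (x - y) ∂(areaMeasure O))
      (∫ y, g y • dker ε (x - y) ∂(areaMeasure O)) x := by
  refine hN.hasFDerivAt_integral (f := fun x y => g y * ker ε (x - y))
    (f' := fun x y => g y • dker ε (x - y))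
    ((hg.comp continuous_snd).mul (continuous_ker_sub hε))
    ((hg.comp continuous_snd).smul (continuous_dker_sub hε)) (fun x y => ?_) x
  have h1 := (hasFDerivAt_ker hε (x - y)).comp x ((hasFDerivAt_id x).sub_const y)
  exact h1.const_mul (g y)

theorem contDiff_integral_ker {ε : ℝ} (hε : 0 < ε) {g : E3 → ℝ} (hg : Continuous g) :
    ContDiff ℝ 1 fun x => ∫ y, g y * ker ε (x - y) ∂(areaMeasure O) := by
  rw [contDiff_one_iff_fderiv]
  refine ⟨fun x => (hN.hasFDerivAt_integral_ker hε hg x).differentiableAt, ?_⟩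
  have h1 : fderiv ℝ (fun x => ∫ y, g y * ker ε (x - y) ∂(areaMeasure O)) = fun x =>
      ∫ y, g y • dker ε (x - y) ∂(areaMeasure O) :=
    funext fun x => (hN.hasFDerivAt_integral_ker hε hg x).fderiv
  rw [h1]
  exact hN.continuous_integral (f := fun x y => g y • dker ε (x - y))
    ((hg.comp continuous_snd).smul (continuous_dker_sub hε))

theorem fderiv_integral_ker {ε : ℝ} (hε : 0 < ε) {g : E3 → ℝ} (hg : Continuous g) (x v : E3) :
    fderiv ℝ (fun x => ∫ y, g y * ker ε (x - y) ∂(areaMeasure O)) x v =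
      ∫ y, g y * dker ε (x - y) v ∂(areaMeasure O) := by
  rw [(hN.hasFDerivAt_integral_ker hε hg x).fderiv, ContinuousLinearMap.integral_apply]
  · rfl
  · exact hN.integrable_of_continuous (hg.smul ((continuous_dker hε).comp (by fun_prop)))

theorem areaMeasure_univ_pos (hne : (frontier O).Nonempty) : 0 < areaMeasure O univ := by
  obtain ⟨x, hx⟩ := hne
  obtain ⟨c, hc, ε₀, hε₀, h⟩ := hN.exists_area_lower_bound
  calc (0 : ENNReal) < ENNReal.ofReal (c * ε₀ ^ 2) := ENNReal.ofReal_pos.2 (by positivity)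
    _ ≤ _ := h x hx ε₀ hε₀ le_rfl
    _ ≤ _ := measure_mono (subset_univ _)

theorem kmass_pos (hne : (frontier O).Nonempty) {ε : ℝ} (hε : 0 < ε) (x : E3) :
    0 < kmass O ε x := by
  rw [kmass, integral_pos_iff_support_of_nonneg (fun y => (ker_pos hε _).le)
    (hN.integrable_of_continuous (continuous_ker_right hε x))]
  convert hN.areaMeasure_univ_pos hne
  exact eq_univ_of_forall fun y => (ker_pos hε _).ne'

/-- The mass of the kernel grows like `ε⁻²`, by the lower bound for the area of small balls. -/
theorem exists_kmass_lower_bound : ∃ c > 0, ∃ ε₀ > 0, ∀ x ∈ frontier O, ∀ ε, 0 < ε → ε ≤ ε₀ →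
    c * (ε ^ 2)⁻¹ ≤ kmass O ε x := by
  have := hN.isFiniteMeasure
  obtain ⟨c, hc, ε₀, hε₀, h⟩ := hN.exists_area_lower_bound
  refine ⟨c / 4, by positivity, ε₀, hε₀, fun x hx ε hε hεε₀ => ?_⟩
  have hi : Integrable (fun y => ker ε (x - y)) (areaMeasure O) :=
    hN.integrable_of_continuous (continuous_ker_right hε x)
  have h1 : ∫ y in Metric.ball x ε, ker ε (x - y) ∂(areaMeasure O) ≤ kmass O ε x :=
    setIntegral_le_integral hi (Filter.Eventually.of_forall fun y => (ker_pos hε _).le)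
  have h2 : ∫ y in Metric.ball x ε, ((2 * ε ^ 2) ^ 2)⁻¹ ∂(areaMeasure O) ≤
      ∫ y in Metric.ball x ε, ker ε (x - y) ∂(areaMeasure O) := by
    apply setIntegral_mono_on (integrable_const _) hi.integrableOn measurableSet_ball
    intro y hy
    have h3 : ‖x - y‖ < ε := by rw [← dist_eq_norm, dist_comm]; exact hy
    have h4 : ‖x - y‖ ^ 2 ≤ ε ^ 2 := pow_le_pow_left₀ (norm_nonneg _) h3.le 2
    rw [ker]
    apply inv_anti₀ (pow_pos (ker_base_pos hε _) 2)
    apply pow_le_pow_left₀ (ker_base_pos hε _).le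
    linarith
  rw [setIntegral_const, smul_eq_mul] at h2
  have h5 : c * ε ^ 2 ≤ (areaMeasure O).real (Metric.ball x ε) := by
    rw [Measure.real, ← ENNReal.ofReal_le_iff_le_toReal (measure_ne_top _ _)]
    exact h x hx ε hε hεε₀
  calc c / 4 * (ε ^ 2)⁻¹ = c * ε ^ 2 * ((2 * ε ^ 2) ^ 2)⁻¹ := by field_simp; norm_num
    _ ≤ (areaMeasure O).real (Metric.ball x ε) * ((2 * ε ^ 2) ^ 2)⁻¹ := by gcongr
    _ ≤ _ := h2.trans h1

/-- The kernels concentrate on the diagonal, uniformly in the parameter `t`. -/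
theorem exists_concentration {g : ℝ → E3 → ℝ} (hg : Continuous fun p : ℝ × E3 => g p.1 p.2)
    {τ δ : ℝ} (hδ : 0 < δ) : ∃ ε > 0, ∀ t ∈ Icc 0 τ, ∀ x ∈ frontier O,
      ∫ y, |g t y - g t x| * ker ε (x - y) ∂(areaMeasure O) ≤ δ * kmass O ε x := by
  have := hN.isFiniteMeasure
  have hcomp : IsCompact (Icc 0 τ ×ˢ frontier O) := isCompact_Icc.prod hN.isCompact
  obtain ⟨B, hB⟩ := hcomp.exists_bound_of_continuousOn hg.continuousOn
  obtain ⟨r, hr, hrg⟩ := Metric.uniformContinuousOn_iff.1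
    (hcomp.uniformContinuousOn_of_continuous hg.continuousOn) (δ / 2) (by positivity)
  obtain ⟨c, hc, ε₀, hε₀, hm⟩ := hN.exists_kmass_lower_bound
  set s := (areaMeasure O).real univ with hs
  have hs0 : 0 ≤ s := measureReal_nonneg
  set A := 2 * |B| * (r ^ 4)⁻¹ * s with hA
  have hA0 : 0 ≤ A := by positivity
  -- the far part is at most `A`, while the mass of the kernel tends to infinity
  obtain ⟨ε, hε, hεε₀, hεA⟩ : ∃ ε > 0, ε ≤ ε₀ ∧ A ≤ δ / 2 * (c * (ε ^ 2)⁻¹) := by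
    have h1 : 0 < δ / 2 * c / (A + 1) := by positivity
    refine ⟨min ε₀ (√(δ / 2 * c / (A + 1))), lt_min hε₀ (Real.sqrt_pos.2 h1), min_le_left _ _, ?_⟩
    set ε := min ε₀ (√(δ / 2 * c / (A + 1)))
    have hε : 0 < ε := lt_min hε₀ (Real.sqrt_pos.2 h1)
    have h2 : ε ^ 2 ≤ δ / 2 * c / (A + 1) := by
      calc ε ^ 2 ≤ √(δ / 2 * c / (A + 1)) ^ 2 :=
            pow_le_pow_left₀ hε.le (min_le_right _ _) 2
        _ = _ := Real.sq_sqrt h1.le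
    rw [le_div_iff₀ (by positivity)] at h2
    rw [← mul_assoc, ← div_eq_mul_inv, le_div_iff₀ (by positivity)]
    nlinarith [sq_nonneg ε]
  refine ⟨ε, hε, fun t ht x hx => ?_⟩
  have hgt : Continuous (g t) := hg.comp (Continuous.prodMk_right t)
  have ik : Integrable (fun y => ker ε (x - y)) (areaMeasure O) :=
    hN.integrable_of_continuous (continuous_ker_right hε x)
  have hpt : ∀ y ∈ frontier O, |g t y - g t x| * ker ε (x - y) ≤
      δ / 2 * ker ε (x - y) + 2 * |B| * (r ^ 4)⁻¹ := by
    intro y hy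
    have hk := ker_pos hε (x - y)
    rcases lt_or_ge (dist y x) r with hyx | hyx
    · have h1 := hrg (t, y) ⟨ht, hy⟩ (t, x) ⟨ht, hx⟩ (by
        rw [Prod.dist_eq]; simpa using hyx)
      rw [Real.dist_eq] at h1
      have h2 : 0 ≤ 2 * |B| * (r ^ 4)⁻¹ := by positivity
      nlinarith
    · have h1 : |g t y - g t x| ≤ 2 * |B| := by
        have a1 := hB (t, y) ⟨ht, hy⟩
        have a2 := hB (t, x) ⟨ht, hx⟩
        rw [Real.norm_eq_abs] at a1 a2
        have a3 := abs_sub (g t y) (g t x)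
        have a4 := le_abs_self B
        simp only at a1 a2
        linarith
      have h2 : ker ε (x - y) ≤ (r ^ 4)⁻¹ := by
        rw [ker]
        apply inv_anti₀ (by positivity)
        have h3 : r ≤ ‖x - y‖ := by rwa [← dist_eq_norm, dist_comm]
        have h4 : r ^ 2 ≤ ‖x - y‖ ^ 2 := pow_le_pow_left₀ hr.le h3 2
        calc r ^ 4 = (r ^ 2) ^ 2 := by ring
          _ ≤ _ := pow_le_pow_left₀ (by positivity) (by nlinarith [sq_nonneg ε]) 2
      calc |g t y - g t x| * ker ε (x - y) ≤ 2 * |B| * (r ^ 4)⁻¹ :=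
            mul_le_mul h1 h2 hk.le (by positivity)
        _ ≤ _ := by
          have : 0 ≤ δ / 2 * ker ε (x - y) := by positivity
          linarith
  calc ∫ y, |g t y - g t x| * ker ε (x - y) ∂(areaMeasure O)
      ≤ ∫ y, (δ / 2 * ker ε (x - y) + 2 * |B| * (r ^ 4)⁻¹) ∂(areaMeasure O) := by
        apply integral_mono_ae
        · exact hN.integrable_of_continuous
            ((hgt.sub continuous_const).abs.mul (continuous_ker_right hε x))
        · exact (ik.const_mul _).add (integrable_const _)
        · filter_upwards [hN.ae_mem] with y hy using hpt y hy
    _ = δ / 2 * kmass O ε x + A := by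
        rw [integral_add (ik.const_mul _) (integrable_const _), integral_const_mul, integral_const,
          smul_eq_mul, kmass, hA, hs]
        ring
    _ ≤ δ / 2 * kmass O ε x + δ / 2 * kmass O ε x := by
        gcongr
        exact hεA.trans (mul_le_mul_of_nonneg_left (hm x hx ε hε hεε₀) (by positivity))
    _ = _ := by ring

theorem abs_kavg_sub_le (hne : (frontier O).Nonempty) {ε δ : ℝ} (hε : 0 < ε) {g : E3 → ℝ}
    (hg : Continuous g) {x : E3}
    (h : ∫ y, |g y - g x| * ker ε (x - y) ∂(areaMeasure O) ≤ δ * kmass O ε x) :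
    |kavg O ε g x - g x| ≤ δ := by
  have hm := hN.kmass_pos hne hε x
  have hk := continuous_ker_right hε x
  have h1 : kavg O ε g x - g x =
      (∫ y, (g y - g x) * ker ε (x - y) ∂(areaMeasure O)) * (kmass O ε x)⁻¹ := by
    have h2 : ∫ y, (g y - g x) * ker ε (x - y) ∂(areaMeasure O) =
        ∫ y, g y * ker ε (x - y) ∂(areaMeasure O) - g x * kmass O ε x := by
      rw [kmass, ← integral_const_mul, ← integral_sub]
      · simp only [sub_mul]
      · exact hN.integrable_of_continuous (hg.mul hk)
      · exact hN.integrable_of_continuous (continuous_const.mul hk)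
    rw [h2, kavg]
    field_simp
  rw [h1, abs_mul, abs_of_pos (inv_pos.2 hm), ← div_eq_mul_inv, div_le_iff₀ hm]
  refine le_trans (abs_integral_le_integral_abs) (le_trans (le_of_eq ?_) h)
  congr 1
  ext y
  rw [abs_mul, abs_of_pos (ker_pos hε _)]

theorem contDiff_kavg (hne : (frontier O).Nonempty) {ε : ℝ} (hε : 0 < ε) {g : E3 → ℝ}
    (hg : Continuous g) : ContDiff ℝ 1 (kavg O ε g) := by
  have h1 : ContDiff ℝ 1 (kmass O ε) := by
    rw [kmass_eq]; exact hN.contDiff_integral_ker hε continuous_const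
  exact (hN.contDiff_integral_ker hε hg).mul (h1.inv fun x => (hN.kmass_pos hne hε x).ne')

theorem fderiv_kavg (hne : (frontier O).Nonempty) {ε : ℝ} (hε : 0 < ε) {g : E3 → ℝ}
    (hg : Continuous g) (x v : E3) :
    fderiv ℝ (kavg O ε g) x v =
      (∫ y, g y * dker ε (x - y) v ∂(areaMeasure O) -
        kavg O ε g x * ∫ y, dker ε (x - y) v ∂(areaMeasure O)) * (kmass O ε x)⁻¹ := by
  have hm := (hN.kmass_pos hne hε x).ne'
  have h1 : HasFDerivAt (kmass O ε) (∫ y, (1 : ℝ) • dker ε (x - y) ∂(areaMeasure O)) x := by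
    rw [kmass_eq]; exact hN.hasFDerivAt_integral_ker hε continuous_const x
  have h2 := (hasDerivAt_inv hm).comp_hasFDerivAt x h1
  have h3 : HasFDerivAt (kavg O ε g) _ x := (hN.hasFDerivAt_integral_ker hε hg x).mul h2
  have e1 := hN.fderiv_integral_ker hε hg x v
  rw [(hN.hasFDerivAt_integral_ker hε hg x).fderiv] at e1
  have e2 := hN.fderiv_integral_ker hε (continuous_const (y := (1 : ℝ))) x v
  rw [(hN.hasFDerivAt_integral_ker hε continuous_const x).fderiv] at e2
  rw [h3.fderiv]
  simp only [add_apply, smul_apply, e1, e2, smul_eq_mul, one_mul, kavg]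
  field_simp
  ring

/-- The commutator estimate: the kernel average of a transported function is almost transported. -/
theorem abs_commutator_le (hne : (frontier O).Nonempty) {ε δ L : ℝ} (hε : 0 < ε) (hL : 0 ≤ L)
    {g : E3 → ℝ} (hg : Continuous g) {V : E3 → E3} (hV : ContDiff ℝ 1 V)
    (ht : ∀ x ∈ frontier O, ⟪N x, V x⟫ = 0) (hdiv : ∀ x ∈ frontier O, sdiv N V x = 0)
    {x : E3} (hVL : ∀ y ∈ frontier O, ‖V x - V y‖ ≤ L * ‖x - y‖)
    (h : ∫ y, |g y - g x| * ker ε (x - y) ∂(areaMeasure O) ≤ δ * kmass O ε x) :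
    |(∫ y, g y * -(dker ε (x - y) (V y)) ∂(areaMeasure O)) * (kmass O ε x)⁻¹ +
      fderiv ℝ (kavg O ε g) x (V x)| ≤ 8 * L * δ := by
  have hm := hN.kmass_pos hne hε x
  have hk := continuous_ker_right hε x
  have hd1 := continuous_dker_right hε x (continuous_const (y := V x))
  have hd2 := continuous_dker_right hε x hV.continuous
  have hη := hN.abs_kavg_sub_le hne hε hg h
  set η := kavg O ε g x with hη'
  -- as `V` is divergence free, `g` may be replaced by `g - η`, which is small near `x`
  have hzero : ∫ y, dker ε (x - y) (V y) ∂(areaMeasure O) = 0 := by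
    have h1 : ContDiff ℝ 1 fun y => ker ε (x - y) :=
      ((contDiff_ker hε).of_le (by simp)).comp (contDiff_const.sub contDiff_id)
    have h2 := hN.integral_fderiv_eq_zero hV ht hdiv h1
    have h3 : ∀ y, fderiv ℝ (fun y => ker ε (x - y)) y (V y) = -(dker ε (x - y) (V y)) := by
      intro y
      have h4 := (hasFDerivAt_ker hε (x - y)).comp y ((hasFDerivAt_id y).const_sub x)
      have h5 : HasFDerivAt (fun y => ker ε (x - y)) _ y := h4
      rw [h5.fderiv]
      simp
    simp only [h3] at h2
    rw [integral_neg, neg_eq_zero] at h2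
    exact h2
  have hsplit : ∫ y, (g y - η) * dker ε (x - y) (V x - V y) ∂(areaMeasure O) =
      (∫ y, g y * -(dker ε (x - y) (V y)) ∂(areaMeasure O)) +
        (∫ y, g y * dker ε (x - y) (V x) ∂(areaMeasure O) -
          η * ∫ y, dker ε (x - y) (V x) ∂(areaMeasure O)) := by
    have i1 : Integrable (fun y => g y * -(dker ε (x - y) (V y))) (areaMeasure O) :=
      hN.integrable_of_continuous (hg.mul hd2.neg)
    have i2 : Integrable (fun y => g y * dker ε (x - y) (V x)) (areaMeasure O) :=
      hN.integrable_of_continuous (hg.mul hd1)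
    have i3 : Integrable (fun y => η * dker ε (x - y) (V x)) (areaMeasure O) :=
      hN.integrable_of_continuous (continuous_const.mul hd1)
    have i4 : Integrable (fun y => η * dker ε (x - y) (V y)) (areaMeasure O) :=
      hN.integrable_of_continuous (continuous_const.mul hd2)
    have i5 : Integrable (fun y => g y * dker ε (x - y) (V x) - η * dker ε (x - y) (V x))
      (areaMeasure O) := i2.sub i3
    have i6 : Integrable (fun y => g y * dker ε (x - y) (V x) - η * dker ε (x - y) (V x) +
      η * dker ε (x - y) (V y)) (areaMeasure O) := i5.add i4
    have e : ∀ y, (g y - η) * dker ε (x - y) (V x - V y) = g y * -(dker ε (x - y) (V y)) +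
        ((g y * dker ε (x - y) (V x) - η * dker ε (x - y) (V x)) +
          η * dker ε (x - y) (V y)) := by
      intro y; rw [map_sub]; ring
    rw [integral_congr_ae (Filter.Eventually.of_forall e), integral_add i1 i6,
      integral_add i5 i4, integral_sub i2 i3, integral_const_mul, integral_const_mul,
      hzero, mul_zero, add_zero]
  rw [hN.fderiv_kavg hne hε hg, ← add_mul, ← hη', ← hsplit, abs_mul, abs_of_pos (inv_pos.2 hm),
    ← div_eq_mul_inv, div_le_iff₀ hm]
  have hδm : |η - g x| * kmass O ε x ≤ δ * kmass O ε x := mul_le_mul_of_nonneg_right hη hm.le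
  have j1 : Integrable (fun y => |g y - g x| * ker ε (x - y)) (areaMeasure O) :=
    hN.integrable_of_continuous ((hg.sub continuous_const).abs.mul hk)
  have j2 : Integrable (fun y => |η - g x| * ker ε (x - y)) (areaMeasure O) :=
    hN.integrable_of_continuous (continuous_const.mul hk)
  calc |∫ y, (g y - η) * dker ε (x - y) (V x - V y) ∂(areaMeasure O)|
      ≤ ∫ y, |(g y - η) * dker ε (x - y) (V x - V y)| ∂(areaMeasure O) :=
        abs_integral_le_integral_abs
    _ ≤ ∫ y, 4 * L * (|g y - g x| * ker ε (x - y) + |η - g x| * ker ε (x - y))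
          ∂(areaMeasure O) := by
        apply integral_mono_ae
        · exact hN.integrable_of_continuous ((hg.sub continuous_const).mul
            (continuous_dker_right hε x (continuous_const.sub hV.continuous))).abs
        · exact (j1.add j2).const_mul _
        · filter_upwards [hN.ae_mem] with y hy
          have h1 := abs_dker_le hε hL (hVL y hy)
          have h2 : |g y - η| ≤ |g y - g x| + |η - g x| := by
            have := abs_sub_le (g y) (g x) η
            rwa [abs_sub_comm (g x) η] at this
          rw [abs_mul]
          calc |g y - η| * |dker ε (x - y) (V x - V y)|
              ≤ (|g y - g x| + |η - g x|) * (4 * L * ker ε (x - y)) :=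
                mul_le_mul h2 h1 (abs_nonneg _) (by positivity)
            _ = _ := by ring
    _ = 4 * L * (∫ y, |g y - g x| * ker ε (x - y) ∂(areaMeasure O) +
          |η - g x| * kmass O ε x) := by
        rw [integral_const_mul, integral_add j1 j2, kmass, integral_const_mul]
    _ ≤ 4 * L * (δ * kmass O ε x + δ * kmass O ε x) := by gcongr
    _ = _ := by ring

end IsNormalField

/-! ### Conservation of the integrals of functions of a transported scalar -/

/-- The continuous scalar `ζ` is transported, in the weak sense and for times in `(0, τ)`, by the
divergence-free tangent fields `V t`, which are Lipschitz with constant `L` on `M`. -/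
structure IsTransported (O : Set E3) (N : E3 → E3) (τ L : ℝ) (V : ℝ → E3 → E3)
    (ζ : ℝ → E3 → ℝ) : Prop where
  continuous_field : Continuous fun p : ℝ × E3 => V p.1 p.2
  continuous_scalar : Continuous fun p : ℝ × E3 => ζ p.1 p.2
  contDiff : ∀ t ∈ Ioo 0 τ, ContDiff ℝ 1 (V t)
  tangent : ∀ t ∈ Ioo 0 τ, ∀ x ∈ frontier O, ⟪N x, V t x⟫ = 0
  div_free : ∀ t ∈ Ioo 0 τ, ∀ x ∈ frontier O, sdiv N (V t) x = 0
  lipschitz : ∀ t ∈ Ioo 0 τ, ∀ x ∈ frontier O, ∀ y ∈ frontier O,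
    ‖V t x - V t y‖ ≤ L * ‖x - y‖
  weak : ∀ φ : E3 → ℝ, ContDiff ℝ ∞ φ → ∀ t ∈ Ioo 0 τ,
    HasDerivAt (fun s => ∫ y, ζ s y * φ y ∂(areaMeasure O))
      (∫ y, ζ t y * fderiv ℝ φ y (V t y) ∂(areaMeasure O)) t

namespace IsTransported

variable {O : Set E3} {N : E3 → E3} {τ L : ℝ} {V : ℝ → E3 → E3} {ζ : ℝ → E3 → ℝ}
  (h : IsTransported O N τ L V ζ)
include h

theorem hasDerivAt_kavg {ε : ℝ} (hε : 0 < ε) {t : ℝ} (ht : t ∈ Ioo 0 τ) (x : E3) :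
    HasDerivAt (fun s => kavg O ε (ζ s) x)
      ((∫ y, ζ t y * -(dker ε (x - y) (V t y)) ∂(areaMeasure O)) * (kmass O ε x)⁻¹) t := by
  have h1 : ContDiff ℝ ∞ fun y => ker ε (x - y) :=
    (contDiff_ker hε).comp (contDiff_const.sub contDiff_id)
  have h2 := (h.weak _ h1 t ht).mul_const (kmass O ε x)⁻¹
  have h3 : ∀ y, fderiv ℝ (fun y => ker ε (x - y)) y (V t y) = -(dker ε (x - y) (V t y)) := by
    intro y
    have h4 := (hasFDerivAt_ker hε (x - y)).comp y ((hasFDerivAt_id y).const_sub x)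
    have h5 : HasFDerivAt (fun y => ker ε (x - y)) _ y := h4
    rw [h5.fderiv]
    simp
  simp only [h3] at h2
  exact h2

variable (hN : IsNormalField O N)
include hN

theorem continuous_kavg (hne : (frontier O).Nonempty) {ε : ℝ} (hε : 0 < ε) :
    Continuous fun p : ℝ × E3 => kavg O ε (ζ p.1) p.2 := by
  have h1 : Continuous fun p : ℝ × E3 => ∫ y, ζ p.1 y * ker ε (p.2 - y) ∂(areaMeasure O) := by
    apply hN.continuous_integral (f := fun (p : ℝ × E3) y => ζ p.1 y * ker ε (p.2 - y))
    exact (h.continuous_scalar.comp (by fun_prop : Continuous fun q : (ℝ × E3) × E3 =>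
      (q.1.1, q.2))).mul ((contDiff_ker hε).continuous.comp (by fun_prop))
  have h2 : Continuous (kmass O ε) := by
    rw [kmass_eq]; exact (hN.contDiff_integral_ker hε continuous_const).continuous
  exact h1.mul ((h2.comp continuous_snd).inv₀ fun p => (hN.kmass_pos hne hε p.2).ne')

theorem continuous_deriv_kavg (hne : (frontier O).Nonempty) {ε : ℝ} (hε : 0 < ε) :
    Continuous fun p : ℝ × E3 =>
      (∫ y, ζ p.1 y * -(dker ε (p.2 - y) (V p.1 y)) ∂(areaMeasure O)) * (kmass O ε p.2)⁻¹ := by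
  have c : Continuous fun q : (ℝ × E3) × E3 => (q.1.1, q.2) := by fun_prop
  have h1 : Continuous fun p : ℝ × E3 =>
      ∫ y, ζ p.1 y * -(dker ε (p.2 - y) (V p.1 y)) ∂(areaMeasure O) := by
    apply hN.continuous_integral
      (f := fun (p : ℝ × E3) y => ζ p.1 y * -(dker ε (p.2 - y) (V p.1 y)))
    refine (h.continuous_scalar.comp c).mul (Continuous.neg ?_)
    exact ((continuous_dker hε).comp (by fun_prop)).clm_apply (h.continuous_field.comp c)
  have h2 : Continuous (kmass O ε) := by
    rw [kmass_eq]; exact (hN.contDiff_integral_ker hε continuous_const).continuous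
  exact h1.mul ((h2.comp continuous_snd).inv₀ fun p => (hN.kmass_pos hne hε p.2).ne')

/-- The integral of a `C¹` function of a transported scalar is conserved. The scalar need not be
differentiable; its kernel averages are, and they are transported up to a uniformly small error. -/
theorem integral_comp_eq (hne : (frontier O).Nonempty) (hτ : 0 < τ) (hL : 0 ≤ L)
    {Φ ψ : ℝ → ℝ} (hψ : Continuous ψ) (hΦ : ∀ z, HasDerivAt Φ (ψ z) z) :
    ∫ x, Φ (ζ τ x) ∂(areaMeasure O) = ∫ x, Φ (ζ 0 x) ∂(areaMeasure O) := by
  have := hN.isFiniteMeasure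
  have hΦc : Continuous Φ := continuous_iff_continuousAt.2 fun z => (hΦ z).continuousAt
  have hΦ1 : ContDiff ℝ 1 Φ := contDiff_one_iff_deriv.2
    ⟨fun z => (hΦ z).differentiableAt, by
      rw [show deriv Φ = ψ from funext fun z => (hΦ z).deriv]; exact hψ⟩
  obtain ⟨B, hB⟩ := (isCompact_Icc.prod hN.isCompact).exists_bound_of_continuousOn
    (s := Icc 0 τ ×ˢ frontier O) h.continuous_scalar.continuousOn
  obtain ⟨D, hD⟩ := (isCompact_Icc (a := -(B + 1)) (b := B + 1)).exists_bound_of_continuousOn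
    hψ.continuousOn
  set s := (areaMeasure O).real univ with hs
  have hs0 : 0 ≤ s := measureReal_nonneg
  -- it is enough to bound the difference by a multiple of any small `δ`
  suffices hsuff : ∀ δ : ℝ, 0 < δ → δ ≤ 1 →
      |∫ x, Φ (ζ τ x) ∂(areaMeasure O) - ∫ x, Φ (ζ 0 x) ∂(areaMeasure O)| ≤
        |D| * s * (2 + 8 * L * τ) * δ by
    rw [← sub_eq_zero, ← abs_nonpos_iff]
    set A := |D| * s * (2 + 8 * L * τ) with hA
    have hA0 : 0 ≤ A := by positivity
    apply le_of_forall_pos_le_add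
    intro e he
    have h1 := hsuff (min 1 (e / (A + 1))) (lt_min one_pos (by positivity)) (min_le_left _ _)
    have h2 : A * min 1 (e / (A + 1)) ≤ e := by
      calc A * min 1 (e / (A + 1)) ≤ A * (e / (A + 1)) :=
            mul_le_mul_of_nonneg_left (min_le_right _ _) hA0
        _ = A / (A + 1) * e := by ring
        _ ≤ 1 * e := by
            gcongr
            rw [div_le_one (by positivity)]; linarith
        _ = e := one_mul e
    linarith
  intro δ hδ hδ1
  obtain ⟨ε, hε, hconc⟩ := hN.exists_concentration (τ := τ) h.continuous_scalar hδ
  have hζc : ∀ t, Continuous (ζ t) := fun t =>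
    h.continuous_scalar.comp (Continuous.prodMk_right t)
  have hclose : ∀ t ∈ Icc 0 τ, ∀ x ∈ frontier O, |kavg O ε (ζ t) x - ζ t x| ≤ δ :=
    fun t ht x hx => hN.abs_kavg_sub_le hne hε (hζc t) (hconc t ht x hx)
  have hmem : ∀ t ∈ Icc 0 τ, ∀ x ∈ frontier O, ζ t x ∈ Icc (-(B + 1)) (B + 1) ∧
      kavg O ε (ζ t) x ∈ Icc (-(B + 1)) (B + 1) := by
    intro t ht x hx
    have h1 := hB (t, x) ⟨ht, hx⟩
    have h2 := hclose t ht x hx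
    rw [Real.norm_eq_abs] at h1
    rw [abs_le] at h1 h2
    simp only at h1
    constructor <;> constructor <;> linarith
  have hψb : ∀ z ∈ Icc (-(B + 1)) (B + 1), |ψ z| ≤ |D| := fun z hz =>
    (hD z hz).trans (le_abs_self D)
  have hηc := h.continuous_kavg hN hne hε
  have hηtc := h.continuous_deriv_kavg hN hne hε
  -- the integral of `Φ` of the averaged scalar
  let E : ℝ → ℝ := fun t => ∫ x, Φ (kavg O ε (ζ t) x) ∂(areaMeasure O)
  have hEc : Continuous E := hN.continuous_integral (f := fun t x => Φ (kavg O ε (ζ t) x))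
    (hΦc.comp hηc)
  have hEclose : ∀ t ∈ Icc 0 τ, |E t - ∫ x, Φ (ζ t x) ∂(areaMeasure O)| ≤ |D| * δ * s := by
    intro t ht
    have i1 : Integrable (fun x => Φ (kavg O ε (ζ t) x)) (areaMeasure O) :=
      hN.integrable_of_continuous (hΦc.comp (hηc.comp (Continuous.prodMk_right t)))
    have i2 : Integrable (fun x => Φ (ζ t x)) (areaMeasure O) :=
      hN.integrable_of_continuous (hΦc.comp (hζc t))
    rw [← integral_sub i1 i2, ← Real.norm_eq_abs]
    apply norm_integral_le_of_norm_le_const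
    filter_upwards [hN.ae_mem] with x hx
    obtain ⟨m1, m2⟩ := hmem t ht x hx
    have h1 := (convex_Icc (-(B + 1)) (B + 1)).norm_image_sub_le_of_norm_hasDerivWithin_le
      (fun z _ => (hΦ z).hasDerivWithinAt) hψb m1 m2
    exact h1.trans (mul_le_mul_of_nonneg_left (hclose t ht x hx) (abs_nonneg D))
  let E' : ℝ → ℝ := fun t => ∫ x, ψ (kavg O ε (ζ t) x) *
    ((∫ y, ζ t y * -(dker ε (x - y) (V t y)) ∂(areaMeasure O)) * (kmass O ε x)⁻¹) ∂(areaMeasure O)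
  have hE' : ∀ t ∈ Ioo 0 τ, HasDerivAt E (E' t) t := by
    intro t ht
    refine hN.hasDerivAt_integral (f := fun t x => Φ (kavg O ε (ζ t) x))
      (f' := fun t x => ψ (kavg O ε (ζ t) x) *
        ((∫ y, ζ t y * -(dker ε (x - y) (V t y)) ∂(areaMeasure O)) * (kmass O ε x)⁻¹))
      isOpen_Ioo (fun t _ => ?_) ?_ (fun t ht x _ => ?_) ht
    · exact (hΦc.comp (hηc.comp (Continuous.prodMk_right t))).continuousOn
    · exact ((hψ.comp hηc).mul hηtc).continuousOn
    · exact (hΦ _).comp t (h.hasDerivAt_kavg hε ht x)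
  have hE'b : ∀ t ∈ Ioo 0 τ, |E' t| ≤ |D| * (8 * L * δ) * s := by
    intro t ht
    have ht' : t ∈ Icc 0 τ := Ioo_subset_Icc_self ht
    have hV1 := h.contDiff t ht
    have hη1 := hN.contDiff_kavg hne hε (hζc t)
    -- adding the integral of `V · ∇Φ(η)`, which vanishes, turns `E'` into a commutator
    have h0 := hN.integral_fderiv_eq_zero hV1 (h.tangent t ht) (h.div_free t ht) (hΦ1.comp hη1)
    have h1 : ∀ x, fderiv ℝ (Φ ∘ kavg O ε (ζ t)) x (V t x) =
        ψ (kavg O ε (ζ t) x) * fderiv ℝ (kavg O ε (ζ t)) x (V t x) := by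
      intro x
      rw [((hΦ _).comp_hasFDerivAt x (hη1.differentiable one_ne_zero x).hasFDerivAt).fderiv]
      simp
    simp only [h1] at h0
    have c1 : Continuous fun x => ψ (kavg O ε (ζ t) x) := hψ.comp hη1.continuous
    have i1 : Integrable (fun x => ψ (kavg O ε (ζ t) x) *
        ((∫ y, ζ t y * -(dker ε (x - y) (V t y)) ∂(areaMeasure O)) * (kmass O ε x)⁻¹))
        (areaMeasure O) :=
      hN.integrable_of_continuous (c1.mul (hηtc.comp (Continuous.prodMk_right t)))
    have i2 : Integrable (fun x => ψ (kavg O ε (ζ t) x) *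
        fderiv ℝ (kavg O ε (ζ t)) x (V t x)) (areaMeasure O) :=
      hN.integrable_of_continuous (c1.mul
        ((hη1.continuous_fderiv one_ne_zero).clm_apply hV1.continuous))
    have h2 : E' t = ∫ x, (ψ (kavg O ε (ζ t) x) *
        ((∫ y, ζ t y * -(dker ε (x - y) (V t y)) ∂(areaMeasure O)) * (kmass O ε x)⁻¹) +
        ψ (kavg O ε (ζ t) x) * fderiv ℝ (kavg O ε (ζ t)) x (V t x)) ∂(areaMeasure O) := by
      rw [integral_add i1 i2, h0, add_zero]
    rw [h2, ← Real.norm_eq_abs]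
    apply norm_integral_le_of_norm_le_const
    filter_upwards [hN.ae_mem] with x hx
    rw [← mul_add, norm_mul]
    exact mul_le_mul (hψb _ (hmem t ht' x hx).2) (hN.abs_commutator_le hne hε hL (hζc t) hV1
      (h.tangent t ht) (h.div_free t ht) (h.lipschitz t ht x hx) (hconc t ht' x hx))
      (norm_nonneg _) (abs_nonneg _)
  obtain ⟨c, hc, hcE⟩ := exists_hasDerivAt_eq_slope E E' hτ hEc.continuousOn hE'
  have h1 := hE'b c hc
  rw [hcE, sub_zero, abs_div, abs_of_pos hτ, div_le_iff₀ hτ] at h1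
  have h2 := hEclose τ (right_mem_Icc.2 hτ.le)
  have h3 := hEclose 0 (left_mem_Icc.2 hτ.le)
  rw [abs_le] at h1 h2 h3 ⊢
  constructor <;> nlinarith

end IsTransported

/-! ### The vorticity equation -/

/-- `V` is a `C¹` extension to `ℝ³`, with compact support in space, of the time-dependent field `u`
on the surface. -/
structure IsFlowExtension (O : Set E3) (T : ℝ) (u V : ℝ → E3 → E3) : Prop where
  contDiffOn : ContDiffOn ℝ 1 (fun z : ℝ × E3 => V z.1 z.2) (Ico 0 T ×ˢ univ)
  eq : ∀ t, ∀ x ∈ frontier O, V t x = u t x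
  exists_compact : ∃ C : Set E3, IsCompact C ∧ ∀ t, ∀ x ∉ C, V t x = 0

theorem IsNormalField.exists_flowExtension {O : Set E3} {N : E3 → E3} (hN : IsNormalField O N)
    {Ω T : ℝ} {u : ℝ → E3 → E3} (hu : IsEulerSolution O Ω (Ico 0 T) u) :
    ∃ V, IsFlowExtension O T u V := by
  obtain ⟨V, h1, h2, C, hC, h3⟩ := exists_extension_time hN.smooth_boundary hN.isCompact
    (by simp) hu.regular
  exact ⟨V, h1, h2, C, hC, h3⟩

namespace IsFlowExtension

variable {O : Set E3} {T : ℝ} {u V : ℝ → E3 → E3} (h : IsFlowExtension O T u V)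
include h

theorem hasFDerivWithinAt {t : ℝ} (ht : t ∈ Ico 0 T) (x : E3) :
    HasFDerivWithinAt (fun z : ℝ × E3 => V z.1 z.2)
      (fderivWithin ℝ (fun z : ℝ × E3 => V z.1 z.2) (Ico 0 T ×ˢ univ) (t, x))
      (Ico 0 T ×ˢ univ) (t, x) :=
  ((h.contDiffOn.differentiableOn one_ne_zero) (t, x) ⟨ht, mem_univ x⟩).hasFDerivWithinAt

theorem hasFDerivAt {t : ℝ} (ht : t ∈ Ico 0 T) (x : E3) :
    HasFDerivAt (V t) ((fderivWithin ℝ (fun z : ℝ × E3 => V z.1 z.2) (Ico 0 T ×ˢ univ) (t, x)) ∘L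
      ContinuousLinearMap.inr ℝ ℝ E3) x := by
  have h1 := (h.hasFDerivWithinAt ht x).comp x
    (hasFDerivAt_prodMk_right t x).hasFDerivWithinAt (s := univ) (fun y _ => ⟨ht, mem_univ y⟩)
  rw [hasFDerivWithinAt_univ] at h1
  exact h1

theorem hasDerivWithinAt {t : ℝ} (ht : t ∈ Ico 0 T) (x : E3) :
    HasDerivWithinAt (fun s => V s x)
      (fderivWithin ℝ (fun z : ℝ × E3 => V z.1 z.2) (Ico 0 T ×ˢ univ) (t, x) (1, 0))
      (Ico 0 T) t := by
  have h2 : HasDerivWithinAt (fun s : ℝ => (s, x)) ((1 : ℝ), (0 : E3)) (Ico 0 T) t :=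
    ((hasDerivAt_id t).prodMk (hasDerivAt_const t x)).hasDerivWithinAt
  have hm : MapsTo (fun s : ℝ => (s, x)) (Ico 0 T) (Ico 0 T ×ˢ univ) :=
    fun s hs => ⟨hs, mem_univ x⟩
  exact (h.hasFDerivWithinAt ht x).comp_hasDerivWithinAt t h2 hm

theorem contDiff {t : ℝ} (ht : t ∈ Ico 0 T) : ContDiff ℝ 1 (V t) := by
  rw [← contDiffOn_univ]
  have h1 : ContDiffOn ℝ 1 (fun y : E3 => (t, y)) univ :=
    (contDiff_const.prodMk contDiff_id).contDiffOn
  exact h.contDiffOn.comp h1 (fun y _ => ⟨ht, mem_univ y⟩)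

theorem hasCompactSupport (t : ℝ) : HasCompactSupport (V t) := by
  obtain ⟨C, hC, h0⟩ := h.exists_compact
  exact HasCompactSupport.intro hC (h0 t)

theorem continuousOn_fderivWithin : ContinuousOn
    (fderivWithin ℝ (fun z : ℝ × E3 => V z.1 z.2) (Ico 0 T ×ˢ univ)) (Ico 0 T ×ˢ univ) :=
  h.contDiffOn.continuousOn_fderivWithin ((uniqueDiffOn_Ico 0 T).prod uniqueDiffOn_univ) le_rfl

theorem continuousOn_fderiv :
    ContinuousOn (fun z : ℝ × E3 => fderiv ℝ (V z.1) z.2) (Ico 0 T ×ˢ univ) := by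
  have h1 : ContinuousOn (fun z : ℝ × E3 =>
      (fderivWithin ℝ (fun z : ℝ × E3 => V z.1 z.2) (Ico 0 T ×ˢ univ) z) ∘L
      ContinuousLinearMap.inr ℝ ℝ E3) (Ico 0 T ×ˢ univ) :=
    (h.continuousOn_fderivWithin).clm_comp continuousOn_const
  exact h1.congr fun z hz => (h.hasFDerivAt hz.1 z.2).fderiv

/-- The fields are Lipschitz, uniformly on compact time intervals. -/
theorem exists_lipschitz {τ : ℝ} (hτT : τ < T) :
    ∃ L, 0 ≤ L ∧ ∀ t ∈ Icc 0 τ, ∀ x y, ‖V t x - V t y‖ ≤ L * ‖x - y‖ := by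
  obtain ⟨C, hC, h0⟩ := h.exists_compact
  have hsub : Icc 0 τ ⊆ Ico 0 T := fun t ht => ⟨ht.1, ht.2.trans_lt hτT⟩
  obtain ⟨L, hL⟩ := (isCompact_Icc.prod hC).exists_bound_of_continuousOn (s := Icc 0 τ ×ˢ C)
    (h.continuousOn_fderiv.mono (prod_mono hsub (subset_univ C)))
  refine ⟨|L|, abs_nonneg L, fun t ht x y => ?_⟩
  refine convex_univ.norm_image_sub_le_of_norm_fderiv_le (𝕜 := ℝ) (f := V t)
    (fun z _ => (h.hasFDerivAt (hsub ht) z).differentiableAt) (fun z _ => ?_)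
    (mem_univ y) (mem_univ x)
  by_cases hz : z ∈ C
  · exact (hL (t, z) ⟨ht, hz⟩).trans (le_abs_self L)
  · have h1 : V t =ᶠ[nhds z] fun _ => 0 := by
      filter_upwards [hC.isClosed.isOpen_compl.mem_nhds hz] with w hw using h0 t w hw
    rw [h1.fderiv_eq]
    simp

end IsFlowExtension

namespace IsNormalField

variable {O : Set E3} {N : E3 → E3} (hN : IsNormalField O N)
include hN

theorem srot_eq_fderiv {X : E3 → E3} {x : E3} (hX : DifferentiableAt ℝ X x) :
    srot N X x = - trT (N x) (crossL.precompR E3 (N x) (fderiv ℝ X x) +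
      crossL.precompL E3 (fderiv ℝ N x) (X x)) := by
  have hd := crossL.hasFDerivAt_of_bilinear (hN.differentiableAt x).hasFDerivAt hX.hasFDerivAt
  rw [srot, sdiv, hd.fderiv]

/-- Integration by parts for the scalar curl. -/
theorem integral_srot_mul {X : E3 → E3} {φ : E3 → ℝ} (hX : ContDiff ℝ 1 X) (hφ : ContDiff ℝ 1 φ) :
    ∫ x, srot N X x * φ x ∂(areaMeasure O) =
      ∫ x, fderiv ℝ φ x (crossL (N x) (X x)) ∂(areaMeasure O) := by
  have hY := hN.contDiff_cross hX (by simp)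
  have hYt : ∀ x ∈ frontier O, ⟪N x, crossL (N x) (X x)⟫ = 0 := fun x _ => inner_crossL_left _ _
  have hφY : ContDiff ℝ 1 fun x => φ x • crossL (N x) (X x) := hφ.smul hY
  have h0 := hN.integral_sdiv_eq_zero hφY
    (fun x hx => by rw [real_inner_smul_right, hYt x hx, mul_zero])
  have h1 : ∀ x ∈ frontier O, sdiv N (fun x => φ x • crossL (N x) (X x)) x =
      fderiv ℝ φ x (crossL (N x) (X x)) - srot N X x * φ x := by
    intro x hx
    rw [hN.sdiv_smul hx (hφ.differentiable one_ne_zero x) (hY.differentiable one_ne_zero x)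
      (hYt x hx), srot]
    ring
  rw [hN.integral_congr h1, integral_sub] at h0
  · linarith
  · exact hN.integrable_of_continuous ((hφ.continuous_fderiv one_ne_zero).clm_apply hY.continuous)
  · exact hN.integrable_of_continuous ((hN.continuous_srot hX).mul hφ.continuous)

end IsNormalField

namespace IsFlowExtension

variable {O : Set E3} {T : ℝ} {u V : ℝ → E3 → E3} (h : IsFlowExtension O T u V)
  {N : E3 → E3} (hN : IsNormalField O N) {Ω : ℝ} (hu : IsEulerSolution O Ω (Ico 0 T) u)
include h hN

theorem continuousOn_srot :
    ContinuousOn (fun z : ℝ × E3 => srot N (V z.1) z.2) (Ico 0 T ×ˢ univ) := by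
  have c1 : Continuous fun z : ℝ × E3 => N z.2 := hN.smooth.continuous.comp continuous_snd
  have c2 : Continuous fun z : ℝ × E3 => fderiv ℝ N z.2 :=
    hN.continuous_fderiv_normal.comp continuous_snd
  have c3 := h.continuousOn_fderiv
  have c4 := h.contDiffOn.continuousOn
  have c5 : ContinuousOn (fun z : ℝ × E3 => crossL.precompR E3 (N z.2) (fderiv ℝ (V z.1) z.2) +
      crossL.precompL E3 (fderiv ℝ N z.2) (V z.1 z.2)) (Ico 0 T ×ˢ univ) :=
    (((crossL.precompR E3).continuous.comp c1).continuousOn.clm_apply c3).add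
      (((crossL.precompL E3).continuous.comp c2).continuousOn.clm_apply c4)
  have c6 : ContinuousOn (fun z : ℝ × E3 => -trT (N z.2)
      (crossL.precompR E3 (N z.2) (fderiv ℝ (V z.1) z.2) +
        crossL.precompL E3 (fderiv ℝ N z.2) (V z.1 z.2))) (Ico 0 T ×ˢ univ) := by
    refine ContinuousOn.neg ?_
    exact (traceL.continuous.comp_continuousOn c5).sub
      (c1.continuousOn.inner (c5.clm_apply c1.continuousOn))
  exact c6.congr fun z hz => hN.srot_eq_fderiv (h.hasFDerivAt hz.1 z.2).differentiableAt

include hu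

theorem tangent {t : ℝ} (ht : t ∈ Ico 0 T) : ∀ x ∈ frontier O, ⟪N x, V t x⟫ = 0 := by
  intro x hx
  rw [h.eq t x hx]
  exact (hN.mem_tangentPlane hx).1 (hu.tangent t ht x hx)

theorem div_free {t : ℝ} (ht : t ∈ Ico 0 T) : ∀ x ∈ frontier O, sdiv N (V t) x = 0 := by
  intro x hx
  rw [← hu.div_free t ht x hx]
  exact (hN.surfaceDiv_eq hx (h.hasFDerivAt ht x).differentiableAt (h.eq t)).symm

/-- The Euler equation tested against the divergence-free field `J ∇φ`. -/
theorem integral_time_derivative {t : ℝ} (ht : t ∈ Ioo 0 T) {φ : E3 → ℝ} (hφ : ContDiff ℝ ∞ φ) :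
    ∫ x, fderiv ℝ φ x (crossL (N x) (fderivWithin ℝ (fun z : ℝ × E3 => V z.1 z.2)
        (Ico 0 T ×ˢ univ) (t, x) (1, 0))) ∂(areaMeasure O) =
      ∫ x, (srot N (V t) x - Ω * N x 2) * fderiv ℝ φ x (V t x) ∂(areaMeasure O) := by
  have ht' : t ∈ Ico 0 T := Ioo_subset_Ico_self ht
  obtain ⟨p, hp, heq⟩ := hu.equation
  obtain ⟨P, hP, -, hPp⟩ := exists_extension hN.smooth_boundary hN.isCompact (by simp) (hp t ht')
  have hV := h.contDiff ht'
  have hVd : ∀ x, DifferentiableAt ℝ (V t) x := fun x => hV.differentiable one_ne_zero x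
  have hW : ContDiff ℝ 1 fun x => crossL (N x) (gradient φ x) :=
    hN.contDiff_cross (contDiff_gradient hφ (by rw [one_add_one_eq_two]; exact two_le_infty))
      (by simp)
  have hWt : ∀ x ∈ frontier O, ⟪N x, crossL (N x) (gradient φ x)⟫ = 0 :=
    fun x _ => inner_crossL_left _ _
  have hQ : ContDiff ℝ 1 fun x => P x + ⟪V t x, V t x⟫ / 2 := hP.add ((hV.inner ℝ hV).div_const 2)
  have h0 := hN.integral_fderiv_eq_zero hW hWt
    (fun x hx => hN.sdiv_cross_gradient hx (hφ.of_le two_le_infty)) hQ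
  have hfd : Continuous (fderiv ℝ φ) := hφ.continuous_fderiv (by simp)
  have hpt : ∀ x ∈ frontier O, fderiv ℝ φ x (crossL (N x)
      (fderivWithin ℝ (fun z : ℝ × E3 => V z.1 z.2) (Ico 0 T ×ˢ univ) (t, x) (1, 0))) =
      (srot N (V t) x - Ω * N x 2) * fderiv ℝ φ x (V t x) +
        fderiv ℝ (fun x => P x + ⟪V t x, V t x⟫ / 2) x (crossL (N x) (gradient φ x)) := by
    intro x hx
    set W := crossL (N x) (gradient φ x) with hWdef
    have hVx := h.tangent hN hu ht' x hx
    have hder : derivWithin (fun s => u s x) (Ico 0 T) t =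
        fderivWithin ℝ (fun z : ℝ × E3 => V z.1 z.2) (Ico 0 T ×ˢ univ) (t, x) (1, 0) := by
      rw [← (h.hasDerivWithinAt ht' x).derivWithin (uniqueDiffOn_Ico 0 T t ht')]
      congr 1
      ext1 s
      exact (h.eq s x hx).symm
    have e := heq t ht' x hx
    rw [hder, ← h.eq t x hx, hN.covDerivAlong_eq hx (hVd x) (h.eq t) hVx, rotJ_eq,
      ← hN.eq x hx, chi, ← hN.eq x hx,
      hN.surfaceGradient_eq hx (hP.differentiable one_ne_zero x) hPp] at e
    have e1 := congrArg (fun v => ⟪W, v⟫) e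
    simp only [inner_add_right, inner_sub_right, real_inner_smul_right] at e1
    have hWn : ⟪W, N x⟫ = 0 := by rw [real_inner_comm]; exact hWt x hx
    rw [inner_projT_of_inner hWn, sgrad, inner_projT_of_inner hWn, real_inner_comm (fderiv ℝ (V t) x (V t x)),
      hN.inner_advection hx (hVd x) hVx (hWt x hx), real_inner_comm (gradient P x), inner_gradient] at e1
    have e2 : ⟪crossL (N x) (V t x), W⟫ = fderiv ℝ φ x (V t x) := by
      rw [hWdef, inner_crossL_crossL, hN.inner_self hx, real_inner_comm (N x) (V t x), hVx,
        ← inner_gradient, real_inner_comm]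
      ring
    have e3 : fderiv ℝ (fun x => P x + ⟪V t x, V t x⟫ / 2) x W =
        fderiv ℝ P x W + ⟪fderiv ℝ (V t) x W, V t x⟫ := by
      have d1 := ((hVd x).hasFDerivAt.inner ℝ (hVd x).hasFDerivAt).mul_const (2⁻¹ : ℝ)
      have d2 : HasFDerivAt (fun x => P x + ⟪V t x, V t x⟫ * 2⁻¹) _ x :=
        (hP.differentiable one_ne_zero x).hasFDerivAt.add d1
      simp only [div_eq_mul_inv]
      rw [d2.fderiv]
      simp [fderivInnerCLM_apply, real_inner_comm (V t x)]
      ring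
    rw [← inner_gradient, real_inner_comm, inner_crossL_triple, ← hWdef,
      real_inner_comm W, e3]
    rw [real_inner_comm (crossL (N x) (V t x)) W, e2] at e1
    linarith
  rw [hN.integral_congr hpt, integral_add, h0, add_zero]
  · exact hN.integrable_of_continuous (((hN.continuous_srot hV).sub
      (continuous_const.mul ((EuclideanSpace.proj (𝕜 := ℝ) (2 : Fin 3)).continuous.comp
        hN.smooth.continuous))).mul (hfd.clm_apply hV.continuous))
  · exact hN.integrable_of_continuous
      ((hQ.continuous_fderiv one_ne_zero).clm_apply hW.continuous)

end IsFlowExtension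

/-! ### Conservation laws of the Euler equation -/

/-- Truncation of times to `[0, τ]`. -/
def clampTime (τ t : ℝ) : ℝ := max 0 (min τ t)

theorem continuous_clampTime (τ : ℝ) : Continuous (clampTime τ) :=
  continuous_const.max (continuous_const.min continuous_id)

theorem clampTime_mem {τ : ℝ} (hτ : 0 ≤ τ) (t : ℝ) : clampTime τ t ∈ Icc 0 τ :=
  ⟨le_max_left _ _, max_le hτ (min_le_left _ _)⟩

theorem clampTime_eq {τ t : ℝ} (ht : t ∈ Icc 0 τ) : clampTime τ t = t := by
  rw [clampTime, min_eq_right ht.2, max_eq_right ht.1]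

namespace IsFlowExtension

variable {O : Set E3} {T : ℝ} {u V : ℝ → E3 → E3} (h : IsFlowExtension O T u V)
  {N : E3 → E3} (hN : IsNormalField O N) {Ω : ℝ} (hu : IsEulerSolution O Ω (Ico 0 T) u)
include h hN hu

/-- The absolute vorticity is transported by the flow. -/
theorem exists_isTransported {τ : ℝ} (hτ : 0 ≤ τ) (hτT : τ < T) :
    ∃ L, 0 ≤ L ∧ IsTransported O N τ L (fun t => V (clampTime τ t))
      (fun t x => srot N (V (clampTime τ t)) x - Ω * N x 2) := by
  obtain ⟨L, hL, hLip⟩ := h.exists_lipschitz hτT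
  have hsub : Icc 0 τ ⊆ Ico 0 T := fun t ht => ⟨ht.1, ht.2.trans_lt hτT⟩
  have hcl : Continuous fun z : ℝ × E3 => (clampTime τ z.1, z.2) :=
    ((continuous_clampTime τ).comp continuous_fst).prodMk continuous_snd
  have hmaps : ∀ z : ℝ × E3, (clampTime τ z.1, z.2) ∈ Ico 0 T ×ˢ (univ : Set E3) :=
    fun z => ⟨hsub (clampTime_mem hτ z.1), mem_univ _⟩
  have hN2 : Continuous fun x => N x 2 :=
    (EuclideanSpace.proj (𝕜 := ℝ) (2 : Fin 3)).continuous.comp hN.smooth.continuous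
  have hIcc : ∀ t ∈ Ioo 0 τ, t ∈ Icc 0 τ := fun t ht => Ioo_subset_Icc_self ht
  refine ⟨L, hL, ⟨h.contDiffOn.continuousOn.comp_continuous hcl hmaps,
    ((h.continuousOn_srot hN).comp_continuous hcl hmaps).sub
      (continuous_const.mul (hN2.comp continuous_snd)), fun t ht => ?_, fun t ht => ?_,
    fun t ht => ?_, fun t ht x _ y _ => ?_, fun φ hφ t ht => ?_⟩⟩
  · exact h.contDiff (hsub (clampTime_mem hτ t))
  · exact h.tangent hN hu (hsub (clampTime_mem hτ t))
  · exact h.div_free hN hu (hsub (clampTime_mem hτ t))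
  · exact hLip _ (clampTime_mem hτ t) x y
  · have hfd : Continuous (fderiv ℝ φ) := hφ.continuous_fderiv (by simp)
    have htT : t ∈ Ioo 0 T := ⟨ht.1, ht.2.trans hτT⟩
    have hφ1 : ContDiff ℝ 1 φ := hφ.of_le (by simp)
    -- the derivative of the integral written in terms of the velocity
    have h1 : HasDerivAt (fun s => ∫ x, fderiv ℝ φ x (crossL (N x) (V s x)) ∂(areaMeasure O))
        (∫ x, (srot N (V t) x - Ω * N x 2) * fderiv ℝ φ x (V t x) ∂(areaMeasure O)) t := by
      rw [← h.integral_time_derivative hN hu htT hφ]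
      refine hN.hasDerivAt_integral (f := fun s x => fderiv ℝ φ x (crossL (N x) (V s x)))
        (f' := fun s x => fderiv ℝ φ x (crossL (N x)
          (fderivWithin ℝ (fun z : ℝ × E3 => V z.1 z.2) (Ico 0 T ×ˢ univ) (s, x) (1, 0))))
        isOpen_Ioo (fun s hs => ?_) ?_ (fun s hs x _ => ?_) htT
      · exact (hfd.clm_apply (hN.contDiff_cross (h.contDiff (Ioo_subset_Ico_self hs))
          (by simp)).continuous).continuousOn
      · have c1 := (h.continuousOn_fderivWithin.mono (prod_mono Ioo_subset_Ico_self
          (subset_univ (frontier O)))).clm_apply (continuousOn_const (c := ((1 : ℝ), (0 : E3))))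
        exact (hfd.comp continuous_snd).continuousOn.clm_apply
          ((crossL.continuous.comp (hN.smooth.continuous.comp
            continuous_snd)).continuousOn.clm_apply c1)
      · have d1 := (h.hasDerivWithinAt (Ioo_subset_Ico_self hs) x).hasDerivAt
          (Ico_mem_nhds hs.1 hs.2)
        exact ((fderiv ℝ φ x).comp (crossL (N x))).hasFDerivAt.comp_hasDerivAt s d1
    have h2 := h1.sub_const (∫ x, Ω * N x 2 * φ x ∂(areaMeasure O))
    have ht1 : clampTime τ t = t := clampTime_eq (hIcc t ht)
    simp only [ht1]
    refine h2.congr_of_eventuallyEq ?_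
    filter_upwards [Ioo_mem_nhds ht.1 ht.2] with s hs
    have hVs := h.contDiff (hsub (hIcc s hs))
    rw [clampTime_eq (hIcc s hs), ← hN.integral_srot_mul hVs hφ1, ← integral_sub]
    · simp only [sub_mul]
    · exact hN.integrable_of_continuous ((hN.continuous_srot hVs).mul hφ.continuous)
    · exact hN.integrable_of_continuous ((continuous_const.mul hN2).mul hφ.continuous)

/-- The Casimir functionals `∫ Φ(ζ)` of the absolute vorticity `ζ` are conserved. -/
theorem integral_casimir_eq (hne : (frontier O).Nonempty) {t : ℝ} (ht : t ∈ Ico 0 T)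
    {Φ ψ : ℝ → ℝ} (hψ : Continuous ψ) (hΦ : ∀ z, HasDerivAt Φ (ψ z) z) :
    ∫ x, Φ (srot N (V t) x - Ω * N x 2) ∂(areaMeasure O) =
      ∫ x, Φ (srot N (V 0) x - Ω * N x 2) ∂(areaMeasure O) := by
  rcases ht.1.eq_or_lt with h0 | h0
  · rw [← h0]
  · obtain ⟨L, hL, htr⟩ := h.exists_isTransported hN hu ht.1 ht.2
    have h1 := htr.integral_comp_eq hN hne h0 hL hψ hΦ
    simpa only [clampTime_eq (right_mem_Icc.2 ht.1), clampTime_eq (left_mem_Icc.2 ht.1)] using h1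

end IsFlowExtension

theorem inner_X3_rotation_zero (v : E3) : ⟪v, crossL (EuclideanSpace.single 2 1) v⟫ = 0 :=
  inner_crossL_right _ _

theorem fderiv_X3 (x : E3) : fderiv ℝ X3 x = crossL (EuclideanSpace.single 2 1) := by
  have : X3 = fun x => crossL (EuclideanSpace.single 2 1) x := funext X3_eq_crossL
  rw [this]
  exact (crossL (EuclideanSpace.single 2 1)).fderiv

/-- The algebra behind `χ ∇ξ = -∇(|X₃|²/2)`: if `X₃(x)` and `v` are orthogonal to the unit vector `n`
then `(e₃ · n) ⟨n × X₃(x), v⟩ = -(x₀ v₀ + x₁ v₁)`. -/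
theorem chi_mul_inner_cross_X3 {n x v : E3} (hn : ⟪n, n⟫ = 1) (hX : ⟪n, X3 x⟫ = 0)
    (hv : ⟪n, v⟫ = 0) : n 2 * ⟪crossL n (X3 x), v⟫ = -(x 0 * v 0 + x 1 * v 1) := by
  rw [PiLp.inner_apply, Fin.sum_univ_three] at hn
  simp only [RCLike.inner_apply, conj_trivial] at hn
  simp [PiLp.inner_apply, Fin.sum_univ_three, X3] at hX hv
  simp [crossL_apply, PiLp.inner_apply, Fin.sum_univ_three, cross_apply, X3]
  linear_combination (n 0 * x 0 + n 1 * x 1) * hv + (n 1 * v 0 - n 0 * v 1) * hX -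
    (x 0 * v 0 + x 1 * v 1) * hn

namespace IsNormalField

variable {O : Set E3} {N : E3 → E3} (hN : IsNormalField O N)
include hN

/-- The pairing of the absolute vorticity with `u · ∇ξ` vanishes: the rotations are symmetries. -/
theorem integral_vorticity_mul_fderiv_potential {Ξ : E3 → ℝ}
    (hΞX : ∀ x ∈ frontier O, crossL (N x) (sgrad N Ξ x) = -X3 x) {Ω : ℝ} {V : E3 → E3}
    (hV : ContDiff ℝ 1 V) (ht : ∀ x ∈ frontier O, ⟪N x, V x⟫ = 0)
    (hdiv : ∀ x ∈ frontier O, sdiv N V x = 0) :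
    ∫ x, (srot N V x - Ω * N x 2) * fderiv ℝ Ξ x (V x) ∂(areaMeasure O) = 0 := by
  have hVd : ∀ x, DifferentiableAt ℝ V x := fun x => hV.differentiable one_ne_zero x
  have hX1 : ContDiff ℝ 1 X3 := contDiff_X3.of_le (by simp)
  have hXt : ∀ x ∈ frontier O, ⟪N x, X3 x⟫ = 0 := fun x hx => inner_X3_eq_zero hΞX hx
  have hXdiv : ∀ x ∈ frontier O, sdiv N X3 x = 0 := by
    intro x hx
    obtain ⟨e₁, e₂, hf⟩ := hN.exists_frame hx
    rw [sdiv, fderiv_X3, hf.trT_eq, inner_X3_rotation_zero, inner_X3_rotation_zero, add_zero]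
  have hN2 : Continuous fun x => N x 2 :=
    (EuclideanSpace.proj (𝕜 := ℝ) (2 : Fin 3)).continuous.comp hN.smooth.continuous
  have g1 : ContDiff ℝ 1 fun x => ⟪V x, X3 x⟫ := hV.inner ℝ hX1
  have g2 : ContDiff ℝ 1 fun x => ⟪V x, V x⟫ * 2⁻¹ := (hV.inner ℝ hV).mul contDiff_const
  have g3 : ContDiff ℝ 1 fun x : E3 => (x 0 ^ 2 + x 1 ^ 2) * 2⁻¹ * Ω := by fun_prop
  have i1 := hN.integral_fderiv_eq_zero hV ht hdiv g1
  have i2 := hN.integral_fderiv_eq_zero hX1 hXt hXdiv g2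
  have i3 := hN.integral_fderiv_eq_zero hV ht hdiv g3
  have hpt : ∀ x ∈ frontier O, (srot N V x - Ω * N x 2) * fderiv ℝ Ξ x (V x) =
      fderiv ℝ (fun x => ⟪V x, V x⟫ * 2⁻¹) x (X3 x) - fderiv ℝ (fun x => ⟪V x, X3 x⟫) x (V x) +
        fderiv ℝ (fun x : E3 => (x 0 ^ 2 + x 1 ^ 2) * 2⁻¹ * Ω) x (V x) := by
    intro x hx
    have hgrad := hN.fderiv_rotation_potential hΞX hx (ht x hx)
    have a1 := hN.inner_advection hx (hVd x) (ht x hx) (hXt x hx)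
    have a2 := chi_mul_inner_cross_X3 (hN.inner_self hx) (hXt x hx) (ht x hx)
    have d1 : fderiv ℝ (fun x => ⟪V x, V x⟫ * 2⁻¹) x (X3 x) = ⟪fderiv ℝ V x (X3 x), V x⟫ := by
      have d := ((hVd x).hasFDerivAt.inner ℝ (hVd x).hasFDerivAt).mul_const (2⁻¹ : ℝ)
      rw [d.fderiv]
      simp [fderivInnerCLM_apply, real_inner_comm (V x)]
      ring
    have d2 : fderiv ℝ (fun x => ⟪V x, X3 x⟫) x (V x) = ⟪fderiv ℝ V x (V x), X3 x⟫ := by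
      have d := (hVd x).hasFDerivAt.inner ℝ (hX1.differentiable one_ne_zero x).hasFDerivAt
      rw [d.fderiv]
      simp [fderivInnerCLM_apply, fderiv_X3, inner_X3_rotation_zero]
    have d3 : fderiv ℝ (fun x : E3 => (x 0 ^ 2 + x 1 ^ 2) * 2⁻¹ * Ω) x (V x) =
        Ω * (x 0 * V x 0 + x 1 * V x 1) := by
      have p0 := (EuclideanSpace.proj (𝕜 := ℝ) (0 : Fin 3)).hasFDerivAt (x := x)
      have p1 := (EuclideanSpace.proj (𝕜 := ℝ) (1 : Fin 3)).hasFDerivAt (x := x)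
      have d : HasFDerivAt (fun x : E3 => (x 0 ^ 2 + x 1 ^ 2) * 2⁻¹ * Ω) _ x :=
        (((p0.pow 2).add (p1.pow 2)).mul_const (2⁻¹ : ℝ)).mul_const Ω
      rw [d.fderiv]
      simp
      ring
    have a3 : ⟪crossL (N x) (V x), X3 x⟫ = -⟪crossL (N x) (X3 x), V x⟫ := by
      rw [inner_crossL_triple, real_inner_comm]
    rw [a3] at a1
    rw [d1, d2, d3, hgrad]
    linear_combination a1 - Ω * a2
  rw [hN.integral_congr hpt, integral_add, integral_sub, i1, i2, i3]
  · simp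
  · exact hN.integrable_of_continuous ((g2.continuous_fderiv one_ne_zero).clm_apply hX1.continuous)
  · exact hN.integrable_of_continuous ((g1.continuous_fderiv one_ne_zero).clm_apply hV.continuous)
  · exact hN.integrable_of_continuous
      (((g2.continuous_fderiv one_ne_zero).clm_apply hX1.continuous).sub
        ((g1.continuous_fderiv one_ne_zero).clm_apply hV.continuous))
  · exact hN.integrable_of_continuous ((g3.continuous_fderiv one_ne_zero).clm_apply hV.continuous)

end IsNormalField

/-- Conservation of angular momentum. -/
theorem IsFlowExtension.integral_angular_momentum_eq {O : Set E3} {T : ℝ} {u V : ℝ → E3 → E3}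
    (h : IsFlowExtension O T u V) {N : E3 → E3} (hN : IsNormalField O N) {Ω : ℝ}
    (hu : IsEulerSolution O Ω (Ico 0 T) u) {Ξ : E3 → ℝ} (hΞ : ContDiff ℝ ∞ Ξ)
    (hΞX : ∀ x ∈ frontier O, crossL (N x) (sgrad N Ξ x) = -X3 x) {t : ℝ} (ht : t ∈ Ico 0 T) :
    ∫ x, (srot N (V t) x - Ω * N x 2) * Ξ x ∂(areaMeasure O) =
      ∫ x, (srot N (V 0) x - Ω * N x 2) * Ξ x ∂(areaMeasure O) := by
  rcases ht.1.eq_or_lt with h0 | h0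
  · rw [← h0]
  · obtain ⟨L, hL, htr⟩ := h.exists_isTransported hN hu ht.1 ht.2
    have hc : Continuous fun s => ∫ x, (srot N (V (clampTime t s)) x - Ω * N x 2) * Ξ x
        ∂(areaMeasure O) :=
      hN.continuous_integral (f := fun s x => (srot N (V (clampTime t s)) x - Ω * N x 2) * Ξ x)
        (htr.continuous_scalar.mul (hΞ.continuous.comp continuous_snd))
    obtain ⟨c, hc1, hc2⟩ := exists_hasDerivAt_eq_slope _ _ h0 hc.continuousOn
      (fun s hs => htr.weak Ξ hΞ s hs)
    rw [hN.integral_vorticity_mul_fderiv_potential hΞX (htr.contDiff c hc1) (htr.tangent c hc1)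
      (htr.div_free c hc1), clampTime_eq (right_mem_Icc.2 ht.1),
      clampTime_eq (left_mem_Icc.2 ht.1), eq_comm, div_eq_zero_iff] at hc2
    rcases hc2 with hc2 | hc2
    · exact sub_eq_zero.1 hc2
    · linarith

/-! ### The stream function and stability -/

theorem IsRotationalBody.frontier_nonempty {O : Set E3} (hO : IsRotationalBody O) :
    (frontier O).Nonempty := by
  obtain ⟨Φ, -, -, h, -⟩ := hO.diffeo_sphere
  obtain ⟨x, hx⟩ := (NormedSpace.sphere_nonempty (E := E3) (x := 0) (r := 1)).2 zero_le_one
  exact ⟨Φ x, h hx⟩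

theorem h1Norm_nonneg (O : Set E3) (X : E3 → E3) : 0 ≤ h1Norm O X := Real.sqrt_nonneg _

theorem crossL_sgrad (N : E3 → E3) (f : E3 → ℝ) (y : E3) :
    crossL (N y) (sgrad N f y) = crossL (N y) (gradient f y) := by
  rw [sgrad, projT_apply, map_sub, map_smul, crossL_self, smul_zero, sub_zero]

theorem sdiv_sub {N X Y : E3 → E3} {x : E3} (hX : DifferentiableAt ℝ X x)
    (hY : DifferentiableAt ℝ Y x) :
    sdiv N (fun y => X y - Y y) x = sdiv N X x - sdiv N Y x := by
  have h : fderiv ℝ (fun y => X y - Y y) x = fderiv ℝ X x - fderiv ℝ Y x := fderiv_fun_sub hX hY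
  simp only [sdiv, trT_eq_traceL, h, map_sub, sub_apply, inner_sub_right]
  ring

namespace IsNormalField

variable {O : Set E3} {N : E3 → E3} (hN : IsNormalField O N)
include hN

theorem srot_sub {X Y : E3 → E3} {x : E3} (hX : ContDiff ℝ 1 X) (hY : ContDiff ℝ 1 Y) :
    srot N (fun y => X y - Y y) x = srot N X x - srot N Y x := by
  have hX' := (hN.contDiff_cross hX (by simp)).differentiable one_ne_zero x
  have hY' := (hN.contDiff_cross hY (by simp)).differentiable one_ne_zero x
  simp only [srot, map_sub]
  rw [sdiv_sub hX' hY']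
  ring

variable {f F : E3 → ℝ} (hF : ContDiff ℝ ∞ F)
include hF

theorem contDiff_streamField : ContDiff ℝ ∞ fun x => crossL (N x) (gradient F x) :=
  hN.contDiff_cross (contDiff_gradient hF (by simp)) le_rfl

theorem contDiff_laplacian : ContDiff ℝ ∞ (sdiv N (sgrad N F)) := by
  have h1 : ContDiff ℝ ∞ (sgrad N F) := contDiff_sgrad hN.smooth hF (by simp) le_rfl
  have h2 : ContDiff ℝ ∞ (fderiv ℝ (sgrad N F)) := h1.fderiv_right (by simp)
  exact (traceL.contDiff.comp h2).sub (hN.smooth.inner ℝ (h2.clm_apply hN.smooth))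

variable (hFf : ∀ x ∈ frontier O, F x = f x)
include hFf

theorem streamField_eq {x : E3} (hx : x ∈ frontier O) :
    streamField O f x = crossL (N x) (gradient F x) := by
  rw [streamField, rotJ_eq, ← hN.eq x hx,
    hN.surfaceGradient_eq hx (hF.differentiable (by simp) x) hFf, crossL_sgrad]

theorem laplaceBeltrami_eq {x : E3} (hx : x ∈ frontier O) :
    laplaceBeltrami O f x = sdiv N (sgrad N F) x := by
  apply hN.surfaceDiv_eq hx
  · exact (contDiff_sgrad hN.smooth hF (m := 1) (by rw [one_add_one_eq_two]; exact two_le_infty)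
      (by simp)).differentiable one_ne_zero x
  · exact fun y hy => (hN.surfaceGradient_eq hy (hF.differentiable (by simp) y) hFf).symm

/-- An extension of the stationary field with compact support; its curl is `Δf`. -/
theorem exists_streamField_extension : ∃ U : E3 → E3, ContDiff ℝ ∞ U ∧ HasCompactSupport U ∧
    (∀ x ∈ frontier O, U x = streamField O f x) ∧ (∀ x ∈ frontier O, ⟪N x, U x⟫ = 0) ∧
    (∀ x ∈ frontier O, sdiv N U x = 0) ∧
    ∀ x ∈ frontier O, srot N U x = sdiv N (sgrad N F) x := by
  have h0 := hN.contDiff_streamField hF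
  obtain ⟨U, h1, h2, h3⟩ := exists_extension hN.smooth_boundary hN.isCompact le_rfl
    h0.contDiffOn
  have hU : ∀ x, DifferentiableAt ℝ U x := fun x => h1.differentiable (by simp) x
  refine ⟨U, h1, h2, fun x hx => ?_, fun x hx => ?_, fun x hx => ?_, fun x hx => ?_⟩
  · rw [h3 x hx, hN.streamField_eq hF hFf hx]
  · rw [h3 x hx, inner_crossL_left]
  · rw [hN.sdiv_congr hx (hU x) (h0.differentiable (by simp) x) h3]
    exact hN.sdiv_cross_gradient hx (hF.of_le two_le_infty)
  · have d1 : DifferentiableAt ℝ (fun y => crossL (N y) (U y)) x :=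
      (hN.contDiff_cross h1 le_rfl).differentiable (by simp) x
    have d2 : ContDiff ℝ 1 (sgrad N F) := contDiff_sgrad hN.smooth hF
      (by rw [one_add_one_eq_two]; exact two_le_infty) (by simp)
    have d3 : DifferentiableAt ℝ (fun y => (fun _ : E3 => (0 : E3)) y - sgrad N F y) x :=
      (differentiableAt_const 0).sub (d2.differentiable one_ne_zero x)
    rw [srot, hN.sdiv_congr hx d1 d3, sdiv_sub (differentiableAt_const 0)
      (d2.differentiable one_ne_zero x)]
    · simp [sdiv, trT]
    · intro y hy
      rw [h3 y hy, ← crossL_sgrad, crossL_crossL, hN.inner_self hy, sgrad,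
        inner_projT (hN.inner_self hy)]
      simp

end IsNormalField

/-- Stability by the energy–Casimir method. -/
theorem isStableInH1_streamField {O : Set E3} (hO : IsRotationalBody O) {Ω : ℝ} {ξ : E3 → ℝ}
    (hξ : IsRotationPotential O ξ) {f : E3 → ℝ} (hf : ContDiffOn ℝ ∞ f (frontier O))
    {q : ℝ → ℝ} (hq : ∀ x ∈ frontier O, laplaceBeltrami O f x - Ω * chi O x = q (ξ x))
    (hmono : DerivBoundedAwayFromZeroOn q (ξ '' frontier O)) :
    IsStableInH1 O Ω (streamField O f) := by
  obtain ⟨N, hN⟩ := hO.exists_isNormalField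
  have hne := hO.frontier_nonempty
  obtain ⟨F, hF, -, hFf⟩ := exists_extension hN.smooth_boundary hN.isCompact le_rfl hf
  obtain ⟨Ξ, hΞ, -, hΞξ⟩ := exists_extension hN.smooth_boundary hN.isCompact le_rfl hξ.1
  obtain ⟨U, hU, hUc, hUf, hUt, hUd, hUr⟩ := hN.exists_streamField_extension hF hFf
  have hΞX : ∀ x ∈ frontier O, crossL (N x) (sgrad N Ξ x) = -X3 x := by
    intro x hx
    rw [← hξ.2 x hx, rotJ_eq, ← hN.eq x hx,
      hN.surfaceGradient_eq hx (hΞ.differentiable (by simp) x) hΞξ]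
  have hN2 : ContDiff ℝ ∞ fun x => N x 2 :=
    (EuclideanSpace.proj (𝕜 := ℝ) (2 : Fin 3)).contDiff.comp hN.smooth
  let Z : E3 → ℝ := fun x => sdiv N (sgrad N F) x - Ω * N x 2
  have hZ : ContDiff ℝ ∞ Z := (hN.contDiff_laplacian hF).sub (contDiff_const.mul hN2)
  have hqZ : ∀ x ∈ frontier O, Z x = q (Ξ x) := by
    intro x hx
    rw [hΞξ x hx, ← hq x hx, hN.laplaceBeltrami_eq hF hFf hx, chi, ← hN.eq x hx]
  have himg : ξ '' frontier O = Ξ '' frontier O := image_congr fun x hx => (hΞξ x hx).symm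
  rw [himg] at hmono
  obtain ⟨σ, Φ, ψ, k, K, hk, hK, hψ, hΦ, hbreg⟩ := hN.exists_potential hO hΞ hΞX hZ hqZ hmono
  obtain ⟨C, hC, hell⟩ := hN.exists_h1Norm_sq_le hO.curvature_pos
  have hΦc : Continuous Φ := continuous_iff_continuousAt.2 fun z => (hΦ z).continuousAt
  set A := C * (K / k * 2) with hA
  have hA0 : 0 < A := by positivity
  intro ε hε
  -- it is shown below that `‖u t - U‖² ≤ A ‖u 0 - U‖²` in the `H¹` norm
  refine ⟨ε / √(A + 1), by positivity, fun T hT u hu hu0 t ht => ?_⟩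
  obtain ⟨V, hV⟩ := hN.exists_flowExtension hu
  have h0T : (0 : ℝ) ∈ Ico 0 T := ⟨le_rfl, hT⟩
  -- the perturbation at time `s`
  have hX1 : ∀ s ∈ Ico 0 T, ContDiff ℝ 1 fun x => V s x - U x := fun s hs =>
    (hV.contDiff hs).sub (hU.of_le (by simp))
  have hXe : ∀ s, ∀ x ∈ frontier O, V s x - U x = (u s - streamField O f) x := fun s x hx => by
    rw [hV.eq s x hx, hUf x hx]; rfl
  have hXt : ∀ s ∈ Ico 0 T, ∀ x ∈ frontier O, ⟪N x, V s x - U x⟫ = 0 := fun s hs x hx => by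
    rw [inner_sub_right, hV.tangent hN hu hs x hx, hUt x hx, sub_zero]
  have hXc : ∀ s, HasCompactSupport fun x => V s x - U x := fun s =>
    (hV.hasCompactSupport s).sub hUc
  have hXd : ∀ s ∈ Ico 0 T, ∀ x ∈ frontier O, sdiv N (fun x => V s x - U x) x = 0 := by
    intro s hs x hx
    rw [sdiv_sub ((hV.contDiff hs).differentiable one_ne_zero x)
      (hU.differentiable (by simp) x), hV.div_free hN hu hs x hx, hUd x hx, sub_zero]
  let ζ : ℝ → E3 → ℝ := fun s x => srot N (V s) x - Ω * N x 2
  have hζc : ∀ s ∈ Ico 0 T, Continuous (ζ s) := fun s hs =>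
    (hN.continuous_srot (hV.contDiff hs)).sub (continuous_const.mul hN2.continuous)
  have hXr : ∀ s ∈ Ico 0 T, ∀ x ∈ frontier O,
      srot N (fun x => V s x - U x) x = ζ s x - Z x := by
    intro s hs x hx
    rw [hN.srot_sub (hV.contDiff hs) (hU.of_le (by simp)), hUr x hx]
    simp only [ζ, Z]
    ring
  -- the relative energy–Casimir functional
  let H : ℝ → ℝ := fun s => ∫ x, σ * (Φ (ζ s x) - Φ (Z x) - Ξ x * (ζ s x - Z x)) ∂(areaMeasure O)
  have hHi : ∀ s ∈ Ico 0 T, Integrable (fun x => σ * (Φ (ζ s x) - Φ (Z x) -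
      Ξ x * (ζ s x - Z x))) (areaMeasure O) := fun s hs =>
    hN.integrable_of_continuous (continuous_const.mul (((hΦc.comp (hζc s hs)).sub
      (hΦc.comp hZ.continuous)).sub (hΞ.continuous.mul ((hζc s hs).sub hZ.continuous))))
  have hri : ∀ s ∈ Ico 0 T, Integrable (fun x => srot N (fun x => V s x - U x) x ^ 2)
      (areaMeasure O) := fun s hs =>
    hN.integrable_of_continuous ((hN.continuous_srot (hX1 s hs)).pow 2)
  have hHeq : H t = H 0 := by
    have e : ∀ s ∈ Ico 0 T, H s = σ * (∫ x, Φ (ζ s x) ∂(areaMeasure O) -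
        ∫ x, ζ s x * Ξ x ∂(areaMeasure O) - ∫ x, (Φ (Z x) - Z x * Ξ x) ∂(areaMeasure O)) := by
      intro s hs
      have j1 : Integrable (fun x => Φ (ζ s x)) (areaMeasure O) :=
        hN.integrable_of_continuous (hΦc.comp (hζc s hs))
      have j2 : Integrable (fun x => ζ s x * Ξ x) (areaMeasure O) :=
        hN.integrable_of_continuous ((hζc s hs).mul hΞ.continuous)
      have j3 : Integrable (fun x => Φ (Z x) - Z x * Ξ x) (areaMeasure O) :=
        hN.integrable_of_continuous ((hΦc.comp hZ.continuous).sub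
          (hZ.continuous.mul hΞ.continuous))
      have j4 : Integrable (fun x => Φ (ζ s x) - ζ s x * Ξ x) (areaMeasure O) := j1.sub j2
      rw [← integral_sub j1 j2, ← integral_sub j4 j3, ← integral_const_mul]
      exact integral_congr_ae (Filter.Eventually.of_forall fun x => by ring)
    rw [e t ht, e 0 h0T, hV.integral_casimir_eq hN hu hne ht hψ hΦ,
      hV.integral_angular_momentum_eq hN hu hΞ hΞX ht]
  have hlow : k * ∫ x, srot N (fun x => V t x - U x) x ^ 2 ∂(areaMeasure O) ≤ H t := by
    rw [← integral_const_mul]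
    apply integral_mono_ae ((hri t ht).const_mul k) (hHi t ht)
    filter_upwards [hN.ae_mem] with x hx
    rw [hXr t ht x hx]
    exact (hbreg x hx (ζ t x)).1
  have hup : H 0 ≤ K * ∫ x, srot N (fun x => V 0 x - U x) x ^ 2 ∂(areaMeasure O) := by
    rw [← integral_const_mul]
    apply integral_mono_ae (hHi 0 h0T) ((hri 0 h0T).const_mul K)
    filter_upwards [hN.ae_mem] with x hx
    rw [hXr 0 h0T x hx]
    exact (hbreg x hx (ζ 0 x)).2
  have b1 := hell (u t - streamField O f) _ (hX1 t ht) (hXc t) (hXe t) (hXt t ht) (hXd t ht)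
  have b2 := hN.integral_srot_sq_le (hX1 0 h0T) (hXe 0) (hXt 0 h0T)
  have b3 : h1Norm O (u t - streamField O f) ^ 2 ≤
      A * h1Norm O (u 0 - streamField O f) ^ 2 := by
    have c1 : ∫ x, srot N (fun x => V t x - U x) x ^ 2 ∂(areaMeasure O) ≤
        K / k * (2 * h1Norm O (u 0 - streamField O f) ^ 2) := by
      rw [div_mul_eq_mul_div, le_div_iff₀ hk]
      have := mul_le_mul_of_nonneg_left b2 hK.le
      linarith
    calc _ ≤ _ := b1
      _ ≤ C * (K / k * (2 * h1Norm O (u 0 - streamField O f) ^ 2)) := by gcongr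
      _ = _ := by rw [hA]; ring
  have b4 : h1Norm O (u 0 - streamField O f) ^ 2 < (ε / √(A + 1)) ^ 2 :=
    pow_lt_pow_left₀ hu0 (h1Norm_nonneg _ _) two_ne_zero
  rw [div_pow, Real.sq_sqrt (by positivity), lt_div_iff₀ (by positivity)] at b4
  apply lt_of_pow_lt_pow_left₀ 2 hε.le
  nlinarith [sq_nonneg (h1Norm O (u 0 - streamField O f))]

/-! ### Primitives of closed one-forms on `M` -/

/-- Stereographic projection from `v`, transported to `M` by a diffeomorphism: `S` is a
parametrization of `M` without the point `Φ v`, with inverse `T`. -/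
theorem exists_stereographic_chart {O : Set E3} (hO : IsRotationalBody O) {Φ Ψ : E3 → E3}
    (hΦ : ContDiffOn ℝ ∞ Φ (Metric.sphere 0 1))
    (hΦM : MapsTo Φ (Metric.sphere 0 1) (frontier O))
    (hΨ : ContDiffOn ℝ ∞ Ψ (frontier O)) (hΨM : MapsTo Ψ (frontier O) (Metric.sphere 0 1))
    (hinv : InvOn Ψ Φ (Metric.sphere 0 1) (frontier O)) {v : E3} (hv : ‖v‖ = 1) :
    ∃ (S : (ℝ ∙ v)ᗮ → E3) (T : E3 → (ℝ ∙ v)ᗮ), ContDiff ℝ ∞ S ∧ (∀ y, S y ∈ frontier O) ∧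
      (∀ y, S y ≠ Φ v) ∧ S.Injective ∧ S 0 = Φ (-v) ∧
      ∀ x ∈ frontier O, x ≠ Φ v → ContDiffAt ℝ ∞ T x ∧ S (T x) = x := by
  have hvs : v ∈ Metric.sphere (0 : E3) 1 := mem_sphere_zero_iff_norm.2 hv
  obtain ⟨Ψ', hΨ'⟩ : ∃ Ψ' : E3 → E3, ContDiff ℝ ∞ Ψ' ∧ ∀ x ∈ frontier O, Ψ' x = Ψ x := by
    obtain ⟨Ψ', h1, -, h2⟩ := exists_extension hO.smooth_boundary hO.isCompact le_rfl hΨ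
    exact ⟨Ψ', h1, h2⟩
  have hinj : InjOn Φ (Metric.sphere 0 1) := hinv.1.injOn
  refine ⟨fun y => Φ (stereoInvFun hv y), fun x => stereoToFun v (Ψ' x), ?_, fun y => ?_,
    fun y h => ?_, fun y z h => ?_, ?_, fun x hx hne => ⟨?_, ?_⟩⟩
  · have h1 : ContDiff ℝ ∞ fun y : (ℝ ∙ v)ᗮ => stereoInvFunAux v (y : E3) :=
      contDiff_stereoInvFunAux.comp (ℝ ∙ v)ᗮ.subtypeL.contDiff
    exact contDiffOn_univ.1 (hΦ.comp h1.contDiffOn fun y _ => (stereoInvFun hv y).2)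
  · exact hΦM (stereoInvFun hv y).2
  · exact stereoInvFun_ne_north_pole hv y (Subtype.ext (hinj (stereoInvFun hv y).2 hvs h))
  · have h1 : stereoInvFun hv y = stereoInvFun hv z :=
      Subtype.ext (hinj (stereoInvFun hv y).2 (stereoInvFun hv z).2 h)
    rw [← stereo_right_inv hv y, h1, stereo_right_inv]
  · show Φ _ = _
    congr 1
    rw [stereoInvFun_apply]
    simp [smul_smul]
  · have h1 : Ψ' x ≠ v := by
      rw [hΨ'.2 x hx]
      intro h
      exact hne (by rw [← h, hinv.2 hx])
    have h2 : innerSL ℝ v (Ψ' x) ≠ 1 := by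
      rw [innerSL_apply_apply]
      intro h
      apply h1
      have h3 : ‖Ψ' x‖ = 1 := by
        rw [hΨ'.2 x hx]; exact mem_sphere_zero_iff_norm.1 (hΨM hx)
      exact ((inner_eq_one_iff_of_norm_eq_one hv h3).1 h).symm
    have h3 : IsOpen {y : E3 | innerSL ℝ v y ≠ 1} :=
      isOpen_ne_fun (innerSL ℝ v).continuous continuous_const
    exact ((contDiffOn_stereoToFun (v := v)).contDiffAt (h3.mem_nhds h2)).comp x hΨ'.1.contDiffAt
  · have h1 : Ψ x ≠ v := fun h => hne (by rw [← h, hinv.2 hx])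
    show Φ (stereoInvFun hv (stereoToFun v (Ψ' x))) = x
    rw [hΨ'.2 x hx, stereo_left_inv hv (x := ⟨Ψ x, hΨM hx⟩) h1]
    exact hinv.2 hx

namespace IsNormalField

open Topology Filter

variable {O : Set E3} {N : E3 → E3} (hN : IsNormalField O N)
include hN

/-- A closed form `Z dF` has a primitive on a subset of `M` that is parametrized by a vector
space. -/
theorem exists_primitive_of_chart {Z F : E3 → ℝ} (hZ : ContDiff ℝ ∞ Z) (hF : ContDiff ℝ ∞ F)
    (hcl : ∀ x ∈ frontier O, ∀ v w, ⟪N x, v⟫ = 0 → ⟪N x, w⟫ = 0 →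
      fderiv ℝ Z x v * fderiv ℝ F x w = fderiv ℝ Z x w * fderiv ℝ F x v)
    {E : Type*} [NormedAddCommGroup E] [NormedSpace ℝ E] {S : E → E3} {T : E3 → E} {a : E3}
    (hS : ContDiff ℝ ∞ S) (hSM : ∀ y, S y ∈ frontier O)
    (hT : ∀ x ∈ frontier O, x ≠ a → ContDiffAt ℝ ∞ T x ∧ S (T x) = x) :
    ∃ R : E3 → ℝ, ∀ x ∈ frontier O, x ≠ a → ContDiffAt ℝ 1 R x ∧
      ∀ w, ⟪N x, w⟫ = 0 → fderiv ℝ R x w = Z x * fderiv ℝ F x w := by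
  have hSd : ∀ y, HasFDerivAt S (fderiv ℝ S y) y := fun y =>
    (hS.differentiable (by simp) y).hasFDerivAt
  have hFS : ContDiff ℝ ∞ fun y => F (S y) := hF.comp hS
  have hZS : ContDiff ℝ ∞ fun y => Z (S y) := hZ.comp hS
  have hFSd : ∀ y, fderiv ℝ (fun y => F (S y)) y = fderiv ℝ F (S y) ∘L fderiv ℝ S y := fun y =>
    ((hF.differentiable (by simp) _).hasFDerivAt.comp y (hSd y)).fderiv
  have hZSd : ∀ y, fderiv ℝ (fun y => Z (S y)) y = fderiv ℝ Z (S y) ∘L fderiv ℝ S y := fun y =>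
    ((hZ.differentiable (by simp) _).hasFDerivAt.comp y (hSd y)).fderiv
  have hSt : ∀ y w, ⟪N (S y), fderiv ℝ S y w⟫ = 0 := fun y w =>
    hN.inner_normal_of_mapsTo (hSd y) (Eventually.of_forall hSM) w
  have hFS' : ContDiff ℝ ∞ (fderiv ℝ fun y => F (S y)) := hFS.fderiv_right (by simp)
  let β : E → E →L[ℝ] ℝ := fun y => Z (S y) • fderiv ℝ (fun y => F (S y)) y
  have hβ : ContDiff ℝ ∞ β := hZS.smul hFS'
  obtain ⟨G, hG⟩ := convex_univ.exists_forall_hasFDerivAt_of_fderiv_symmetric isOpen_univ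
    (hβ.differentiable (by simp)).differentiableOn (fun y _ v w => by
      have h1 : HasFDerivAt β _ y := (hZS.differentiable (by simp) y).hasFDerivAt.smul
        (hFS'.differentiable (by simp) y).hasFDerivAt
      have h2 := (hFS.contDiffAt (x := y)).isSymmSndFDerivAt
        (by simpa using two_le_infty) |>.eq v w
      have h3 := hcl (S y) (hSM y) _ _ (hSt y v) (hSt y w)
      rw [h1.fderiv]
      simp only [add_apply, smul_apply, ContinuousLinearMap.smulRight_apply, h2, hFSd, hZSd,
        ContinuousLinearMap.comp_apply, smul_eq_mul]
      rw [h3])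
  have hG1 : ContDiff ℝ 1 G := by
    rw [contDiff_one_iff_fderiv]
    refine ⟨fun y => (hG y (mem_univ y)).differentiableAt, ?_⟩
    have : fderiv ℝ G = β := funext fun y => (hG y (mem_univ y)).fderiv
    rw [this]
    exact hβ.continuous
  refine ⟨fun x => G (T x), fun x hx hxa => ⟨?_, fun w hw => ?_⟩⟩
  · exact hG1.contDiffAt.comp x ((hT x hx hxa).1.of_le (by simp))
  · have hTd := ((hT x hx hxa).1.differentiableAt (by simp)).hasFDerivAt
    have hTx := (hT x hx hxa).2
    have h1 : HasFDerivAt (fun x => G (T x)) (β (T x) ∘L fderiv ℝ T x) x :=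
      (hG (T x) (mem_univ _)).comp x hTd
    have h2 : HasFDerivAt (fun x => S (T x)) (fderiv ℝ S (T x) ∘L fderiv ℝ T x) x :=
      (hSd (T x)).comp x hTd
    have h3 : (fun x => S (T x)) =ᶠ[𝓝[frontier O] x] fun x => x := by
      filter_upwards [self_mem_nhdsWithin, mem_nhdsWithin_of_mem_nhds (isOpen_ne.mem_nhds hxa)]
        with z hz hza using (hT z hz hza).2
    have h4 := fderiv_eq_of_tangent hN.smooth_boundary hx h2.hasFDerivWithinAt
      (hasFDerivAt_id x).hasFDerivWithinAt h3 (by rw [← hN.eq x hx]; exact hw)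
    rw [ContinuousLinearMap.comp_apply] at h4
    rw [h1.fderiv]
    simp only [β, hFSd, ContinuousLinearMap.comp_apply, smul_apply, smul_eq_mul, h4, hTx]
    rfl

/-- A closed form `Z dF` on `M` is exact. -/
theorem exists_primitive (hO : IsRotationalBody O) {Z F : E3 → ℝ} (hZ : ContDiff ℝ ∞ Z)
    (hF : ContDiff ℝ ∞ F)
    (hcl : ∀ x ∈ frontier O, ∀ v w, ⟪N x, v⟫ = 0 → ⟪N x, w⟫ = 0 →
      fderiv ℝ Z x v * fderiv ℝ F x w = fderiv ℝ Z x w * fderiv ℝ F x v) :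
    ∃ Q : E3 → ℝ, ContDiff ℝ 1 Q ∧
      ∀ x ∈ frontier O, ∀ w, ⟪N x, w⟫ = 0 → fderiv ℝ Q x w = Z x * fderiv ℝ F x w := by
  obtain ⟨Φ, Ψ, hΦ, hΦM, hΨ, hΨM, hinv⟩ := hO.diffeo_sphere
  obtain ⟨v, hv⟩ := (NormedSpace.sphere_nonempty (E := E3) (x := 0) (r := 1)).2 zero_le_one
  have hv1 : ‖v‖ = 1 := mem_sphere_zero_iff_norm.1 hv
  have hv0 : v ≠ 0 := norm_ne_zero_iff.1 (by rw [hv1]; exact one_ne_zero)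
  obtain ⟨S, T, hS, hSM, hSa, hSi, hS0, hT⟩ :=
    exists_stereographic_chart hO hΦ hΦM hΨ hΨM hinv hv1
  obtain ⟨S', T', hS', hSM', -, -, -, hT'⟩ :=
    exists_stereographic_chart hO hΦ hΦM hΨ hΨM hinv (v := -v) (by rw [norm_neg, hv1])
  obtain ⟨R, hR⟩ := hN.exists_primitive_of_chart hZ hF hcl hS hSM hT
  obtain ⟨R', hR'⟩ := hN.exists_primitive_of_chart hZ hF hcl hS' hSM' hT'
  set a := Φ v
  set b := Φ (-v)
  have hab : b ≠ a := hS0 ▸ hSa 0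
  have hSb : ∀ y, y ≠ 0 → S y ≠ b := fun y hy h => hy (hSi (h.trans hS0.symm))
  -- the two primitives differ by a constant on the connected set `M \ {a, b}`
  obtain ⟨c, hc⟩ : ∃ c, ∀ y ∈ ({0}ᶜ : Set (ℝ ∙ v)ᗮ), R (S y) - R' (S y) = c := by
    have hrank : 1 < Module.rank ℝ (ℝ ∙ v)ᗮ := by
      have : Fact (Module.finrank ℝ E3 = 2 + 1) := ⟨by simp⟩
      rw [← Module.finrank_eq_rank, Submodule.finrank_orthogonal_span_singleton (n := 2) hv0]
      norm_num
    have hd : ∀ y ∈ ({0}ᶜ : Set (ℝ ∙ v)ᗮ), HasFDerivAt (fun y => R (S y) - R' (S y))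
        (0 : (ℝ ∙ v)ᗮ →L[ℝ] ℝ) y := by
      intro y hy
      have hSd : HasFDerivAt S (fderiv ℝ S y) y := (hS.differentiable (by simp) y).hasFDerivAt
      have h1 := hR (S y) (hSM y) (hSa y)
      have h2 := hR' (S y) (hSM y) (hSb y hy)
      have h3 : HasFDerivAt (fun y => R (S y)) _ y :=
        (h1.1.differentiableAt one_ne_zero).hasFDerivAt.comp y hSd
      have h4 : HasFDerivAt (fun y => R' (S y)) _ y :=
        (h2.1.differentiableAt one_ne_zero).hasFDerivAt.comp y hSd
      have h5 : HasFDerivAt (fun y => R (S y) - R' (S y)) _ y := h3.sub h4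
      apply h5.congr_fderiv
      ext w
      have h6 := hN.inner_normal_of_mapsTo hSd (Eventually.of_forall hSM) w
      simp only [sub_apply, ContinuousLinearMap.comp_apply, h1.2 _ h6, h2.2 _ h6, sub_self,
        zero_apply]
    exact isOpen_compl_singleton.exists_is_const_of_fderiv_eq_zero
      (isConnected_compl_singleton_of_one_lt_rank hrank 0).isPreconnected
      (fun y hy => (hd y hy).differentiableAt.differentiableWithinAt)
      (fun y hy => (hd y hy).fderiv)
  have hRR : ∀ x ∈ frontier O, x ≠ a → x ≠ b → R x = R' x + c := by
    intro x hx hxa hxb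
    have h1 := hc (T x) (fun h => hxb (by
      rw [← (hT x hx hxa).2, mem_singleton_iff.1 h, hS0]))
    rw [(hT x hx hxa).2] at h1
    linarith
  classical
  let Q₀ : E3 → ℝ := fun x => if x = a then R' x + c else R x
  have hQR : ∀ x, x ≠ a → Q₀ =ᶠ[𝓝 x] R := by
    intro x hx
    filter_upwards [isOpen_ne.mem_nhds hx] with z hz using if_neg hz
  have hQR' : ∀ x, x = a → Q₀ =ᶠ[𝓝[frontier O] x] fun z => R' z + c := by
    intro x hx
    have hxb : x ≠ b := hx ▸ hab.symm
    filter_upwards [self_mem_nhdsWithin, mem_nhdsWithin_of_mem_nhds (isOpen_ne.mem_nhds hxb)]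
      with z hz hzb
    by_cases hza : z = a
    · exact if_pos hza
    · exact (if_neg hza).trans (hRR z hz hza hzb)
  have hQ₀ : ContDiffOn ℝ 1 Q₀ (frontier O) := by
    intro x hx
    by_cases hxa : x = a
    · have hxb : x ≠ b := hxa ▸ hab.symm
      have h1 : ContDiffAt ℝ 1 (fun z => R' z + c) x := (hR' x hx hxb).1.add contDiffAt_const
      exact h1.contDiffWithinAt.congr_of_eventuallyEq (hQR' x hxa) (if_pos hxa)
    · exact ((hR x hx hxa).1.congr_of_eventuallyEq (hQR x hxa)).contDiffWithinAt
  obtain ⟨Q, hQ, -, hQQ⟩ := exists_extension hN.smooth_boundary hN.isCompact (by simp) hQ₀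
  refine ⟨Q, hQ, fun x hx w hw => ?_⟩
  have hQd := (hQ.differentiable one_ne_zero x).hasFDerivAt
  have hQe : Q =ᶠ[𝓝[frontier O] x] Q₀ := by
    filter_upwards [self_mem_nhdsWithin] with z hz using hQQ z hz
  have hw' : ⟪outwardNormal O x, w⟫ = 0 := by rw [← hN.eq x hx]; exact hw
  by_cases hxa : x = a
  · have h1 := hR' x hx (hxa ▸ hab.symm)
    rw [← h1.2 w hw]
    exact fderiv_eq_of_tangent hN.smooth_boundary hx hQd.hasFDerivWithinAt
      ((h1.1.differentiableAt one_ne_zero).hasFDerivAt.add_const c).hasFDerivWithinAt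
      (hQe.trans (hQR' x hxa)) hw'
  · have h1 := hR x hx hxa
    rw [← h1.2 w hw]
    exact fderiv_eq_of_tangent hN.smooth_boundary hx hQd.hasFDerivWithinAt
      (h1.1.differentiableAt one_ne_zero).hasFDerivAt.hasFDerivWithinAt
      (hQe.trans ((hQR x hxa).filter_mono nhdsWithin_le_nhds)) hw'

end IsNormalField

/-! ### The stationary solution -/

theorem hasDerivAt_rotation (x : E3) : HasDerivAt (fun s => rotation s x) (X3 x) 0 := by
  have h1 : (fun s => rotation s x) = fun s => Real.cos s • (!₂[x 0, x 1, 0] : E3) +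
      Real.sin s • X3 x + (!₂[0, 0, x 2] : E3) := by
    funext s
    ext i; fin_cases i <;> simp [rotation, X3] <;> ring
  rw [h1]
  have h2 := (((Real.hasDerivAt_cos 0).smul_const (!₂[x 0, x 1, 0] : E3)).add
    ((Real.hasDerivAt_sin 0).smul_const (X3 x))).add_const (!₂[0, 0, x 2] : E3)
  exact h2.congr_deriv (by simp)

theorem rotation_zero (x : E3) : rotation 0 x = x := by
  ext i; fin_cases i <;> simp [rotation]

/-- Zonal functions are annihilated by the rotation field. -/
theorem fderiv_X3_eq_zero {O : Set E3} (hO : IsRotationalBody O) {f F : E3 → ℝ}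
    (hf : IsSmoothZonal O f) {x : E3} (hF : DifferentiableAt ℝ F x)
    (hFf : ∀ x ∈ frontier O, F x = f x) (hx : x ∈ frontier O) : fderiv ℝ F x (X3 x) = 0 := by
  have h0 : HasFDerivAt F (fderiv ℝ F x) (rotation 0 x) := by
    rw [rotation_zero]; exact hF.hasFDerivAt
  have h1 : HasDerivAt (fun s => F (rotation s x)) (fderiv ℝ F x (X3 x)) 0 :=
    h0.comp_hasDerivAt 0 (hasDerivAt_rotation x)
  have h2 : (fun s => F (rotation s x)) = fun _ => f x := funext fun s => by
    rw [hFf _ (hO.rotation_invariant s x hx), hf.2 s x hx]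
  rw [h2] at h1
  exact h1.unique (hasDerivAt_const 0 (f x))

/-- The linear relation between three vectors of a plane. -/
theorem IsFrame.cross_relation {n e₁ e₂ a v w : E3} (h : IsFrame n e₁ e₂) (ha : ⟪n, a⟫ = 0)
    (hv : ⟪n, v⟫ = 0) (hw : ⟪n, w⟫ = 0) :
    ⟪crossL n a, v⟫ • w - ⟪crossL n a, w⟫ • v = -⟪crossL n v, w⟫ • a := by
  rw [h.expand_tangent ha, h.expand_tangent hv, h.expand_tangent hw]
  simp only [map_add, map_smul, inner_add_left, inner_add_right, real_inner_smul_left,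
    real_inner_smul_right, h.cross1, h.cross2, inner_neg_left, h.e11, h.e22, h.e12, h.e21]
  module

/-- For zonal `f` the form `ζ df` is closed, where `ζ = q(ξ)` is the absolute vorticity: both `dζ`
and `df` vanish on `X₃`. -/
theorem IsNormalField.fderiv_mul_fderiv_comm {O : Set E3} {N : E3 → E3} (hN : IsNormalField O N)
    (hO : IsRotationalBody O) {Ξ Z f F : E3 → ℝ} (hΞ : ContDiff ℝ ∞ Ξ)
    (hΞX : ∀ x ∈ frontier O, crossL (N x) (sgrad N Ξ x) = -X3 x) (hZ : ContDiff ℝ ∞ Z)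
    {q : ℝ → ℝ} (hq : ∀ x ∈ frontier O, Z x = q (Ξ x))
    (hqd : DifferentiableOn ℝ q (Ξ '' frontier O)) (hf : IsSmoothZonal O f)
    (hF : ContDiff ℝ ∞ F) (hFf : ∀ x ∈ frontier O, F x = f x) {x v w : E3}
    (hx : x ∈ frontier O) (hv : ⟪N x, v⟫ = 0) (hw : ⟪N x, w⟫ = 0) :
    fderiv ℝ Z x v * fderiv ℝ F x w = fderiv ℝ Z x w * fderiv ℝ F x v := by
  have h1 := (hqd (Ξ x) (mem_image_of_mem Ξ hx)).hasDerivWithinAt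
  have h2 := fun {v} hv => hN.fderiv_eq_of_eq_comp (v := v) hx (hΞ.differentiable (by simp) x)
    (hZ.differentiable (by simp) x) (mapsTo_image Ξ (frontier O)) hq h1 hv
  rw [h2 hv, h2 hw, hN.fderiv_rotation_potential hΞX hx hv,
    hN.fderiv_rotation_potential hΞX hx hw]
  obtain ⟨e₁, e₂, h⟩ := hN.exists_frame hx
  have h3 := congrArg (fderiv ℝ F x) (h.cross_relation (inner_X3_eq_zero hΞX hx) hv hw)
  rw [map_sub, map_smul, map_smul, map_smul,
    fderiv_X3_eq_zero hO hf (hF.differentiable (by simp) x) hFf hx, smul_zero, smul_eq_mul,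
    smul_eq_mul] at h3
  linear_combination derivWithin q (Ξ '' frontier O) (Ξ x) * h3

/-- The zonal flow is stationary: its pressure is a primitive of `ζ df`, minus `|u|² / 2`. -/
theorem isStationarySolution_streamField {O : Set E3} (hO : IsRotationalBody O) {Ω : ℝ}
    {ξ : E3 → ℝ} (hξ : IsRotationPotential O ξ) {f : E3 → ℝ} (hf : IsSmoothZonal O f) {q : ℝ → ℝ}
    (hq : ∀ x ∈ frontier O, laplaceBeltrami O f x - Ω * chi O x = q (ξ x))
    (hqd : DifferentiableOn ℝ q (ξ '' frontier O)) :
    IsStationarySolution O Ω (streamField O f) := by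
  obtain ⟨N, hN⟩ := hO.exists_isNormalField
  obtain ⟨F, hF, -, hFf⟩ := exists_extension hN.smooth_boundary hN.isCompact le_rfl hf.1
  obtain ⟨Ξ, hΞ, -, hΞξ⟩ := exists_extension hN.smooth_boundary hN.isCompact le_rfl hξ.1
  obtain ⟨U, hU, -, hUf, hUt, hUd, hUr⟩ := hN.exists_streamField_extension hF hFf
  have hΞX : ∀ x ∈ frontier O, crossL (N x) (sgrad N Ξ x) = -X3 x := by
    intro x hx
    rw [← hξ.2 x hx, rotJ_eq, ← hN.eq x hx,
      hN.surfaceGradient_eq hx (hΞ.differentiable (by simp) x) hΞξ]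
  let Z : E3 → ℝ := fun x => sdiv N (sgrad N F) x - Ω * N x 2
  have hZ : ContDiff ℝ ∞ Z := (hN.contDiff_laplacian hF).sub (contDiff_const.mul
    ((EuclideanSpace.proj (𝕜 := ℝ) (2 : Fin 3)).contDiff.comp hN.smooth))
  have hqZ : ∀ x ∈ frontier O, Z x = q (Ξ x) := by
    intro x hx
    rw [hΞξ x hx, ← hq x hx, hN.laplaceBeltrami_eq hF hFf hx, chi, ← hN.eq x hx]
  have himg : ξ '' frontier O = Ξ '' frontier O := image_congr fun x hx => (hΞξ x hx).symm
  rw [himg] at hqd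
  obtain ⟨Q, hQ, hQZ⟩ := hN.exists_primitive hO hZ hF fun x hx v w hv hw =>
    hN.fderiv_mul_fderiv_comm hO hΞ hΞX hZ hqZ hqd hf hF hFf hx hv hw
  have hUd' : ∀ x, DifferentiableAt ℝ U x := fun x => hU.differentiable (by simp) x
  let P : E3 → ℝ := fun x => Q x - ⟪U x, U x⟫ * 2⁻¹
  have hP : ContDiff ℝ 1 P := hQ.sub (((hU.inner ℝ hU).of_le (by simp)).mul contDiff_const)
  refine ⟨?_, fun t _ x hx => ?_, fun t _ x hx => ?_, fun _ => P, fun t _ => hP.contDiffOn,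
    fun t _ x hx => ?_⟩
  · have h1 : ContDiff ℝ 1 fun z : ℝ × E3 => U z.2 := (hU.of_le (by simp)).comp contDiff_snd
    exact h1.contDiffOn.congr fun z hz => (hUf z.2 hz.2).symm
  · rw [hN.mem_tangentPlane hx, ← hUf x hx, hUt x hx]
  · rw [hN.surfaceDiv_eq hx (hUd' x) hUf, hUd x hx]
  have hnn := hN.inner_self hx
  have hc : derivWithin (fun _ : ℝ => streamField O f x) univ t = 0 := by simp
  rw [hc, zero_add, ← hUf x hx, hN.covDerivAlong_eq hx (hUd' x) hUf (hUt x hx), rotJ_eq,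
    ← hN.eq x hx, chi, ← hN.eq x hx,
    hN.surfaceGradient_eq hx (hP.differentiable one_ne_zero x) fun _ _ => rfl]
  have hP' : ∀ w, fderiv ℝ P x w = fderiv ℝ Q x w - ⟪fderiv ℝ U x w, U x⟫ := by
    intro w
    have d1 := ((hUd' x).hasFDerivAt.inner ℝ (hUd' x).hasFDerivAt).mul_const (2⁻¹ : ℝ)
    have d2 : HasFDerivAt P _ x := (hQ.differentiable one_ne_zero x).hasFDerivAt.sub d1
    rw [d2.fderiv]
    simp [fderivInnerCLM_apply, real_inner_comm (U x)]
    ring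
  -- the equation tested with a tangent vector
  have key : ∀ w, ⟪w, N x⟫ = 0 → ⟪w, projT (N x) (fderiv ℝ U x (U x))⟫ =
      ⟪w, (Ω * N x 2) • crossL (N x) (U x) - sgrad N P x⟫ := by
    intro w hw
    have hw' : ⟪N x, w⟫ = 0 := by rw [real_inner_comm]; exact hw
    have h1 : ⟪crossL (N x) (U x), w⟫ = -fderiv ℝ F x w := by
      rw [hUf x hx, hN.streamField_eq hF hFf hx, inner_crossL_triple, inner_crossL_crossL, hnn,
        hw', ← inner_gradient]
      ring
    have h2 := hN.inner_advection hx (hUd' x) (hUt x hx) hw'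
    rw [h1, hUr x hx] at h2
    rw [inner_projT_of_inner hw, inner_sub_right, real_inner_smul_right, sgrad,
      inner_projT_of_inner hw, real_inner_comm, h2, real_inner_comm _ w, h1,
      real_inner_comm _ w, inner_gradient, hP', hQZ x hx w hw']
    simp only [Z]
    ring
  obtain ⟨e₁, e₂, h⟩ := hN.exists_frame hx
  refine h.ext_inner (key e₁ h.e1n) (key e₂ h.e2n) ?_
  rw [inner_projT hnn, inner_sub_right, real_inner_smul_right, inner_crossL_left, sgrad,
    inner_projT hnn, mul_zero, sub_zero]

theorem DerivBoundedAwayFromZeroOn.differentiableOn {q : ℝ → ℝ} {S : Set ℝ}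
    (h : DerivBoundedAwayFromZeroOn q S) : DifferentiableOn ℝ q S := by
  obtain ⟨b, hb, h⟩ := h
  intro s hs
  by_contra hnd
  have h1 := h s hs
  rw [derivWithin_zero_of_not_differentiableWithinAt hnd, abs_zero] at h1
  linarith

end RotatingSurface

end

open RotatingSurface in
theorem theorem4p1p1 (O : Set E3) (hO : IsRotationalBody O) (Ω : ℝ)
    (ξ : E3 → ℝ) (hξ : IsRotationPotential O ξ)
    (f : E3 → ℝ) (hf : IsSmoothZonal O f)
    (q : ℝ → ℝ)
    (hq : ∀ x ∈ frontier O, laplaceBeltrami O f x - Ω * chi O x = q (ξ x))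
    (hmono : DerivBoundedAwayFromZeroOn q (ξ '' frontier O)) :
    IsStationarySolution O Ω (streamField O f) ∧ IsStableInH1 O Ω (streamField O f) :=
  ⟨isStationarySolution_streamField hO hξ hf hq hmono.differentiableOn,
    isStableInH1_streamField hO hξ hf.1 hq hmono⟩
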